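/- Let $\mathbf F_q$ be a finite field with $q$ elements and algebraic closure $\bar{\mathbf F}_q$, and let $\mathcal X$ be a projective, irreducible, non-singular algebraic curve over $\bar{\mathbf F}_q$ of genus $g$ that is defined over $\mathbf F_q$, i.e. $\mathcal X\subseteq\mathbf P^n(\bar{\mathbf F}_q)$ for some $n$ and the homogeneous ideal of $\mathcal X$ is generated by polynomials with coefficients in $\mathbf F_q$. Let $\Phi_q:\mathcal X\to\mathcal X$ be the Frobenius morphism relative to $\mathbf F_q$, which raises homogeneous coordinates to the $q$-th power; let $\mathcal X(\mathbf F_q)$ be the set of points of $\mathcal X$ with homogeneous coordinates in $\mathbf F_q$, and $\mathbf F_q(\mathcal X)\subseteq\bar{\mathbf F}_q(\mathcal X)$ the field of rational functions defined over $\mathbf F_q$. Let $r\ge 1$ and let $\mathcal D$ be a base-point-free linear series on $\mathcal X$ of dimension $r$ and degree $d$ (a $g^r_d$), that is, $\mathcal D=\{E+\operatorname{div}(f): 0\ne f\in\mathcal D'\}$ for a divisor $E$ of degree $d$ and an $(r+1)$-dimensional $\bar{\mathbf F}_q$-subspace $\mathcal D'$ of $L(E)=\{f: f=0 \text{ or }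 E+\operatorname{div}(f)\ge 0\}$, and no point of $\mathcal X$ lies in the support of all $D\in\mathcal D$. Assume that $\mathcal D$ is defined over $\mathbf F_q$, i.e. $\sum_P n_P\Phi_q(P)\in\mathcal D$ whenever $\sum_P n_PP\in\mathcal D$. Let $\nu_0<\dots<\nu_{r-1}$ be the $\mathbf F_q$-Frobenius orders of $\mathcal D$, defined as follows. Choose $E$ and $\mathcal D'$ such that $\mathcal D'$ has a basis $f_0,\dots,f_r$ with all $f_j\in\mathbf F_q(\mathcal X)$, and choose a separating variable $x$ of $\bar{\mathbf F}_q(\mathcal X)\,|\,\bar{\mathbf F}_q$; let $D^i_x$ denote the $i$-th Hasse derivative on $\bar{\mathbf F}_q(\mathcal X)$ with respect to $x$. Then $(\nu_0,\dots,\nu_{r-1})$ is the lexicographically smallest tuple of integers $0\le m_0<\dots<m_{r-1}$ for which $$\det\begin{pmatrix} f_0\circ\Phi_q&\cdots&f_r\circ\Phi_q\\ D^{m_0}_xf_0&\cdots&D^{m_0}_xf_r\\ \vdots&&\vdots\\ D^{m_{r-1}}_xf_0&\cdots&D^{m_{r-1}}_xf_r\end{pmatrix}\ne 0$$ (this does not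 depend on the choices of $E$, $f_0,\dots,f_r$ and $x$). Then $$\#\mathcal X(\mathbf F_q)\le\frac{\left(\sum_{i=0}^{r-1}\nu_i\right)(2g-2)+(q+r)d}{r}.$$ -/

import Mathlib

open scoped LinearAlgebra.Projectivization

namespace StohrVoloch

section Taylor

open scoped PowerSeries IntermediateField

variable (F : Type*) {K : Type*} [Field F] [Field K] [Algebra F K]

/-- `x` is a separating variable of `K | F`: it is transcendental over `F` and `K | F(x)` is a
separable algebraic extension. -/
structure IsSeparatingVariable (x : K) : Prop where
  transcendental : Transcendental F x
  separable : Algebra.IsSeparable F⟮x⟯ K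

/-- `η : K → K⟦T⟧`, `f ↦ ∑ Dⁱ(f) Tⁱ`, is the homomorphism of `F`-algebras that encodes the Hasse
derivatives with respect to `x`. Multiplicativity of `η` is the product rule, and the two conditions
say `D⁰ = id`, `D¹ x = 1` and `Dⁱ x = 0` for `i ≥ 2`. If `x` is a separating variable, these
properties determine `η`. -/
structure IsTaylorHom (x : K) (η : K →ₐ[F] K⟦X⟧) : Prop where
  constantCoeff : ∀ f, PowerSeries.constantCoeff (η f) = f
  apply_self : η x = PowerSeries.C x + PowerSeries.X

open Polynomial in
theorem exists_lift {A : Type*} [CommRing A] [Algebra F A] (I : Ideal A) [IsAdicComplete I A]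
    (x : K) (hx : IsSeparatingVariable F x) (s : K →ₐ[F] A ⧸ I) (a : A)
    (ha : Ideal.Quotient.mk I a = s x) :
    ∃ η : K →ₐ[F] A, (∀ f, Ideal.Quotient.mk I (η f) = s f) ∧ η x = a := by
  have := hx.separable
  let : Algebra F[X] F⟮x⟯ := (aeval (IntermediateField.AdjoinSimple.gen F x)).toAlgebra
  let : Algebra F[X] K := (aeval x).toAlgebra
  let : Algebra F[X] A := (aeval a).toAlgebra
  have : IsScalarTower F F[X] A := .of_algebraMap_eq fun c => by
    simp [RingHom.algebraMap_toAlgebra]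
  have : IsScalarTower F[X] F⟮x⟯ K := .of_algebraMap_eq fun p => by
    simp only [RingHom.algebraMap_toAlgebra]
    change aeval x p = F⟮x⟯.val (aeval _ p)
    rw [← aeval_algHom_apply]; simp
  have hinj : Function.Injective (algebraMap F[X] F⟮x⟯) := by
    have h1 : Function.Injective (algebraMap F[X] K) :=
      transcendental_iff_injective.mp hx.transcendental
    rw [IsScalarTower.algebraMap_eq F[X] F⟮x⟯ K, RingHom.coe_comp] at h1
    exact Function.Injective.of_comp h1
  have : FaithfulSMul F[X] F⟮x⟯ := (faithfulSMul_iff_algebraMap_injective _ _).mpr hinj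
  have : IsFractionRing F[X] F⟮x⟯ := by
    refine IsFractionRing.of_field _ _ fun z => ?_
    obtain ⟨p, q, h⟩ := (IntermediateField.mem_adjoin_simple_iff F (z : K)).mp z.2
    refine ⟨p, q, Subtype.ext ?_⟩
    have e : ∀ p : F[X], ((algebraMap F[X] F⟮x⟯ p : F⟮x⟯) : K) = aeval x p := fun p =>
      (IsScalarTower.algebraMap_apply F[X] F⟮x⟯ K p).symm
    simp [e, h]
  have : Algebra.FormallyEtale F[X] F⟮x⟯ := .of_isLocalization (nonZeroDivisors F[X])
  have : Algebra.FormallyEtale F⟮x⟯ K := .of_isSeparable _ _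
  have : Algebra.FormallyEtale F[X] K := .comp _ F⟮x⟯ _
  let s' : K →ₐ[F[X]] A ⧸ I :=
    { s.toRingHom with
      commutes' := fun p => by
        change s (aeval x p) = Ideal.Quotient.mkₐ F I (aeval a p)
        rw [← aeval_algHom_apply, ← aeval_algHom_apply]
        congr 2
        exact ha.symm }
  obtain ⟨g, hg⟩ := Algebra.FormallySmooth.exists_mkₐ_comp_eq_of_isAdicComplete (I := I) s'
  have : IsScalarTower F F[X] K := .of_algebraMap_eq fun c => by
    simp [RingHom.algebraMap_toAlgebra]
  refine ⟨g.restrictScalars F, fun f => congr($hg f), ?_⟩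
  have := g.commutes X
  simpa [RingHom.algebraMap_toAlgebra] using this

theorem exists_isTaylorHom (x : K) (hx : IsSeparatingVariable F x) :
    ∃ η : K →ₐ[F] K⟦X⟧, IsTaylorHom F x η := by
  let I : Ideal K⟦X⟧ := .span {PowerSeries.X}
  let s : K →ₐ[F] K⟦X⟧ ⧸ I :=
    (Ideal.Quotient.mkₐ F I).comp (Algebra.ofId K K⟦X⟧ |>.restrictScalars F)
  obtain ⟨η, h1, h2⟩ := exists_lift F I x hx s (PowerSeries.C x + PowerSeries.X) (by
    change Ideal.Quotient.mk I _ = Ideal.Quotient.mk I (PowerSeries.C x)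
    rw [Ideal.Quotient.eq]
    rw [add_sub_cancel_left]
    exact Ideal.mem_span_singleton_self _)
  refine ⟨η, ⟨fun f => ?_, h2⟩⟩
  have h : Ideal.Quotient.mk I (η f) = Ideal.Quotient.mk I (PowerSeries.C f) := h1 f
  rw [Ideal.Quotient.eq, Ideal.mem_span_singleton, PowerSeries.X_dvd_iff] at h
  simpa [sub_eq_zero] using h

/-- The `i`-th Hasse derivative `Dⁱₓ` on `K` with respect to the separating variable `x`. -/
noncomputable def hasseDeriv (x : K) (hx : IsSeparatingVariable F x) (i : ℕ) : K →ₗ[F] K :=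
  ((PowerSeries.coeff i).restrictScalars F : K⟦X⟧ →ₗ[F] K) ∘ₗ
    (exists_isTaylorHom F x hx).choose.toLinearMap

end Taylor

section Geometry

open MvPolynomial

variable {F : Type*} [Field F] {n : ℕ}
variable (I : Ideal (MvPolynomial (Fin (n + 1)) F)) [I.IsPrime]

/-- The quotient `G / H` of two polynomials in the fraction field of `F[x₀, …, xₙ] / I`. -/
noncomputable def frac (G H : MvPolynomial (Fin (n + 1)) F) :
    FractionRing (MvPolynomial (Fin (n + 1)) F ⧸ I) :=
  algebraMap _ _ (Ideal.Quotient.mk I G) / algebraMap _ _ (Ideal.Quotient.mk I H)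

variable {I}
theorem toFrac_ne_zero {H : MvPolynomial (Fin (n + 1)) F} (h : H ∉ I) :
    algebraMap _ (FractionRing (MvPolynomial (Fin (n + 1)) F ⧸ I)) (Ideal.Quotient.mk I H) ≠ 0 := by
  simpa [Ideal.Quotient.eq_zero_iff_mem] using h

theorem frac_add {G H G' H' : MvPolynomial (Fin (n + 1)) F} (h : H ∉ I) (h' : H' ∉ I) :
    frac I G H + frac I G' H' = frac I (G * H' + H * G') (H * H') := by
  simp only [frac, map_add, map_mul]
  exact div_add_div _ _ (toFrac_ne_zero h) (toFrac_ne_zero h')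

theorem frac_mul (G H G' H' : MvPolynomial (Fin (n + 1)) F) :
    frac I G H * frac I G' H' = frac I (G * G') (H * H') := by
  simp only [frac, map_mul]
  exact div_mul_div_comm _ _ _ _

theorem frac_C (c : F) : frac I (C c) 1 = algebraMap F _ c := by
  simp only [frac, map_one, div_one]
  rw [IsScalarTower.algebraMap_apply F (MvPolynomial (Fin (n + 1)) F ⧸ I)
    (FractionRing (MvPolynomial (Fin (n + 1)) F ⧸ I))]
  rfl

theorem one_notMem : (1 : MvPolynomial (Fin (n + 1)) F) ∉ I :=
  fun h => Ideal.IsPrime.ne_top' ((Ideal.eq_top_iff_one I).mpr h)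

variable (I)

/-- The function field of the projective variety in `ℙⁿ` with homogeneous prime ideal `I`: all
`G / H` with `G`, `H` homogeneous of the same degree and `H ∉ I`. -/
noncomputable def functionField : IntermediateField F (FractionRing (MvPolynomial (Fin (n + 1)) F ⧸ I)) where
  carrier := {z | ∃ d G H, G.IsHomogeneous d ∧ H.IsHomogeneous d ∧ H ∉ I ∧ z = frac I G H}
  mul_mem' := by
    rintro _ _ ⟨d, G, H, hG, hH, h, rfl⟩ ⟨d', G', H', hG', hH', h', rfl⟩
    exact ⟨d + d', G * G', H * H', hG.mul hG', hH.mul hH',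
      fun hm => (Ideal.IsPrime.mem_or_mem ‹_› hm).elim h h', frac_mul ..⟩
  add_mem' := by
    rintro _ _ ⟨d, G, H, hG, hH, h, rfl⟩ ⟨d', G', H', hG', hH', h', rfl⟩
    exact ⟨d + d', G * H' + H * G', H * H', (hG.mul hH').add (hH.mul hG'), hH.mul hH',
      fun hm => (Ideal.IsPrime.mem_or_mem ‹_› hm).elim h h', frac_add h h'⟩
  algebraMap_mem' c := ⟨0, C c, 1, isHomogeneous_C _ _, isHomogeneous_one _ _, one_notMem,
    (frac_C c).symm⟩
  inv_mem' := by
    rintro _ ⟨d, G, H, hG, hH, h, rfl⟩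
    by_cases hGI : G ∈ I
    · refine ⟨0, 0, 1, isHomogeneous_zero _ _ _, isHomogeneous_one _ _, one_notMem, ?_⟩
      simp [frac, Ideal.Quotient.eq_zero_iff_mem.mpr hGI]
    · exact ⟨d, H, G, hH, hG, hGI, by simp [frac]⟩

/-- The points of `ℙⁿ(F)` at which the homogeneous ideal `I` vanishes. -/
def zeroLocus : Set (ℙ F (Fin (n + 1) → F)) := {P | ∀ g ∈ I, eval P.rep g = 0}

/-- The local ring at `P` of the variety with ideal `I`: all `G / H` with `G`, `H` homogeneous of the
same degree and `H(P) ≠ 0`. -/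
noncomputable def localRing (P : zeroLocus I) : Subalgebra F (functionField I) where
  carrier := {z | ∃ d G H, G.IsHomogeneous d ∧ H.IsHomogeneous d ∧ eval P.1.rep H ≠ 0 ∧
    (z : FractionRing (MvPolynomial (Fin (n + 1)) F ⧸ I)) = frac I G H}
  mul_mem' := by
    rintro a b ⟨d, G, H, hG, hH, h, ha⟩ ⟨d', G', H', hG', hH', h', hb⟩
    exact ⟨d + d', G * G', H * H', hG.mul hG', hH.mul hH', by simp [h, h'],
      by rw [← frac_mul, ← ha, ← hb]; rfl⟩
  add_mem' := by
    rintro a b ⟨d, G, H, hG, hH, h, ha⟩ ⟨d', G', H', hG', hH', h', hb⟩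
    exact ⟨d + d', G * H' + H * G', H * H', (hG.mul hH').add (hH.mul hG'), hH.mul hH',
      by simp [h, h'], by
        rw [← frac_add (fun hm => h (P.2 _ hm)) (fun hm => h' (P.2 _ hm)), ← ha, ← hb]; rfl⟩
  algebraMap_mem' c := ⟨0, C c, 1, isHomogeneous_C _ _, isHomogeneous_one _ _, by simp,
    (frac_C c).symm⟩

instance (P : zeroLocus I) : IsFractionRing (localRing I P) (functionField I) := by
  have : FaithfulSMul (localRing I P) (functionField I) :=
    (faithfulSMul_iff_algebraMap_injective _ _).mpr Subtype.val_injective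
  refine IsFractionRing.of_field _ _ ?_
  rintro ⟨z, d, G, H, hG, hH, h, rfl⟩
  obtain ⟨i, hi⟩ : ∃ i, P.1.rep i ≠ 0 := by
    by_contra! hc
    exact P.1.rep_nonzero (funext hc)
  have hXd : (X i ^ d : MvPolynomial (Fin (n + 1)) F).IsHomogeneous d := by
    simpa using (isHomogeneous_X F i).pow d
  have hev : eval P.1.rep (X i ^ d) ≠ 0 := by simp [hi]
  have hXI : (X i ^ d : MvPolynomial (Fin (n + 1)) F) ∉ I := fun hm => hev (P.2 _ hm)
  refine ⟨⟨⟨frac I G (X i ^ d), ⟨d, G, _, hG, hXd, hXI, rfl⟩⟩, ⟨d, G, _, hG, hXd, hev, rfl⟩⟩,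
    ⟨⟨frac I H (X i ^ d), ⟨d, H, _, hH, hXd, hXI, rfl⟩⟩, ⟨d, H, _, hH, hXd, hev, rfl⟩⟩, ?_⟩
  apply Subtype.ext
  change frac I G H = frac I G (X i ^ d) / frac I H (X i ^ d)
  simp only [frac]
  exact (div_div_div_cancel_right₀ (toFrac_ne_zero hXI) _ _).symm

end Geometry

section Frobenius

open MvPolynomial

variable {k F : Type*} [Field k] [Field F] [Algebra k F] {n : ℕ}

/-- The extension to `F[x₀, …, xₙ]` of an ideal of `k[x₀, …, xₙ]`. -/
noncomputable abbrev extend (F : Type*) [Field F] [Algebra k F] (J : Ideal (MvPolynomial (Fin (n + 1)) k)) :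
    Ideal (MvPolynomial (Fin (n + 1)) F) :=
  J.map (MvPolynomial.map (algebraMap k F))

theorem eval_smul_of_isHomogeneous {g : MvPolynomial (Fin (n + 1)) F} {d : ℕ}
    (hg : g.IsHomogeneous d) (c : F) (v : Fin (n + 1) → F) :
    eval (c • v) g = c ^ d * eval v g := by
  rw [eval_eq, eval_eq, Finset.mul_sum]
  refine Finset.sum_congr rfl fun m hm => ?_
  have h : ∑ i ∈ m.support, m i = d := by
    simpa [Finsupp.weight_apply, Finsupp.sum] using hg (mem_support_iff.mp hm)
  simp only [Pi.smul_apply, smul_eq_mul, mul_pow, Finset.prod_mul_distrib, Finset.prod_pow_eq_pow_sum,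
    h]
  ring

variable [Fintype k]

theorem expand_map_frobenius (k : Type*) [Field k] [Fintype k] [Algebra k F]
    (h : MvPolynomial (Fin (n + 1)) F) :
    expand (Fintype.card k) (map (FiniteField.frobeniusAlgHom k F : F →+* F) h) =
      h ^ Fintype.card k := by
  have : ((expand (Fintype.card k) : MvPolynomial (Fin (n + 1)) F →ₐ[F] _) :
      MvPolynomial (Fin (n + 1)) F →+* MvPolynomial (Fin (n + 1)) F).comp
      (map (FiniteField.frobeniusAlgHom k F : F →+* F)) =
      ((FiniteField.frobeniusAlgHom k (MvPolynomial (Fin (n + 1)) F) :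
        MvPolynomial (Fin (n + 1)) F →+* MvPolynomial (Fin (n + 1)) F)) := by
    apply MvPolynomial.ringHom_ext <;> intro i <;> simp
  exact congr($this h)

theorem frobenius_comp_algebraMap (k F : Type*) [Field k] [Fintype k] [Field F] [Algebra k F] :
    (FiniteField.frobeniusAlgHom k F : F →+* F).comp (algebraMap k F) = algebraMap k F :=
  RingHom.ext fun c => (FiniteField.frobeniusAlgHom k F).commutes c

theorem expand_map_algebraMap (g : MvPolynomial (Fin (n + 1)) k) :
    expand (Fintype.card k) (map (algebraMap k F) g) = map (algebraMap k F) g ^ Fintype.card k := by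
  rw [← expand_map_frobenius k, map_map, frobenius_comp_algebraMap]

theorem map_frobenius_mem {J : Ideal (MvPolynomial (Fin (n + 1)) k)}
    {h : MvPolynomial (Fin (n + 1)) F} (hh : h ∈ extend F J) :
    map (FiniteField.frobeniusAlgHom k F : F →+* F) h ∈ extend F J := by
  have hle : extend F J ≤
      (extend F J).comap (map (FiniteField.frobeniusAlgHom k F : F →+* F)) := by
    refine Ideal.map_le_iff_le_comap.mpr fun g hg => ?_
    rw [Ideal.mem_comap, Ideal.mem_comap, map_map, frobenius_comp_algebraMap]
    exact Ideal.mem_map_of_mem _ hg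
  exact hle hh

theorem expand_mem {J : Ideal (MvPolynomial (Fin (n + 1)) k)} :
    extend F J ≤ (extend F J).comap
      (expand (Fintype.card k) : MvPolynomial (Fin (n + 1)) F →ₐ[F] _) := by
  refine Ideal.map_le_iff_le_comap.mpr fun g hg => ?_
  rw [Ideal.mem_comap, Ideal.mem_comap]
  exact expand_map_algebraMap (F := F) g ▸
    Ideal.pow_mem_of_mem _ (Ideal.mem_map_of_mem _ hg) _ Fintype.card_pos

theorem mem_of_expand_mem [Algebra.IsAlgebraic k F] {J : Ideal (MvPolynomial (Fin (n + 1)) k)}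
    [(extend F J).IsPrime] {h : MvPolynomial (Fin (n + 1)) F}
    (hh : expand (Fintype.card k) h ∈ extend F J) : h ∈ extend F J := by
  let e := FiniteField.frobeniusAlgEquivOfAlgebraic k F
  have he : map (FiniteField.frobeniusAlgHom k F : F →+* F)
      (map (e.symm : F →+* F) h) = h := by
    rw [map_map]
    have : (FiniteField.frobeniusAlgHom k F : F →+* F).comp (e.symm : F →+* F) = RingHom.id F :=
      RingHom.ext fun c => e.apply_symm_apply c
    rw [this, map_id]
  rw [← he] at hh ⊢
  rw [expand_map_frobenius] at hh
  exact map_frobenius_mem (Ideal.IsPrime.mem_of_pow_mem ‹_› _ hh)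

/-- The Frobenius map `v ↦ (vᵢ ^ q)ᵢ` on `Fⁿ⁺¹`, as a semilinear map. -/
def frobeniusVec (k F : Type*) [Field k] [Fintype k] [Field F] [Algebra k F] (n : ℕ) :
    (Fin (n + 1) → F) →ₛₗ[(FiniteField.frobeniusAlgHom k F : F →+* F)] (Fin (n + 1) → F) where
  toFun v i := v i ^ Fintype.card k
  map_add' _ _ := funext fun _ => map_add (FiniteField.frobeniusAlgHom k F) _ _
  map_smul' c v := funext fun i => map_mul (FiniteField.frobeniusAlgHom k F) c (v i)

theorem frobeniusVec_injective : Function.Injective (frobeniusVec k F n) := fun v w h =>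
  funext fun i => (FiniteField.frobeniusAlgHom k F : F →+* F).injective congr($h i)

/-- The Frobenius map `(a₀ : … : aₙ) ↦ (a₀ ^ q : … : aₙ ^ q)` of `ℙⁿ(F)`. -/
def frobeniusProj (k : Type*) {F : Type*} [Field k] [Fintype k] [Field F] [Algebra k F] {n : ℕ} :
    ℙ F (Fin (n + 1) → F) → ℙ F (Fin (n + 1) → F) :=
  Projectivization.map (frobeniusVec k F n) frobeniusVec_injective

theorem frobeniusProj_mem {J : Ideal (MvPolynomial (Fin (n + 1)) k)}
    (hJ : ∀ g ∈ J, ∀ d, homogeneousComponent d g ∈ J) {P : ℙ F (Fin (n + 1) → F)}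
    (hP : P ∈ zeroLocus (extend F J)) : frobeniusProj k P ∈ zeroLocus (extend F J) := by
  obtain ⟨a, ha⟩ := Projectivization.exists_smul_eq_mk_rep F (frobeniusVec k F n P.rep)
    (map_zero (frobeniusVec k F n) ▸ frobeniusVec_injective.ne P.rep_nonzero)
  have hrep : (frobeniusProj k P).rep = (a : F) • frobeniusVec k F n P.rep := by
    conv_lhs => rw [← P.mk_rep]
    exact ha.symm
  suffices hle : extend F J ≤ RingHom.ker (eval (frobeniusProj k P).rep) from
    fun g hg => hle hg
  refine Ideal.map_le_iff_le_comap.mpr fun g hg => ?_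
  rw [Ideal.mem_comap, RingHom.mem_ker, ← sum_homogeneousComponent g, map_sum, map_sum]
  refine Finset.sum_eq_zero fun d _ => ?_
  rw [hrep, eval_smul_of_isHomogeneous ((homogeneousComponent_isHomogeneous d g).map _)]
  have h0 := hP _ (Ideal.mem_map_of_mem (MvPolynomial.map (algebraMap k F)) (hJ g hg d))
  have h1 : eval (frobeniusVec k F n P.rep) (map (algebraMap k F) (homogeneousComponent d g)) =
      eval P.rep (map (algebraMap k F) (homogeneousComponent d g)) ^ Fintype.card k := by
    rw [← map_pow, ← expand_map_algebraMap, eval_expand]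
    rfl
  rw [h1, h0, zero_pow Fintype.card_ne_zero, mul_zero]

variable [Algebra.IsAlgebraic k F] (J : Ideal (MvPolynomial (Fin (n + 1)) k))
  [(extend F J).IsPrime]

/-- The endomorphism of the homogeneous coordinate ring that sends each `xᵢ` to `xᵢ ^ q` and is the
identity on `F`. -/
noncomputable def frobeniusCoord : (MvPolynomial (Fin (n + 1)) F ⧸ extend F J) →ₐ[F]
    (MvPolynomial (Fin (n + 1)) F ⧸ extend F J) :=
  Ideal.quotientMapₐ _ (expand (Fintype.card k)) expand_mem

theorem frobeniusCoord_injective : Function.Injective (frobeniusCoord (F := F) J) := by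
  rw [injective_iff_map_eq_zero]
  intro a
  obtain ⟨g, rfl⟩ := Ideal.Quotient.mk_surjective a
  intro h
  rw [Ideal.Quotient.eq_zero_iff_mem]
  refine mem_of_expand_mem ?_
  rw [← Ideal.Quotient.eq_zero_iff_mem]
  exact h

theorem algHom_comp_frobeniusCoord_injective : Function.Injective
    ((Algebra.algHom F (MvPolynomial (Fin (n + 1)) F ⧸ extend F J)
      (FractionRing (MvPolynomial (Fin (n + 1)) F ⧸ extend F J))).comp (frobeniusCoord J)) :=
  (IsFractionRing.injective (MvPolynomial (Fin (n + 1)) F ⧸ extend F J)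
    (FractionRing (MvPolynomial (Fin (n + 1)) F ⧸ extend F J))).comp (frobeniusCoord_injective J)

/-- The extension of `frobeniusCoord` to the fraction field. -/
noncomputable def frobeniusFrac :
    FractionRing (MvPolynomial (Fin (n + 1)) F ⧸ extend F J) →ₐ[F]
      FractionRing (MvPolynomial (Fin (n + 1)) F ⧸ extend F J) :=
  IsFractionRing.liftAlgHom (algHom_comp_frobeniusCoord_injective J)

theorem frobeniusFrac_frac (G H : MvPolynomial (Fin (n + 1)) F) :
    frobeniusFrac J (frac (extend F J) G H) =
      frac (extend F J) (expand (Fintype.card k) G) (expand (Fintype.card k) H) := by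
  have key : ∀ G : MvPolynomial (Fin (n + 1)) F, frobeniusFrac J
      (algebraMap _ (FractionRing (MvPolynomial (Fin (n + 1)) F ⧸ extend F J))
        (Ideal.Quotient.mk (extend F J) G)) =
      algebraMap _ _ (Ideal.Quotient.mk (extend F J) (expand (Fintype.card k) G)) := fun G =>
    IsFractionRing.lift_algebraMap (algHom_comp_frobeniusCoord_injective (F := F) J) _
  rw [frac, map_div₀, key, key, frac]

/-- Composition `f ↦ f ∘ Φ` of rational functions with the Frobenius morphism: it sends `G / H` to
`G(x₀ ^ q, …, xₙ ^ q) / H(x₀ ^ q, …, xₙ ^ q)`. -/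
noncomputable def frobeniusPullback :
    functionField (extend F J) →ₐ[F] functionField (extend F J) :=
  ((frobeniusFrac J).comp (functionField (extend F J)).val).codRestrict
    (functionField (extend F J)).toSubalgebra (by
      rintro ⟨_, d, G, H, hG, hH, h, rfl⟩
      have hom : ∀ {G : MvPolynomial (Fin (n + 1)) F}, G.IsHomogeneous d →
          (expand (Fintype.card k) G).IsHomogeneous (Fintype.card k * d) := fun hG =>
        hG.aeval _ fun i => by simpa using (isHomogeneous_X F i).pow (Fintype.card k)
      exact ⟨_, _, _, hom hG, hom hH, fun hm => h (mem_of_expand_mem hm), frobeniusFrac_frac J G H⟩)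

end Frobenius

section Curve

variable (k F : Type*) [Field k] [Field F] [Algebra k F] (n : ℕ)

/-- A projective, irreducible, non-singular curve in `ℙⁿ` over `F` that is defined over the subfield
`k`: it is given by a homogeneous ideal of `k[x₀, …, xₙ]` whose extension to `F[x₀, …, xₙ]` is prime,
its dimension (the transcendence degree of its function field over `F`) is one, and its local rings
at all points are regular, i.e. discrete valuation rings. -/
structure Curve where
  ideal : Ideal (MvPolynomial (Fin (n + 1)) k)
  homogeneous : ∀ g ∈ ideal, ∀ d, MvPolynomial.homogeneousComponent d g ∈ ideal
  [isPrime : (extend F ideal).IsPrime]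
  trdeg_eq_one : Algebra.trdeg F (functionField (extend F ideal)) = 1
  nonsingular : ∀ P : zeroLocus (extend F ideal),
    IsDiscreteValuationRing (localRing (extend F ideal) P)

namespace Curve

attribute [instance] Curve.isPrime

variable {k F n} (X : Curve k F n)

/-- The points of the curve, with coordinates in `F`. -/
abbrev Point : Type _ := zeroLocus (extend F X.ideal)

/-- The field `F(X)` of rational functions on the curve. -/
abbrev Func : Type _ := functionField (extend F X.ideal)

instance (P : X.Point) : IsDiscreteValuationRing (localRing (extend F X.ideal) P) :=
  X.nonsingular P

noncomputable section

/-- The valuation of `F(X)` with valuation ring the local ring at `P`, written multiplicatively. -/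
def valuation (P : X.Point) : Valuation X.Func (WithZero (Multiplicative ℤ)) :=
  (IsDiscreteValuationRing.maximalIdeal (localRing (extend F X.ideal) P)).valuation X.Func

/-- The order `v_P(f)` of a nonzero rational function `f` at `P` (its value at `f = 0` is
irrelevant). -/
def ord (P : X.Point) (f : X.Func) : ℤ := -WithZero.log (X.valuation P f)

/-- Divisors on the curve. -/
abbrev Div : Type _ := X.Point →₀ ℤ

/-- The degree of a divisor. -/
def degree (D : X.Div) : ℤ := D.sum fun _ m => m

theorem ord_iff (P : X.Point) (f : X.Func) (m : ℤ) :
    (f ≠ 0 → 0 ≤ m + X.ord P f) ↔ X.valuation P f ≤ WithZero.exp m := by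
  by_cases hf : f = 0
  · simp [hf]
  · have h0 : X.valuation P f ≠ 0 := (Valuation.ne_zero_iff _).mpr hf
    rw [← WithZero.log_le_iff_le_exp h0, ord]
    constructor
    · intro h
      linarith [h hf]
    · intro h _
      linarith

theorem valuation_algebraMap_le_one (P : X.Point) (c : F) :
    X.valuation P (algebraMap F X.Func c) ≤ 1 :=
  (IsDiscreteValuationRing.maximalIdeal (localRing (extend F X.ideal) P)).valuation_le_one
    (algebraMap F (localRing (extend F X.ideal) P) c)

/-- The space `L(D) = {f ≠ 0 : D + div f ≥ 0} ∪ {0}`. -/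
def riemannRochSpace (D : X.Div) : Submodule F X.Func where
  carrier := {f | f ≠ 0 → ∀ P, 0 ≤ D P + X.ord P f}
  zero_mem' h := (h rfl).elim
  add_mem' {f g} hf hg := by
    intro h P
    refine (X.ord_iff P _ _).mpr ((X.valuation P).map_add_le ?_ ?_) h
    · exact (X.ord_iff P _ _).mp fun h => hf h P
    · exact (X.ord_iff P _ _).mp fun h => hg h P
  smul_mem' c f hf := by
    intro h P
    refine (X.ord_iff P _ _).mpr ?_ h
    rw [Algebra.smul_def, map_mul]
    exact (mul_le_of_le_one_left' (X.valuation_algebraMap_le_one P c)).trans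
      ((X.ord_iff P _ _).mp fun h => hf h P)

/-- The genus of `X`: the largest value of `deg D + 1 - ℓ(D)` over all divisors `D`. -/
def genus : ℤ := ⨆ D : X.Div, (X.degree D + 1 - Module.finrank F (X.riemannRochSpace D))

/-- The set `X(k)` of the points that have homogeneous coordinates in `k`. -/
def rationalPoints : Set X.Point :=
  {P | ∃ (v : Fin (n + 1) → k) (hv : (fun i => algebraMap k F (v i)) ≠ 0),
    P.1 = Projectivization.mk F (fun i => algebraMap k F (v i)) hv}

theorem rationalPoints_finite [Finite k] : X.rationalPoints.Finite := by
  refine Set.Finite.of_injOn (f := Subtype.val)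
    (t := {Q | ∃ (v : Fin (n + 1) → k) (hv : (fun i => algebraMap k F (v i)) ≠ 0),
      Q = Projectivization.mk F (fun i => algebraMap k F (v i)) hv})
    (fun P hP => hP) Subtype.val_injective.injOn ?_
  let S := {v : Fin (n + 1) → k // (fun i => algebraMap k F (v i)) ≠ 0}
  refine (Set.finite_range fun v : S => Projectivization.mk F _ v.2).subset ?_
  rintro _ ⟨v, hv, rfl⟩
  exact ⟨⟨v, hv⟩, rfl⟩

/-- The field `k(X)`, as a subset of `F(X)`: the rational functions `G / H` with `G`, `H` homogeneous of
the same degree with coefficients in `k`. -/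
def rationalFunctions : Set X.Func :=
  {f | ∃ (d : ℕ) (G H : MvPolynomial (Fin (n + 1)) k), G.IsHomogeneous d ∧ H.IsHomogeneous d ∧
    MvPolynomial.map (algebraMap k F) H ∉ extend F X.ideal ∧
    (f : FractionRing (MvPolynomial (Fin (n + 1)) F ⧸ extend F X.ideal)) =
      frac (extend F X.ideal) (MvPolynomial.map (algebraMap k F) G)
        (MvPolynomial.map (algebraMap k F) H)}

/-- The set of divisors `E + div f` with `f` a nonzero element of `V`. -/
def linearSeries (E : X.Div) (V : Submodule F X.Func) : Set X.Div :=
  {D | ∃ f ∈ V, f ≠ 0 ∧ ∀ P, D P = E P + X.ord P f}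

/-- `𝒟` is a linear series of (projective) dimension `r` and degree `d`. -/
def IsLinearSeries (𝒟 : Set X.Div) (r : ℕ) (d : ℤ) : Prop :=
  ∃ (E : X.Div) (V : Submodule F X.Func), V ≤ X.riemannRochSpace E ∧ X.degree E = d ∧
    Module.finrank F V = r + 1 ∧ 𝒟 = X.linearSeries E V

/-- No point lies in the support of all the divisors in `𝒟`. -/
def BasePointFree (𝒟 : Set X.Div) : Prop := ∀ P, ∃ D ∈ 𝒟, D P = 0

section Frobenius

variable [Fintype k]

/-- The Frobenius morphism `Φ` of `X` relative to `k`, which raises homogeneous coordinates to the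
`q`-th power, where `q` is the number of elements of `k`. -/
def frobenius (P : X.Point) : X.Point := ⟨frobeniusProj k P.1, frobeniusProj_mem X.homogeneous P.2⟩

/-- `𝒟` is defined over `k`: it is stable under `Φ_* : ∑ n_P P ↦ ∑ n_P Φ(P)`. -/
def IsDefinedOver (𝒟 : Set X.Div) : Prop := ∀ D ∈ 𝒟, D.mapDomain X.frobenius ∈ 𝒟

variable [Algebra.IsAlgebraic k F]

/-- The matrix with first row `f₀ ∘ Φ, …, f_r ∘ Φ` and further rows `D^{m_i} f₀, …, D^{m_i} f_r` for
`i = 0, …, r - 1`, where `D` denotes the Hasse derivatives with respect to `x`. -/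
def frobeniusMatrix {r : ℕ} (x : X.Func) (hx : IsSeparatingVariable F x)
    (f : Fin (r + 1) → X.Func) (m : Fin r → ℕ) : Matrix (Fin (r + 1)) (Fin (r + 1)) X.Func :=
  Matrix.of (Fin.cons (fun j => frobeniusPullback X.ideal (f j))
    (fun i j => hasseDeriv F x hx (m i) (f j)))

/-- The set of all `m₀ < … < m_{r-1}` for which `frobeniusMatrix` has nonzero determinant, with the
lexicographic order. -/
def frobeniusOrderSet {r : ℕ} (x : X.Func) (hx : IsSeparatingVariable F x)
    (f : Fin (r + 1) → X.Func) : Set (Lex (Fin r → ℕ)) :=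
  {m | StrictMono (ofLex m) ∧ (X.frobeniusMatrix x hx f (ofLex m)).det ≠ 0}

/-- `ν₀, …, ν_{r-1}` are the Frobenius orders of `𝒟`: for a basis `f₀, …, f_r` in `k(X)` of the space of
functions that defines `𝒟`, and a separating variable `x`, the tuple `ν` is the lexicographic minimum
of `frobeniusOrderSet`. (It does not depend on the choice of `f` and `x`.) -/
def IsFrobeniusOrders (𝒟 : Set X.Div) {r : ℕ} (ν : Fin r → ℕ) : Prop :=
  ∃ (E : X.Div) (f : Fin (r + 1) → X.Func) (x : X.Func) (hx : IsSeparatingVariable F x),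
    (∀ j, f j ∈ X.rationalFunctions) ∧ LinearIndependent F f ∧
    Submodule.span F (Set.range f) ≤ X.riemannRochSpace E ∧
    𝒟 = X.linearSeries E (Submodule.span F (Set.range f)) ∧
    IsLeast (X.frobeniusOrderSet x hx f) (toLex ν)

end Frobenius

end

end Curve

end Curve

end StohrVoloch

/-!
Let `Δ` be the minor that defines the Frobenius orders. Changing the local parameter, or multiplying
all `f j` by one function, changes the rows of the minor triangularly, up to minors that vanish by
the minimality of `ν`. Hence `B = div Δ + (∑ ν i) div dx + (q + r) E` can be computed at a point `P`
with a uniformizer `t` at `P` and with the `f j` divided by one of least order; then all entries are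
regular, so `B` is effective. At a rational point `φ t = t ^ q` for the Frobenius `φ`, so the row of
the `φ (f j)` is the value at `φ t - t`, of order one, of the Taylor expansions of the `f j`.
Subtracting Hasse derivatives from it gives remainders that may replace the other rows, and each row
gains a factor `φ t - t`. So `B` has multiplicity at least `r` at every rational point, and the
bound follows by taking degrees, since `deg (div Δ) = 0` and `deg (div dx) ≤ 2 g - 2`.

For the last inequality take a basis `b` of the function field over `F(x)` whose pole orders `δ i`
along the poles of `x` have the least possible sum. Then `L(m (x)_∞)` has dimension at most
`∑ max (m + 1 - δ i) 0`, and Riemann's inequality bounds `∑ δ i` by `deg x - 1 + g`. The traces of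
regular differentials are regular; testing an element of `L(div dx + (x)_∞)` against the `b i` by
traces gives the bound `∑ δ i` for the dimension of this space, and Riemann's inequality for
`div dx + (x)_∞` then bounds the degree of `div dx`.
-/

open scoped WithZero IntermediateField

namespace StohrVoloch

open WithZero Polynomial

/-! ### Orders with respect to an integer-valued valuation -/

section Order

variable {K : Type*} [Field K] (v : Valuation K ℤᵐ⁰)

/-- The order of `f` with respect to `v` is at least `m`; this holds for `f = 0` and all `m`. -/
def OrdGE (m : ℤ) (f : K) : Prop := v f ≤ exp (-m)

/-- The order of a nonzero element `f` with respect to `v`, the additive form of `v f`. Its value at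
`f = 0` is the junk value `0`, which is why lower bounds on orders are stated with `OrdGE`. -/
noncomputable def vOrd (f : K) : ℤ := -log (v f)

variable {v} {m n : ℤ} {f g : K}

theorem ordGE_iff_le_vOrd (hf : f ≠ 0) : OrdGE v m f ↔ m ≤ vOrd v f := by
  rw [OrdGE, vOrd, ← log_le_iff_le_exp ((Valuation.ne_zero_iff v).mpr hf), le_neg]

theorem valuation_eq_exp_neg_vOrd (hf : f ≠ 0) : v f = exp (-vOrd v f) := by
  rw [vOrd, neg_neg, exp_log ((Valuation.ne_zero_iff v).mpr hf)]

theorem vOrd_eq_of_eq_exp_neg (h : v f = exp (-m)) : vOrd v f = m := by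
  rw [vOrd, h, log_exp, neg_neg]

theorem ne_zero_of_eq_exp (h : v f = exp m) : f ≠ 0 := by
  rintro rfl
  exact exp_ne_zero (h.symm.trans (map_zero v))

theorem vOrd_one : vOrd v 1 = 0 := by simp [vOrd]

theorem vOrd_neg (f : K) : vOrd v (-f) = vOrd v f := by simp [vOrd]

theorem vOrd_inv (f : K) : vOrd v f⁻¹ = -vOrd v f := by simp [vOrd]

theorem vOrd_mul (hf : f ≠ 0) (hg : g ≠ 0) : vOrd v (f * g) = vOrd v f + vOrd v g := by
  simp only [vOrd, map_mul,
    log_mul ((Valuation.ne_zero_iff v).mpr hf) ((Valuation.ne_zero_iff v).mpr hg), neg_add]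

theorem vOrd_div (hf : f ≠ 0) (hg : g ≠ 0) : vOrd v (f / g) = vOrd v f - vOrd v g := by
  rw [div_eq_mul_inv, vOrd_mul hf (inv_ne_zero hg), vOrd_inv, sub_eq_add_neg]

theorem vOrd_pow (f : K) (n : ℕ) : vOrd v (f ^ n) = n * vOrd v f := by simp [vOrd, log_pow]

theorem vOrd_zpow (f : K) (n : ℤ) : vOrd v (f ^ n) = n * vOrd v f := by simp [vOrd, log_zpow]

namespace OrdGE

theorem zero (m : ℤ) : OrdGE v m (0 : K) := by simp [OrdGE]

theorem one : OrdGE v 0 (1 : K) := by simp [OrdGE]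

theorem self (f : K) : OrdGE v (vOrd v f) f := by
  by_cases hf : f = 0
  · exact hf ▸ zero _
  · exact (ordGE_iff_le_vOrd hf).mpr le_rfl

theorem mono (h : OrdGE v m f) (hnm : n ≤ m) : OrdGE v n f :=
  h.trans (exp_le_exp.mpr (neg_le_neg hnm))

theorem add (hf : OrdGE v m f) (hg : OrdGE v m g) : OrdGE v m (f + g) := v.map_add_le hf hg

theorem sub (hf : OrdGE v m f) (hg : OrdGE v m g) : OrdGE v m (f - g) := v.map_sub_le hf hg

theorem neg (hf : OrdGE v m f) : OrdGE v m (-f) := by rwa [OrdGE, Valuation.map_neg]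

theorem sum {α : Type*} {s : Finset α} {f : α → K} (h : ∀ i ∈ s, OrdGE v m (f i)) :
    OrdGE v m (∑ i ∈ s, f i) := v.map_sum_le h

theorem mul (hf : OrdGE v m f) (hg : OrdGE v n g) : OrdGE v (m + n) (f * g) := by
  rw [OrdGE, map_mul, neg_add, exp_add]
  exact mul_le_mul' hf hg

theorem mul_left (hf : OrdGE v 0 f) (hg : OrdGE v m g) : OrdGE v m (f * g) := by
  simpa using hf.mul hg

theorem mul_right (hf : OrdGE v m f) (hg : OrdGE v 0 g) : OrdGE v m (f * g) := by
  simpa using hf.mul hg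

theorem pow (hf : OrdGE v m f) (n : ℕ) : OrdGE v (n * m) (f ^ n) := by
  rw [OrdGE, map_pow, neg_mul_eq_mul_neg, ← nsmul_eq_mul, exp_nsmul]
  exact pow_le_pow_left' hf n

theorem pow_of_zero (hf : OrdGE v 0 f) (n : ℕ) : OrdGE v 0 (f ^ n) := by
  simpa using hf.pow n

theorem prod {α : Type*} {s : Finset α} {f : α → K} (h : ∀ i ∈ s, OrdGE v 0 (f i)) :
    OrdGE v 0 (∏ i ∈ s, f i) := by
  simp only [OrdGE, neg_zero, exp_zero] at h ⊢
  exact (map_prod v f s).trans_le (Finset.prod_le_one' h)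

theorem det {n : ℕ} (M : Matrix (Fin n) (Fin n) K) (h : ∀ i j, OrdGE v 0 (M i j)) :
    OrdGE v 0 M.det := by
  rw [Matrix.det_apply]
  refine OrdGE.sum fun σ _ => ?_
  have hprod : OrdGE v 0 (∏ i, M (σ i) i) := OrdGE.prod fun i _ => h _ _
  rcases Int.units_eq_one_or (Equiv.Perm.sign σ) with hs | hs
  · simpa [hs] using hprod
  · simpa [hs] using hprod.neg

theorem mul_iff (hf : f ≠ 0) : OrdGE v m (f * g) ↔ OrdGE v (m - vOrd v f) g := by
  by_cases hg : g = 0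
  · simp [hg, zero]
  · rw [ordGE_iff_le_vOrd (mul_ne_zero hf hg), ordGE_iff_le_vOrd hg, vOrd_mul hf hg,
      sub_le_iff_le_add']

theorem div (hf : OrdGE v m f) (hg : g ≠ 0) : OrdGE v (m - vOrd v g) (f / g) := by
  rwa [← mul_iff hg, mul_div_cancel₀ _ hg]

theorem eq_zero_of_forall (h : ∀ m : ℕ, OrdGE v m f) : f = 0 := by
  by_contra hf
  have := (ordGE_iff_le_vOrd hf).mp (h ((vOrd v f).toNat + 1))
  lia

end OrdGE

theorem ordGE_zero_iff_le_one : OrdGE v 0 f ↔ v f ≤ 1 := by simp [OrdGE]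

theorem ordGE_one_iff_lt_one : OrdGE v 1 f ↔ v f < 1 := by
  by_cases hf : f = 0
  · simp [hf, OrdGE]
  · rw [OrdGE, valuation_eq_exp_neg_vOrd hf, ← exp_zero, exp_le_exp, exp_lt_exp]
    lia

theorem eq_exp_neg_iff_ordGE : v f = exp (-m) ↔ OrdGE v m f ∧ ¬ OrdGE v (m + 1) f := by
  by_cases hf : f = 0
  · simp [hf, OrdGE, exp_ne_zero.symm]
  · rw [ordGE_iff_le_vOrd hf, ordGE_iff_le_vOrd hf, valuation_eq_exp_neg_vOrd hf, exp_inj]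
    lia

end Order

/-! ### Simple transcendental extensions -/

section Transcendental

variable {F K : Type*} [Field F] [Field K] [Algebra F K]

theorem transcendental_or_mem_range [IsAlgClosed F] (f : K) :
    Transcendental F f ∨ f ∈ Set.range (algebraMap F K) := by
  refine (em (IsAlgebraic F f)).symm.imp id fun hf => ?_
  exact minpoly.mem_range_of_degree_eq_one F f
    (IsAlgClosed.degree_eq_one_of_irreducible F (minpoly.irreducible hf.isIntegral))

theorem ne_zero_of_transcendental {x : K} (hx : Transcendental F x) : x ≠ 0 := by
  rintro rfl
  exact hx isAlgebraic_zero

theorem transcendental_inv {x : K} (hx : Transcendental F x) : Transcendental F x⁻¹ :=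
  fun ha => hx (IsAlgebraic.inv_iff.mp ha)

theorem aeval_ne_zero_of_transcendental {x : K} (hx : Transcendental F x) {p : F[X]} (hp : p ≠ 0) :
    aeval x p ≠ 0 :=
  fun h => hx ⟨p, hp, h⟩

theorem linearIndependent_pow_of_transcendental {x : K} (hx : Transcendental F x) :
    LinearIndependent F fun j : ℕ => x ^ j := by
  have hker : LinearMap.ker (aeval x : F[X] →ₐ[F] K).toLinearMap = ⊥ :=
    LinearMap.ker_eq_bot.mpr (transcendental_iff_injective.mp hx)
  have hmonomial := (basisMonomials F).linearIndependent.map' _ hker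
  simpa [coe_basisMonomials, Function.comp_def, aeval_monomial] using hmonomial

theorem adjoin_simple_inv (x : K) : F⟮x⁻¹⟯ = F⟮x⟯ := by
  refine le_antisymm (IntermediateField.adjoin_simple_le_iff.mpr ?_)
    (IntermediateField.adjoin_simple_le_iff.mpr ?_)
  · exact inv_mem (IntermediateField.mem_adjoin_simple_self F x)
  · simpa using inv_mem (IntermediateField.mem_adjoin_simple_self F x⁻¹)

theorem aeval_mem_adjoin_simple (s : K) (p : F[X]) : aeval s p ∈ F⟮s⟯ :=
  IntermediateField.algebra_adjoin_le_adjoin F _ (aeval_mem_adjoin_singleton F s)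

variable {s : K} {α : Type*} [Finite α]

open scoped IntermediateField.algebraAdjoinAdjoin in
theorem exists_common_denominator (a : α → F⟮s⟯) :
    ∃ (d : F[X]) (p : α → F[X]), aeval s d ≠ 0 ∧ ∀ i, (a i : K) * aeval s d = aeval s (p i) := by
  obtain ⟨⟨b, hb⟩, hba⟩ := IsLocalization.exist_integer_multiples_of_finite
    (nonZeroDivisors (Algebra.adjoin F {s})) a
  choose c hc using hba
  have hrange : ∀ z : Algebra.adjoin F {s}, ∃ p : F[X], aeval s p = z := fun z => by
    simpa [Algebra.adjoin_singleton_eq_range_aeval] using z.2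
  obtain ⟨d, hd⟩ := hrange b
  choose p hp using fun i => hrange (c i)
  refine ⟨d, p, ?_, fun i => ?_⟩
  · rw [hd]
    exact_mod_cast nonZeroDivisors.ne_zero hb
  · rw [hp, hd, mul_comm]
    exact congr(($(hc i) : K)).symm

theorem exists_primitive_multiple (hs : Transcendental F s) (a : α → F⟮s⟯) (ha : a ≠ 0) :
    ∃ (u : F⟮s⟯) (p : α → F[X]), u ≠ 0 ∧ (∀ i, (u : K) * a i = aeval s (p i)) ∧
      ∃ i, (p i).coeff 0 ≠ 0 := by
  classical
  have := Fintype.ofFinite α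
  obtain ⟨d, p, hd, hp⟩ := exists_common_denominator a
  obtain ⟨i, hi⟩ := Function.ne_iff.mp ha
  have hpi : p i ≠ 0 := by
    rintro h0
    have hi' : (a i : K) ≠ 0 := by simpa using hi
    exact mul_ne_zero hi' hd (by rw [hp, h0, map_zero])
  let := UniqueFactorizationMonoid.toNormalizedGCDMonoid F[X]
  set g := Finset.univ.gcd p
  have hg : g ≠ 0 := fun h0 => hpi (Finset.gcd_eq_zero_iff.mp h0 i (Finset.mem_univ i))
  obtain ⟨q, hpq, hq⟩ := Finset.extract_gcd p ⟨i, Finset.mem_univ i⟩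
  have hgs : aeval s g ≠ 0 := aeval_ne_zero_of_transcendental hs hg
  refine ⟨⟨aeval s d / aeval s g,
    div_mem (aeval_mem_adjoin_simple s d) (aeval_mem_adjoin_simple s g)⟩, q, ?_, fun j => ?_, ?_⟩
  · exact fun h0 => div_ne_zero hd hgs congr(($h0 : K))
  · rw [div_mul_eq_mul_div, mul_comm, hp, hpq j (Finset.mem_univ j), map_mul,
      mul_div_cancel_left₀ _ hgs]
  · by_contra! hc
    exact not_isUnit_X (isUnit_of_dvd_one (hq ▸ Finset.dvd_gcd fun j _ => X_dvd_iff.mpr (hc j)))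

end Transcendental

/-! ### Place systems and approximation -/

/-- The valuations of `K` at the points of a complete nonsingular curve over `F` with function field
`K`, abstracted to the properties needed below. The last field says that all local rings are
localizations of finitely many finitely generated algebras, as for an affine open cover. -/
structure IsPlaceSystem (F : Type*) {K ι : Type*} [Field F] [Field K] [Algebra F K]
    (v : ι → Valuation K ℤᵐ⁰) : Prop where
  ordGE_algebraMap : ∀ P (c : F), OrdGE (v P) 0 (algebraMap F K c)
  exists_residue : ∀ P f, OrdGE (v P) 0 f → ∃ c : F, OrdGE (v P) 1 (f - algebraMap F K c)
  exists_uniformizer : ∀ P, ∃ t, v P t = exp (-1)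
  exists_separating :
    ∀ (S : Finset ι), ∀ P ∈ S, ∃ e, v P e = 1 ∧ ∀ Q ∈ S, Q ≠ P → OrdGE (v Q) 1 e
  mem_range_of_regular : ∀ f, (∀ P, OrdGE (v P) 0 f) → f ∈ Set.range (algebraMap F K)
  finiteDimensional : ∀ x : K, Transcendental F x → FiniteDimensional F⟮x⟯ K
  exists_generators : ∃ T : Finset K, ∀ P f, OrdGE (v P) 0 f →
    ∃ a ∈ Algebra.adjoin F {u | u ∈ T ∧ OrdGE (v P) 0 u},
    ∃ b ∈ Algebra.adjoin F {u | u ∈ T ∧ OrdGE (v P) 0 u}, v P b = 1 ∧ f = a / b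

variable {F K ι : Type*} [Field F] [Field K] [Algebra F K] {v : ι → Valuation K ℤᵐ⁰}

/-- Up to the constants `c P`, which are distinct, `y` is a local parameter at every point `P` of
`S`. -/
structure IsSimultaneousParameter (v : ι → Valuation K ℤᵐ⁰) (S : Finset ι) (y : K) (c : ι → F) :
    Prop where
  injOn : Set.InjOn c S
  valuation_sub : ∀ P ∈ S, v P (y - algebraMap F K (c P)) = exp (-1)

/-- The number of zeros of `s` in `S`, counted with multiplicity. -/
noncomputable def zerosDegree (v : ι → Valuation K ℤᵐ⁰) (S : Finset ι) (s : K) : ℕ :=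
  ∑ P ∈ S, (vOrd (v P) s).toNat

theorem vOrd_nonneg {v : Valuation K ℤᵐ⁰} {f : K} (hf : OrdGE v 0 f) : 0 ≤ vOrd v f := by
  by_cases h0 : f = 0
  · simp [h0, vOrd]
  · exact (ordGE_iff_le_vOrd h0).mp hf

theorem cast_zerosDegree {S : Finset ι} {s : K} (hs : ∀ P ∈ S, OrdGE (v P) 0 s) :
    (zerosDegree v S s : ℤ) = ∑ P ∈ S, vOrd (v P) s := by
  rw [zerosDegree, Nat.cast_sum]
  exact Finset.sum_congr rfl fun P hP => Int.toNat_of_nonneg (vOrd_nonneg (hs P hP))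

namespace IsPlaceSystem

variable (h : IsPlaceSystem F v)

include h

theorem valuation_algebraMap (P : ι) {c : F} (hc : c ≠ 0) : v P (algebraMap F K c) = 1 := by
  have hle : ∀ c : F, v P (algebraMap F K c) ≤ 1 :=
    fun c => ordGE_zero_iff_le_one.mp (h.ordGE_algebraMap P c)
  refine le_antisymm (hle c) ?_
  calc 1 = v P (algebraMap F K c) * v P (algebraMap F K c⁻¹) := by
        rw [← map_mul, ← map_mul, mul_inv_cancel₀ hc, map_one, map_one]
    _ ≤ v P (algebraMap F K c) := mul_le_of_le_one_right' (hle c⁻¹)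

theorem eq_zero_of_ordGE_one (P : ι) {c : F} (hc : OrdGE (v P) 1 (algebraMap F K c)) : c = 0 :=
  of_not_not fun h0 => (ordGE_one_iff_lt_one.mp hc).ne (h.valuation_algebraMap P h0)

theorem vOrd_algebraMap (P : ι) {c : F} (hc : c ≠ 0) : vOrd (v P) (algebraMap F K c) = 0 :=
  vOrd_eq_of_eq_exp_neg (by simpa using h.valuation_algebraMap P hc)

theorem ordGE_aeval (P : ι) {y : K} (hy : OrdGE (v P) 0 y) (p : F[X]) :
    OrdGE (v P) 0 (aeval y p) := by
  rw [aeval_eq_sum_range]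
  refine OrdGE.sum fun i _ => ?_
  rw [Algebra.smul_def]
  exact (h.ordGE_algebraMap P _).mul_left (hy.pow_of_zero i)

theorem ordGE_aeval_sub_eval (P : ι) {y : K} (hy : OrdGE (v P) 0 y) (p : F[X]) (c : F) {m : ℤ}
    (hc : OrdGE (v P) m (y - algebraMap F K c)) :
    OrdGE (v P) m (aeval y p - algebraMap F K (p.eval c)) := by
  obtain ⟨q, hq⟩ := X_sub_C_dvd_sub_C_eval (p := p) (a := c)
  have hsub : aeval y p - algebraMap F K (p.eval c) = (y - algebraMap F K c) * aeval y q := by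
    simpa using congr(aeval y $hq)
  rw [hsub]
  exact hc.mul_right (h.ordGE_aeval P hy q)

theorem ordGE_aeval_sub_coeff_zero (P : ι) {s : K} {m : ℤ} (hs0 : OrdGE (v P) 0 s)
    (hs : OrdGE (v P) m s) (p : F[X]) :
    OrdGE (v P) m (aeval s p - algebraMap F K (p.coeff 0)) := by
  rw [coeff_zero_eq_eval_zero]
  exact h.ordGE_aeval_sub_eval P hs0 p 0 (by simpa using hs)

theorem valuation_aeval_of_coeff_zero_ne_zero (P : ι) {s : K} (hs : OrdGE (v P) 1 s) {p : F[X]}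
    (hp : p.coeff 0 ≠ 0) : v P (aeval s p) = 1 := by
  have hval := h.valuation_algebraMap P hp
  have hlt : v P (aeval s p - algebraMap F K (p.coeff 0)) < v P (algebraMap F K (p.coeff 0)) := by
    rw [hval]
    exact ordGE_one_iff_lt_one.mp (h.ordGE_aeval_sub_coeff_zero P (hs.mono zero_le_one) hs p)
  simpa [hval] using Valuation.map_add_eq_of_lt_left (v P) hlt

theorem exists_ordGE_one_sub_one (S : Finset ι) {P : ι} (hP : P ∈ S) :
    ∃ e, OrdGE (v P) 1 (e - 1) ∧ ∀ Q ∈ S, Q ≠ P → OrdGE (v Q) 1 e := by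
  obtain ⟨e, heP, heQ⟩ := h.exists_separating S P hP
  obtain ⟨c, hc⟩ := h.exists_residue P e (ordGE_zero_iff_le_one.mpr heP.le)
  have hc0 : c ≠ 0 := by
    rintro rfl
    rw [map_zero, sub_zero, ordGE_one_iff_lt_one] at hc
    exact hc.ne heP
  have hcK : algebraMap F K c ≠ 0 := by simpa using hc0
  have hdiv : ∀ {Q f}, OrdGE (v Q) 1 f → OrdGE (v Q) 1 (f / algebraMap F K c) := fun {Q f} hf => by
    simpa [h.vOrd_algebraMap Q hc0] using hf.div hcK
  refine ⟨e / algebraMap F K c, ?_, fun Q hQ hne => hdiv (heQ Q hQ hne)⟩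
  simpa [sub_div, hcK] using hdiv hc

theorem exists_ordGE_sub_one (S : Finset ι) {P : ι} (hP : P ∈ S) (N : ℕ) :
    ∃ e, OrdGE (v P) N (e - 1) ∧ ∀ Q ∈ S, Q ≠ P → OrdGE (v Q) N e := by
  obtain ⟨e, heP, heQ⟩ := h.exists_ordGE_one_sub_one S hP
  have one_sub_pow : ∀ (u : K) (n : ℕ), 1 - u ^ n = (1 - u) * ∑ i ∈ Finset.range n, u ^ i :=
    fun u n => (mul_neg_geom_sum u n).symm
  refine ⟨1 - (1 - e ^ N) ^ N, ?_, fun Q hQ hne => ?_⟩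
  · have he0 : OrdGE (v P) 0 e := by simpa using (heP.mono zero_le_one).add OrdGE.one
    have hpow : OrdGE (v P) 1 (1 - e ^ N) := by
      rw [one_sub_pow]
      exact (by simpa using heP.neg : OrdGE (v P) 1 (1 - e)).mul_right
        (OrdGE.sum fun i _ => he0.pow_of_zero i)
    simpa using (hpow.pow N).neg
  · have hpow : OrdGE (v Q) N (e ^ N) := by simpa using (heQ Q hQ hne).pow N
    rw [one_sub_pow, sub_sub_cancel]
    exact hpow.mul_right
      (OrdGE.sum fun i _ => (OrdGE.one.sub (hpow.mono (by simp))).pow_of_zero i)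

theorem exists_approx (S : Finset ι) (z : ι → K) (N : ℤ) :
    ∃ y, ∀ P ∈ S, OrdGE (v P) N (y - z P) := by
  classical
  obtain ⟨M, hM⟩ :=
    ((S ×ˢ S).image fun x => (N - vOrd (v x.2) (z x.1)).toNat).exists_le
  have hbound : ∀ P ∈ S, ∀ Q ∈ S, N ≤ vOrd (v Q) (z P) + M := fun P hP Q hQ => by
    have := hM _ (Finset.mem_image_of_mem _ (Finset.mk_mem_product hP hQ))
    lia
  choose! e heP heQ using fun P (hP : P ∈ S) => h.exists_ordGE_sub_one S hP M
  refine ⟨∑ P ∈ S, z P * e P, fun Q hQ => ?_⟩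
  have hsum : ∑ P ∈ S, z P * e P - z Q = z Q * (e Q - 1) + ∑ P ∈ S.erase Q, z P * e P := by
    rw [← Finset.add_sum_erase S _ hQ]
    ring
  rw [hsum]
  refine (((OrdGE.self _).mul (heP Q hQ)).mono (hbound Q hQ Q hQ)).add (OrdGE.sum fun P hP => ?_)
  obtain ⟨hne, hPS⟩ := Finset.mem_erase.mp hP
  exact ((OrdGE.self _).mul (heQ P hPS Q hQ hne.symm)).mono (hbound P hPS Q hQ)

theorem exists_isSimultaneousParameter [Infinite F] (S : Finset ι) :
    ∃ (y : K) (c : ι → F), IsSimultaneousParameter v S y c := by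
  obtain ⟨c, -, hc⟩ := S.finite_toSet.exists_injOn_of_encard_le (t := (Set.univ : Set F))
    (by simp)
  choose t ht using h.exists_uniformizer
  obtain ⟨y, hy⟩ := h.exists_approx S (fun P => algebraMap F K (c P) + t P) 2
  refine ⟨y, c, hc, fun P hP => ?_⟩
  have hlt : v P (y - (algebraMap F K (c P) + t P)) < v P (t P) := by
    refine (hy P hP).trans_lt ?_
    rw [ht, exp_lt_exp]
    norm_num
  have hval := Valuation.map_add_eq_of_lt_left (v P) hlt
  rwa [sub_add_eq_sub_sub, add_sub_cancel, ht] at hval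

/-! ### The number of zeros of a function -/

theorem X_sub_C_pow_dvd_of_ordGE (P : ι) {y : K} {c : F}
    (hy : v P (y - algebraMap F K c) = exp (-1)) {p : F[X]} {e : ℕ}
    (hp : OrdGE (v P) e (aeval y p)) : (X - C c) ^ e ∣ p := by
  by_cases hp0 : p = 0
  · simp [hp0]
  rw [← le_rootMultiplicity_iff hp0]
  obtain ⟨q, hpq, hq⟩ := exists_eq_pow_rootMultiplicity_mul_and_not_dvd p hp0 c
  have hq_unit : v P (aeval y q) = 1 := by
    have := h.valuation_aeval_of_coeff_zero_ne_zero P (s := y - algebraMap F K c) hy.le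
      (p := q.comp (X + C c)) (by simpa [coeff_zero_eq_eval_zero, dvd_iff_isRoot] using hq)
    simpa [aeval_comp] using this
  have hval : v P (aeval y p) = exp (-(p.rootMultiplicity c : ℤ)) := by
    conv_lhs => rw [hpq]
    simp [hq_unit, hy, ← exp_nsmul]
  rw [OrdGE, hval, exp_le_exp] at hp
  lia

variable {S : Finset ι} {s y : K} {c : ι → F}

theorem eq_zero_of_degree_lt_sum (hy : IsSimultaneousParameter v S y c) {e : ι → ℕ} {p : F[X]}
    (hdeg : p.degree < ↑(∑ P ∈ S, e P)) (hp : ∀ P ∈ S, OrdGE (v P) (e P) (aeval y p)) : p = 0 := by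
  have hdvd : ∏ P ∈ S, (X - C (c P)) ^ e P ∣ p := by
    refine Finset.prod_dvd_of_coprime (fun P hP Q hQ hne => ?_) fun P hP =>
      h.X_sub_C_pow_dvd_of_ordGE P (hy.valuation_sub P hP) (hp P hP)
    exact (isCoprime_X_sub_C_of_isUnit_sub
      (sub_ne_zero.mpr fun heq => hne (hy.injOn hP hQ heq)).isUnit).pow
  refine eq_zero_of_dvd_of_degree_lt hdvd (hdeg.trans_eq ?_)
  simp [degree_prod]

theorem ordGE_of_isSimultaneousParameter (hy : IsSimultaneousParameter v S y c) {P : ι}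
    (hP : P ∈ S) : OrdGE (v P) 0 y := by
  have hsub : OrdGE (v P) 1 (y - algebraMap F K (c P)) := (hy.valuation_sub P hP).le
  simpa using (hsub.mono zero_le_one).add (h.ordGE_algebraMap P (c P))

theorem coeff_zero_eq_zero_of_relation (hy : IsSimultaneousParameter v S y c)
    (hs : ∀ P ∈ S, OrdGE (v P) 0 s) (r : Fin (zerosDegree v S s) → F[X])
    (hr : ∀ P ∈ S, OrdGE (v P) (vOrd (v P) s) (∑ i, aeval s (r i) * y ^ (i : ℕ)))
    (i : Fin (zerosDegree v S s)) : (r i).coeff 0 = 0 := by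
  set p : F[X] := ∑ i, C ((r i).coeff 0) * X ^ (i : ℕ) with hp
  have hdeg : p.degree < (zerosDegree v S s : ℕ) := by
    simpa only [hp, ← C_mul_X_pow_eq_monomial, ← Fin.sum_univ_eq_sum_range] using
      degree_sum_fin_lt fun i => (r i).coeff 0
  have hpy : ∀ P ∈ S, OrdGE (v P) (vOrd (v P) s) (aeval y p) := fun P hP => by
    have hsplit : aeval y p = ∑ i, aeval s (r i) * y ^ (i : ℕ) -
        ∑ i, (aeval s (r i) - algebraMap F K ((r i).coeff 0)) * y ^ (i : ℕ) := by
      simp [hp, sub_mul]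
    rw [hsplit]
    refine (hr P hP).sub (OrdGE.sum fun i _ => ?_)
    exact (h.ordGE_aeval_sub_coeff_zero P (hs P hP) (OrdGE.self s) _).mul_right
      ((h.ordGE_of_isSimultaneousParameter hy hP).pow_of_zero i)
  have hp0 : p = 0 := h.eq_zero_of_degree_lt_sum hy hdeg fun P hP => by
    simpa only [Int.toNat_of_nonneg (vOrd_nonneg (hs P hP))] using hpy P hP
  simpa [hp, finsetSum_coeff, coeff_C_mul, coeff_X_pow, Fin.val_inj] using congr(coeff $hp0 i)

theorem exists_vOrd_aeval_eq_mul (hs0 : s ≠ 0) {p : F[X]} (hp : p ≠ 0) :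
    ∃ m : ℤ, ∀ P, OrdGE (v P) 1 s → vOrd (v P) (aeval s p) = m * vOrd (v P) s := by
  obtain ⟨q, hpq, hq⟩ := exists_eq_pow_rootMultiplicity_mul_and_not_dvd p hp 0
  rw [map_zero, sub_zero] at hpq hq
  refine ⟨p.rootMultiplicity 0, fun P hP => ?_⟩
  have hval := h.valuation_aeval_of_coeff_zero_ne_zero P hP (mt X_dvd_iff.mpr hq)
  have hq0 : aeval s q ≠ 0 := (Valuation.ne_zero_iff (v P)).mp (by simp [hval])
  conv_lhs => rw [hpq]
  rw [map_mul, map_pow, aeval_X, vOrd_mul (pow_ne_zero _ hs0) hq0, vOrd_pow,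
    vOrd_eq_of_eq_exp_neg (m := 0) (f := aeval s q) (by simpa using hval), add_zero]

theorem exists_vOrd_eq_mul (hs0 : s ≠ 0) {u : K} (hu : u ∈ F⟮s⟯) (hu0 : u ≠ 0) :
    ∃ m : ℤ, ∀ P, OrdGE (v P) 1 s → vOrd (v P) u = m * vOrd (v P) s := by
  obtain ⟨p, q, rfl⟩ := (IntermediateField.mem_adjoin_simple_iff F u).mp hu
  obtain ⟨hp, hq⟩ := div_ne_zero_iff.mp hu0
  obtain ⟨m, hm⟩ := h.exists_vOrd_aeval_eq_mul hs0 (p := p) (by rintro rfl; simp at hp)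
  obtain ⟨n, hn⟩ := h.exists_vOrd_aeval_eq_mul hs0 (p := q) (by rintro rfl; simp at hq)
  exact ⟨m - n, fun P hP => by rw [vOrd_div hp hq, hm P hP, hn P hP, sub_mul]⟩

theorem linearIndependent_pow (hs : Transcendental F s) (hsS : ∀ P ∈ S, OrdGE (v P) 0 s)
    (hy : IsSimultaneousParameter v S y c) :
    LinearIndependent F⟮s⟯ fun i : Fin (zerosDegree v S s) => y ^ (i : ℕ) := by
  rw [Fintype.linearIndependent_iff]
  intro a ha
  by_contra! hne
  obtain ⟨u, r, -, hur, i, hi⟩ :=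
    exists_primitive_multiple hs a (Function.ne_iff.mpr hne)
  refine hi (h.coeff_zero_eq_zero_of_relation hy hsS r (fun P _ => ?_) i)
  have hsum : ∑ i, aeval s (r i) * y ^ (i : ℕ) = 0 := by
    simpa [← hur, Finset.mul_sum, mul_assoc, Algebra.smul_def] using congr((u : K) * $ha)
  exact hsum ▸ OrdGE.zero _

theorem ordGE_coeff_of_ordGE_sum (hs : Transcendental F s) (hsS : ∀ P ∈ S, OrdGE (v P) 1 s)
    (hy : IsSimultaneousParameter v S y c) (a : Fin (zerosDegree v S s) → F⟮s⟯)
    (ha : ∀ P ∈ S, OrdGE (v P) 0 (∑ i, (a i : K) * y ^ (i : ℕ))) (i) {P : ι} (hP : P ∈ S) :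
    OrdGE (v P) 0 (a i : K) := by
  by_cases ha0 : a = 0
  · simpa [ha0] using OrdGE.zero _
  have hs0 : s ≠ 0 := ne_zero_of_transcendental hs
  have hs_reg : ∀ P ∈ S, OrdGE (v P) 0 s := fun P hP => (hsS P hP).mono zero_le_one
  have hs_pos : ∀ P ∈ S, 1 ≤ vOrd (v P) s := fun P hP => (ordGE_iff_le_vOrd hs0).mp (hsS P hP)
  obtain ⟨u, r, hu, hur, j, hj⟩ := exists_primitive_multiple hs a ha0
  have hu0 : (u : K) ≠ 0 := fun h0 => hu (Subtype.ext h0)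
  obtain ⟨m, hm⟩ := h.exists_vOrd_eq_mul hs0 u.2 hu0
  have hm_nonpos : m ≤ 0 := by
    by_contra! hm_pos
    refine hj (h.coeff_zero_eq_zero_of_relation hy hs_reg r (fun Q hQ => ?_) j)
    have hsum : ∑ i, aeval s (r i) * y ^ (i : ℕ) = u * ∑ i, (a i : K) * y ^ (i : ℕ) := by
      simp only [← hur, Finset.mul_sum, mul_assoc]
    rw [hsum, OrdGE.mul_iff hu0, hm Q (hsS Q hQ)]
    exact (ha Q hQ).mono (by nlinarith [hs_pos Q hQ])
  have hmul : OrdGE (v P) 0 ((u : K) * a i) := hur i ▸ h.ordGE_aeval P (hs_reg P hP) _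
  rw [OrdGE.mul_iff hu0, hm P (hsS P hP)] at hmul
  exact hmul.mono (by nlinarith [hs_pos P hP])

theorem sum_vOrd_le_finrank [Infinite F] (hs : Transcendental F s)
    (hS : ∀ P ∈ S, OrdGE (v P) 0 s) : ∑ P ∈ S, vOrd (v P) s ≤ Module.finrank F⟮s⟯ K := by
  have := h.finiteDimensional s hs
  obtain ⟨y, c, hy⟩ := h.exists_isSimultaneousParameter S
  have hcard := (h.linearIndependent_pow hs hS hy).fintype_card_le_finrank
  rw [← cast_zerosDegree hS]
  exact_mod_cast (Fintype.card_fin _).symm.trans_le hcard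

theorem finite_zeros [Infinite F] (hs : Transcendental F s) : {P | OrdGE (v P) 1 s}.Finite := by
  have hs0 : s ≠ 0 := ne_zero_of_transcendental hs
  by_contra hinf
  obtain ⟨S, hS, hcard⟩ := Set.Infinite.exists_subset_card_eq hinf (Module.finrank F⟮s⟯ K + 1)
  have hle := h.sum_vOrd_le_finrank (S := S) hs fun P hP => (hS hP : OrdGE _ 1 s).mono zero_le_one
  have hcard_le : S.card • (1 : ℤ) ≤ ∑ P ∈ S, vOrd (v P) s :=
    Finset.card_nsmul_le_sum S _ 1 fun P hP => (ordGE_iff_le_vOrd hs0).mp (hS hP)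
  rw [hcard, nsmul_one] at hcard_le
  lia

theorem finite_support [IsAlgClosed F] (f : K) : {P | vOrd (v P) f ≠ 0}.Finite := by
  rcases transcendental_or_mem_range (F := F) f with hf | ⟨c, rfl⟩
  · have hf0 : f ≠ 0 := ne_zero_of_transcendental hf
    refine ((h.finite_zeros hf).union (h.finite_zeros (transcendental_inv hf))).subset
      fun P (hP : vOrd (v P) f ≠ 0) => ?_
    simp only [Set.mem_union, Set.mem_ofPred_eq, ordGE_iff_le_vOrd hf0,
      ordGE_iff_le_vOrd (inv_ne_zero hf0), vOrd_inv]
    lia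
  · rcases eq_or_ne c 0 with rfl | hc
    · simp [vOrd]
    · simp [h.vOrd_algebraMap _ hc]

end IsPlaceSystem

/-! ### Riemann–Roch spaces and Riemann's inequality -/

section Degree

variable {ι : Type*} {D D' : ι →₀ ℤ}

theorem degree_nonneg (hD : 0 ≤ D) : 0 ≤ D.degree :=
  Finset.sum_nonneg fun P _ => hD P

theorem degree_le_degree (h : D ≤ D') : D.degree ≤ D'.degree := by
  simpa using degree_nonneg (sub_nonneg.mpr h)

theorem eq_of_le_of_degree_eq (h : D ≤ D') (hdeg : D.degree = D'.degree) : D = D' := by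
  have hsub : ∀ P, 0 ≤ (D' - D) P := fun P => sub_nonneg.mpr (h P)
  have hzero : (D' - D).degree = 0 := by rw [map_sub, hdeg, sub_self]
  ext P
  by_contra hP
  have hmem : P ∈ (D' - D).support := by simpa [sub_eq_zero] using Ne.symm hP
  refine hP (sub_eq_zero.mp ?_).symm
  simpa using (Finset.sum_eq_zero_iff_of_nonneg fun Q _ => hsub Q).mp hzero P hmem

end Degree

theorem finite_and_finrank_le_add_one {F V : Type*} [Field F] [AddCommGroup V] [Module F V]
    {A B : Submodule F V} [Module.Finite F A] (b : V) (hb : ∀ f ∈ B, ∃ c : F, f - c • b ∈ A) :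
    Module.Finite F B ∧ Module.finrank F B ≤ Module.finrank F A + 1 := by
  have hle : B ≤ A ⊔ Submodule.span F {b} := fun f hf => by
    obtain ⟨c, hc⟩ := hb f hf
    exact Submodule.mem_sup.mpr ⟨_, hc, c • b, Submodule.smul_mem _ _
      (Submodule.mem_span_singleton_self b), sub_add_cancel _ _⟩
  refine ⟨Submodule.finiteDimensional_of_le hle, ?_⟩
  calc Module.finrank F B ≤ Module.finrank F (A ⊔ Submodule.span F {b} : Submodule F V) :=
        Submodule.finrank_mono hle
    _ ≤ Module.finrank F A + Module.finrank F (Submodule.span F {b}) :=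
        Submodule.finrank_add_le_finrank_add_finrank _ _
    _ ≤ Module.finrank F A + 1 := by
        gcongr
        simpa using finrank_span_le_card (R := F) ({b} : Set V)

variable {F K ι : Type*} [Field F] [Field K] [Algebra F K] {v : ι → Valuation K ℤᵐ⁰}

namespace IsPlaceSystem

variable (h : IsPlaceSystem F v)

include h

/-- The Riemann–Roch space `L(D)` of a divisor `D`. -/
def rrSpace (D : ι →₀ ℤ) : Submodule F K where
  carrier := {f | ∀ P, OrdGE (v P) (-D P) f}
  zero_mem' _ := OrdGE.zero _
  add_mem' hf hg P := (hf P).add (hg P)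
  smul_mem' c f hf P := by
    rw [Algebra.smul_def]
    exact (h.ordGE_algebraMap P c).mul_left (hf P)

theorem rrSpace_mono {D D' : ι →₀ ℤ} (hD : D ≤ D') : h.rrSpace D ≤ h.rrSpace D' :=
  fun _ hf P => (hf P).mono (neg_le_neg (hD P))

theorem mul_mem_rrSpace {D D' : ι →₀ ℤ} {f g : K} (hf : f ∈ h.rrSpace D) (hg : g ∈ h.rrSpace D') :
    f * g ∈ h.rrSpace (D + D') := fun P => ((hf P).mul (hg P)).mono (by simp [add_comm])

theorem pow_mem_rrSpace {D : ι →₀ ℤ} {f : K} (hf : f ∈ h.rrSpace D) (n : ℕ) :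
    f ^ n ∈ h.rrSpace (n • D) :=
  fun P => ((hf P).pow n).mono (by simp)

theorem rrSpace_zero_le : h.rrSpace 0 ≤ Submodule.span F {1} := fun f hf => by
  obtain ⟨c, rfl⟩ := h.mem_range_of_regular f fun P => by simpa using hf P
  rw [Algebra.algebraMap_eq_smul_one]
  exact Submodule.smul_mem _ _ (Submodule.mem_span_singleton_self _)

theorem finite_rrSpace_zero : Module.Finite F (h.rrSpace 0) :=
  Submodule.finiteDimensional_of_le h.rrSpace_zero_le

theorem finrank_rrSpace_zero_le : Module.finrank F (h.rrSpace 0) ≤ 1 :=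
  (Submodule.finrank_mono h.rrSpace_zero_le).trans
    (by simpa using finrank_span_le_card (R := F) ({1} : Set K))

theorem ordGE_of_mem_rrSpace_add_single {D : ι →₀ ℤ} {P Q : ι} {f : K}
    (hf : f ∈ h.rrSpace (D + .single P 1)) (hQ : Q ≠ P) : OrdGE (v Q) (-D Q) f := by
  simpa [hQ] using hf Q

theorem vOrd_eq_of_mem_rrSpace_add_single {D : ι →₀ ℤ} {P : ι} {f : K}
    (hf : f ∈ h.rrSpace (D + .single P 1)) (hfD : f ∉ h.rrSpace D) :
    f ≠ 0 ∧ vOrd (v P) f = -(D P + 1) := by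
  have hf0 : f ≠ 0 := fun h0 => hfD (h0 ▸ Submodule.zero_mem _)
  have hge : OrdGE (v P) (-(D P + 1)) f := by simpa using hf P
  have hlt : ¬ OrdGE (v P) (-D P) f := fun hc => hfD fun Q => by
    by_cases hQ : Q = P
    · exact hQ ▸ hc
    · exact h.ordGE_of_mem_rrSpace_add_single hf hQ
  rw [ordGE_iff_le_vOrd hf0] at hge hlt
  exact ⟨hf0, by lia⟩

theorem finrank_rrSpace_add_single_le {D : ι →₀ ℤ} (P : ι) [Module.Finite F (h.rrSpace D)] :
    Module.Finite F (h.rrSpace (D + .single P 1)) ∧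
      Module.finrank F (h.rrSpace (D + .single P 1)) ≤ Module.finrank F (h.rrSpace D) + 1 := by
  by_cases hle : h.rrSpace (D + .single P 1) ≤ h.rrSpace D
  · exact ⟨Submodule.finiteDimensional_of_le hle,
      (Submodule.finrank_mono hle).trans (Nat.le_succ _)⟩
  obtain ⟨b, hb, hbD⟩ := Set.not_subset.mp hle
  obtain ⟨hb0, hord⟩ := h.vOrd_eq_of_mem_rrSpace_add_single hb hbD
  refine finite_and_finrank_le_add_one b fun f hf => ?_
  have hfP : OrdGE (v P) (-(D P + 1)) f := by simpa using hf P
  have hdiv : OrdGE (v P) 0 (f / b) := by simpa only [hord, sub_self] using hfP.div hb0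
  obtain ⟨c, hc⟩ := h.exists_residue P _ hdiv
  refine ⟨c, fun Q => ?_⟩
  rw [Algebra.smul_def]
  by_cases hQ : Q = P
  · subst hQ
    have hmul := (OrdGE.self (v := v Q) b).mul hc
    rw [mul_sub, mul_div_cancel₀ _ hb0, mul_comm b, hord] at hmul
    exact hmul.mono (by lia)
  · exact (h.ordGE_of_mem_rrSpace_add_single hf hQ).sub
      ((h.ordGE_algebraMap Q c).mul_left (h.ordGE_of_mem_rrSpace_add_single hb hQ))

theorem finrank_rrSpace_le_add {D D' : ι →₀ ℤ} (hD : D ≤ D') [Module.Finite F (h.rrSpace D)] :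
    Module.Finite F (h.rrSpace D') ∧ (Module.finrank F (h.rrSpace D') : ℤ) ≤
      Module.finrank F (h.rrSpace D) + (D'.degree - D.degree) := by
  classical
  obtain ⟨n, hn⟩ := Int.eq_ofNat_of_zero_le (sub_nonneg.mpr (degree_le_degree hD))
  induction n generalizing D' with
  | zero =>
    obtain rfl := eq_of_le_of_degree_eq hD (by lia)
    exact ⟨inferInstance, by simp⟩
  | succ n ih =>
    obtain ⟨P, hP⟩ : ∃ P, D P < D' P := by
      by_contra! hc
      have heq : D' = D := le_antisymm hc hD
      simp only [heq, sub_self] at hn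
      lia
    have hle : D ≤ D' - .single P 1 := fun Q => by
      rcases eq_or_ne P Q with rfl | hQ
      · simpa using Int.le_sub_one_of_lt hP
      · simpa [Finsupp.single_apply, hQ] using hD Q
    obtain ⟨_, hrank⟩ := ih hle (by simp only [map_sub, Finsupp.degree_single]; lia)
    obtain ⟨hfin', hrank'⟩ := h.finrank_rrSpace_add_single_le (D := D' - .single P 1) P
    rw [sub_add_cancel] at hfin' hrank'
    rw [map_sub, Finsupp.degree_single] at hrank
    exact ⟨hfin', by lia⟩

instance finite_rrSpace (D : ι →₀ ℤ) : Module.Finite F (h.rrSpace D) := by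
  have := h.finite_rrSpace_zero
  have := (h.finrank_rrSpace_le_add (le_sup_right : (0 : ι →₀ ℤ) ≤ D ⊔ 0)).1
  exact Submodule.finiteDimensional_of_le (h.rrSpace_mono (le_sup_left : D ≤ D ⊔ 0))

theorem finrank_rrSpace_le {D : ι →₀ ℤ} (hD : 0 ≤ D) :
    (Module.finrank F (h.rrSpace D) : ℤ) ≤ 1 + D.degree := by
  have hle := (h.finrank_rrSpace_le_add hD).2
  have hzero := h.finrank_rrSpace_zero_le
  rw [map_zero] at hle
  lia

variable [IsAlgClosed F]

/-- The divisor of a function. It is zero for the function `0`. -/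
noncomputable def divisor (f : K) : ι →₀ ℤ :=
  Finsupp.ofSupportFinite (fun P => vOrd (v P) f) (h.finite_support f)

@[simp] theorem divisor_apply (f : K) (P : ι) : h.divisor f P = vOrd (v P) f := rfl

/-- The divisor of poles of a function. -/
noncomputable def poles (f : K) : ι →₀ ℤ := -h.divisor f ⊔ 0

@[simp] theorem poles_apply (f : K) (P : ι) : h.poles f P = max (-vOrd (v P) f) 0 := rfl

theorem poles_nonneg (f : K) : 0 ≤ h.poles f := le_sup_right

theorem mem_rrSpace_poles (f : K) : f ∈ h.rrSpace (h.poles f) := fun _ =>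
  (OrdGE.self f).mono (neg_le.mp (le_max_left _ _))

theorem divisor_eq_poles_inv_sub_poles (f : K) : h.divisor f = h.poles f⁻¹ - h.poles f := by
  ext P
  simp only [divisor_apply, Finsupp.sub_apply, poles_apply, vOrd_inv]
  lia

theorem divisor_algebraMap {c : F} (hc : c ≠ 0) : h.divisor (algebraMap F K c) = 0 :=
  Finsupp.ext fun _ => h.vOrd_algebraMap _ hc

theorem finrank_rrSpace_add_divisor (D : ι →₀ ℤ) {f : K} (hf : f ≠ 0) :
    Module.finrank F (h.rrSpace (D + h.divisor f)) = Module.finrank F (h.rrSpace D) := by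
  let mulf : K ≃ₗ[F] K := (LinearEquiv.smulOfNeZero K K f hf).restrictScalars F
  have hcomap : h.rrSpace (D + h.divisor f) = (h.rrSpace D).comap (mulf : K →ₗ[F] K) := by
    ext g
    refine forall_congr' fun P => ?_
    rw [show (mulf : K →ₗ[F] K) g = f * g from rfl, OrdGE.mul_iff hf]
    simp only [Finsupp.add_apply, divisor_apply, neg_add']
  rw [hcomap]
  exact (mulf.ofSubmodule' _).finrank_eq

theorem exists_aeval_mul_regular (x z : K) :
    ∃ p : F[X], p ≠ 0 ∧ ∀ P, OrdGE (v P) 0 x → OrdGE (v P) 0 (aeval x p * z) := by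
  classical
  let S := (h.finite_support z).toFinset
  choose! c hc using fun P (hP : OrdGE (v P) 0 x) => h.exists_residue P x hP
  refine ⟨∏ P ∈ S, (X - C (c P)) ^ (-vOrd (v P) z).toNat,
    Finset.prod_ne_zero_iff.mpr fun P _ => pow_ne_zero _ (X_sub_C_ne_zero _), fun P hP => ?_⟩
  by_cases hPS : P ∈ S
  · rw [← Finset.mul_prod_erase _ _ hPS, map_mul, map_pow, map_sub, aeval_X, aeval_C]
    exact ((((hc P hP).pow _).mul_right (h.ordGE_aeval P hP _)).mul (OrdGE.self z)).mono (by lia)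
  · have hz : vOrd (v P) z = 0 := by simpa [S] using hPS
    exact (h.ordGE_aeval P hP _).mul_left (hz ▸ OrdGE.self z)

theorem exists_mem_rrSpace_smul_poles {x g : K} (hg : ∀ P, OrdGE (v P) 0 x → OrdGE (v P) 0 g) :
    ∃ m : ℕ, g ∈ h.rrSpace (m • h.poles x) := by
  let S := (h.finite_support x).toFinset
  refine ⟨S.sup fun P => (-vOrd (v P) g).toNat, fun P => ?_⟩
  by_cases hP : OrdGE (v P) 0 x
  · refine (hg P hP).mono ?_
    simp only [Finsupp.smul_apply, poles_apply, nsmul_eq_mul, Left.neg_nonpos_iff]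
    positivity
  · have hlt : vOrd (v P) x < 0 := by
      rwa [ordGE_iff_le_vOrd (by rintro rfl; exact hP (OrdGE.zero _)), not_le] at hP
    have hle : (-vOrd (v P) g).toNat ≤ S.sup fun P => (-vOrd (v P) g).toNat :=
      Finset.le_sup (f := fun P => (-vOrd (v P) g).toNat) (by simpa [S] using hlt.ne)
    refine (OrdGE.self _).mono ?_
    simp only [Finsupp.smul_apply, poles_apply, nsmul_eq_mul]
    have hpole : (1 : ℤ) ≤ max (-vOrd (v P) x) 0 := by lia
    nlinarith [Int.self_le_toNat (-vOrd (v P) g)]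

theorem exists_aeval_mul_mem_rrSpace (x z : K) :
    ∃ (p : F[X]) (m : ℕ), p ≠ 0 ∧ aeval x p * z ∈ h.rrSpace (m • h.poles x) := by
  obtain ⟨p, hp, hreg⟩ := h.exists_aeval_mul_regular x z
  obtain ⟨m, hm⟩ := h.exists_mem_rrSpace_smul_poles hreg
  exact ⟨p, m, hp, hm⟩

variable {x : K}

theorem exists_basis_mem_rrSpace (hx : Transcendental F x) :
    ∃ (b : Module.Basis (Fin (Module.finrank F⟮x⟯ K)) F⟮x⟯ K) (m : ℕ),
      ∀ i, b i ∈ h.rrSpace (m • h.poles x) := by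
  have := h.finiteDimensional x hx
  let b := Module.finBasis F⟮x⟯ K
  choose p m hp hm using fun i => h.exists_aeval_mul_mem_rrSpace x (b i)
  let u : Fin (Module.finrank F⟮x⟯ K) → F⟮x⟯ := fun i => ⟨_, aeval_mem_adjoin_simple x (p i)⟩
  have hu : ∀ i, u i ≠ 0 := fun i h0 =>
    aeval_ne_zero_of_transcendental hx (hp i) congr(($h0 : K))
  refine ⟨b.unitsSMul fun i => Units.mk0 (u i) (hu i), Finset.univ.sup m, fun i => ?_⟩
  rw [Module.Basis.unitsSMul_apply]
  exact h.rrSpace_mono (nsmul_le_nsmul_left (h.poles_nonneg x)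
    (Finset.le_sup (f := m) (Finset.mem_univ i))) (hm i)

/-- The main term of Riemann's inequality: `ℓ` grows at least linearly along multiples of the
divisor of poles of `x`. -/
theorem exists_finrank_mul_le (hx : Transcendental F x) : ∃ m : ℕ, ∀ l : ℕ,
    Module.finrank F⟮x⟯ K * (l + 1) ≤ Module.finrank F (h.rrSpace ((l + m) • h.poles x)) := by
  obtain ⟨b, m, hb⟩ := h.exists_basis_mem_rrSpace hx
  refine ⟨m, fun l => ?_⟩
  have hgen : Transcendental F (IntermediateField.AdjoinSimple.gen F x) :=
    (transcendental_algebraMap_iff (FaithfulSMul.algebraMap_injective F⟮x⟯ K)).mp hx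
  have hpow : LinearIndependent F
      fun j : Fin (l + 1) => IntermediateField.AdjoinSimple.gen F x ^ (j : ℕ) :=
    (linearIndependent_pow_of_transcendental hgen).comp _ Fin.val_injective
  have hli : LinearIndependent F fun p : Fin (l + 1) × Fin (Module.finrank F⟮x⟯ K) =>
      x ^ (p.1 : ℕ) * b p.2 := linearIndependent_smul hpow b.linearIndependent
  have hmem : ∀ p : Fin (l + 1) × Fin (Module.finrank F⟮x⟯ K),
      x ^ (p.1 : ℕ) * b p.2 ∈ h.rrSpace ((l + m) • h.poles x) := by
    rintro ⟨j, i⟩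
    rw [add_smul]
    refine h.mul_mem_rrSpace (h.rrSpace_mono ?_ (h.pow_mem_rrSpace (h.mem_rrSpace_poles x) j))
      (hb i)
    exact nsmul_le_nsmul_left (h.poles_nonneg x) (by lia)
  have hli' : LinearIndependent F fun p => (⟨_, hmem p⟩ : h.rrSpace ((l + m) • h.poles x)) :=
    LinearIndependent.of_comp (Submodule.subtype _) hli
  simpa [mul_comm] using hli'.fintype_card_le_finrank

theorem degree_poles_le_finrank (hx : Transcendental F x) :
    (h.poles x).degree ≤ Module.finrank F⟮x⟯ K := by
  have hpole : ∀ P ∈ (h.poles x).support, 0 < vOrd (v P) x⁻¹ := fun P hP => by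
    have : max (-vOrd (v P) x) 0 ≠ 0 := by simpa using hP
    rw [vOrd_inv]
    lia
  have hle := h.sum_vOrd_le_finrank (transcendental_inv hx) (S := (h.poles x).support)
    fun P hP => (OrdGE.self _).mono (hpole P hP).le
  rw [adjoin_simple_inv] at hle
  refine le_of_eq_of_le (Finset.sum_congr rfl fun P hP => ?_) hle
  rw [poles_apply, ← vOrd_inv, max_eq_left (hpole P hP).le]

theorem finrank_le_degree_poles (hx : Transcendental F x) :
    (Module.finrank F⟮x⟯ K : ℤ) ≤ (h.poles x).degree := by
  obtain ⟨m, hm⟩ := h.exists_finrank_mul_le hx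
  by_contra! hlt
  have hdeg := degree_nonneg (h.poles_nonneg x)
  set δ := (h.poles x).degree
  set n := Module.finrank F⟮x⟯ K
  have hlinear : ∀ l : ℕ, (n : ℤ) * (l + 1) ≤ 1 + (l + m) * δ := fun l => by
    have hle := h.finrank_rrSpace_le (D := (l + m) • h.poles x) (nsmul_nonneg (h.poles_nonneg x) _)
    rw [map_nsmul, nsmul_eq_mul] at hle
    exact_mod_cast (Nat.cast_le.mpr (hm l)).trans hle
  have hlarge := hlinear (1 + m * δ).toNat
  rw [Int.toNat_of_nonneg (by positivity)] at hlarge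
  have hmul : (δ + 1) * (1 + m * δ + 1) ≤ n * (1 + m * δ + 1) := by
    gcongr
    exact hlt
  linarith

theorem degree_poles (hx : Transcendental F x) : (h.poles x).degree = Module.finrank F⟮x⟯ K :=
  (h.degree_poles_le_finrank hx).antisymm (h.finrank_le_degree_poles hx)

theorem degree_divisor {f : K} (hf : f ≠ 0) : (h.divisor f).degree = 0 := by
  rcases transcendental_or_mem_range (F := F) f with hf' | ⟨c, rfl⟩
  · rw [h.divisor_eq_poles_inv_sub_poles, map_sub, h.degree_poles hf',
      h.degree_poles (transcendental_inv hf'), adjoin_simple_inv, sub_self]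
  · rw [h.divisor_algebraMap (by rintro rfl; simp at hf), map_zero]

theorem exists_le_add_divisor {B D : ι →₀ ℤ} (hpos : 0 < Module.finrank F (h.rrSpace (B - D))) :
    ∃ f ≠ 0, D ≤ B + h.divisor f := by
  obtain ⟨⟨f, hf⟩, hf0⟩ := Module.finrank_pos_iff_exists_ne_zero.mp hpos
  have hf0' : f ≠ 0 := fun h0 => hf0 (Subtype.ext h0)
  refine ⟨f, hf0', fun P => ?_⟩
  have hord := (ordGE_iff_le_vOrd hf0').mp (hf P)
  simp only [Finsupp.add_apply, divisor_apply, Finsupp.sub_apply] at hord ⊢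
  linarith

theorem riemann_inequality (hx : Transcendental F x) :
    ∃ C : ℤ, ∀ D : ι →₀ ℤ, D.degree - Module.finrank F (h.rrSpace D) ≤ C := by
  obtain ⟨m, hm⟩ := h.exists_finrank_mul_le hx
  have := h.finiteDimensional x hx
  have hn : 0 < Module.finrank F⟮x⟯ K := Module.finrank_pos
  refine ⟨(m - 1) * Module.finrank F⟮x⟯ K, fun D => ?_⟩
  set l := (D ⊔ 0).degree.toNat
  have hl : (D ⊔ 0).degree = l :=
    (Int.toNat_of_nonneg (degree_nonneg (le_sup_right : (0 : ι →₀ ℤ) ≤ D ⊔ 0))).symm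
  set B := (l + m) • h.poles x with hB
  have hBdeg : B.degree = (l + m) * Module.finrank F⟮x⟯ K := by
    rw [hB, map_nsmul, h.degree_poles hx]
    simp
  have hBrank : (Module.finrank F⟮x⟯ K : ℤ) * (l + 1) ≤ Module.finrank F (h.rrSpace B) := by
    exact_mod_cast hm l
  have hpos : 0 < Module.finrank F (h.rrSpace (B - D ⊔ 0)) := by
    have hle := (h.finrank_rrSpace_le_add (show B - D ⊔ 0 ≤ B by simp)).2
    rw [map_sub, hl] at hle
    zify
    nlinarith
  obtain ⟨f, hf0, hle⟩ := h.exists_le_add_divisor hpos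
  have hrank := (h.finrank_rrSpace_le_add (le_sup_left.trans hle)).2
  rw [h.finrank_rrSpace_add_divisor B hf0, map_add, h.degree_divisor hf0, hBdeg] at hrank
  linarith

end IsPlaceSystem

/-! ### Derivations and Taylor homomorphisms -/

section Separating

variable {F K : Type*} [Field F] [Field K] [Algebra F K]

section Derivation

variable {M : Type*} [AddCommGroup M] [Module F M] [Module K M]

theorem derivation_eq_zero_of_mem_adjoin_simple (d : Derivation F K M) {x : K}
    (hd : d x = 0) {z : K} (hz : z ∈ F⟮x⟯) : d z = 0 := by
  obtain ⟨p, q, rfl⟩ := (IntermediateField.mem_adjoin_simple_iff F z).mp hz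
  have haeval (p : F[X]) : d (aeval x p) = 0 := by rw [d.map_aeval, hd, smul_zero]
  rw [d.leibniz_div, haeval, haeval, smul_zero, smul_zero, sub_zero, smul_zero]

theorem derivation_eq_zero (d : Derivation F K M) {x : K} (hx : IsSeparatingVariable F x)
    (hd : d x = 0) (z : K) : d z = 0 := by
  have := hx.separable
  have : Algebra.FormallyUnramified F⟮x⟯ K := Algebra.FormallyUnramified.of_isSeparable _ _
  let d' : Derivation F⟮x⟯ K M :=
    { toFun := d
      map_add' := map_add d
      map_smul' := fun c z => by
        have hc : d (algebraMap _ K c) = 0 := derivation_eq_zero_of_mem_adjoin_simple d hd c.2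
        rw [Algebra.smul_def, d.leibniz, hc, smul_zero, add_zero]
        rfl
      map_one_eq_zero' := d.map_one_eq_zero
      leibniz' := d.leibniz }
  calc d z = d'.liftKaehlerDifferential (KaehlerDifferential.D F⟮x⟯ K z) :=
        (d'.liftKaehlerDifferential_comp_D z).symm
    _ = 0 := by rw [Subsingleton.elim (KaehlerDifferential.D F⟮x⟯ K z) 0, map_zero]

theorem derivation_eq_smul [IsScalarTower F K M] (d : Derivation F K M) {x : K}
    (hx : IsSeparatingVariable F x) {D : Derivation F K K} (hD : D x = 1) (z : K) :
    d z = D z • d x := by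
  let e : Derivation F K M := (LinearMap.toSpanSingleton K M (d x)).compDer D
  have he (z : K) : e z = D z • d x := rfl
  have hde := derivation_eq_zero (d - e) hx (by simp [he, hD]) z
  rwa [Derivation.sub_apply, he, sub_eq_zero] at hde

end Derivation

theorem isSeparatingVariable_of_derivation {x : K} (hx : IsSeparatingVariable F x)
    {D : Derivation F K K} (hD : D x = 1) {t : K} (ht : Transcendental F t)
    [FiniteDimensional F⟮t⟯ K] (hDt : D t ≠ 0) : IsSeparatingVariable F t := by
  refine ⟨ht, ?_⟩
  rw [← Algebra.FormallyUnramified.iff_isSeparable, Algebra.formallyUnramified_iff]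
  let d : Derivation F K Ω[K⁄F⟮t⟯] := (KaehlerDifferential.D F⟮t⟯ K).restrictScalars F
  have hd (z : K) : d z = D z • d x := derivation_eq_smul d hx hD z
  have hdt : d t = 0 :=
    (KaehlerDifferential.D F⟮t⟯ K).map_algebraMap (IntermediateField.AdjoinSimple.gen F t)
  have hdx : d x = 0 := (smul_eq_zero.mp ((hd t).symm.trans hdt)).resolve_left hDt
  have hd0 (z : K) : KaehlerDifferential.D F⟮t⟯ K z = 0 := (hd z).trans (by rw [hdx, smul_zero])
  have hbot : (⊤ : Submodule K Ω[K⁄F⟮t⟯]) = ⊥ := by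
    rw [← KaehlerDifferential.span_range_derivation, Submodule.span_eq_bot]
    rintro _ ⟨z, rfl⟩
    exact hd0 z
  exact (Submodule.subsingleton_iff K).mp (subsingleton_of_bot_eq_top hbot.symm)

/-- The first Hasse derivative with respect to `x`, as a derivation. -/
noncomputable def IsTaylorHom.derivation {x : K} {η : K →ₐ[F] PowerSeries K}
    (hη : IsTaylorHom F x η) : Derivation F K K :=
  Derivation.mk' (((PowerSeries.coeff (R := K) 1).restrictScalars F : PowerSeries K →ₗ[F] K) ∘ₗ
    η.toLinearMap) fun a b => by
    simp [PowerSeries.coeff_mul, Finset.Nat.antidiagonal_succ, hη.constantCoeff, mul_comm]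

theorem IsTaylorHom.derivation_apply {x : K} {η : K →ₐ[F] PowerSeries K} (hη : IsTaylorHom F x η)
    (f : K) : hη.derivation f = PowerSeries.coeff 1 (η f) := rfl

theorem IsTaylorHom.derivation_self {x : K} {η : K →ₐ[F] PowerSeries K}
    (hη : IsTaylorHom F x η) : hη.derivation x = 1 := by
  rw [hη.derivation_apply, hη.apply_self, map_add, PowerSeries.coeff_C, if_neg one_ne_zero,
    PowerSeries.coeff_one_X, zero_add]

theorem algHom_eqOn_adjoin_simple {A : Type*} [CommRing A] [IsDomain A] [Algebra F A]
    {η η' : K →ₐ[F] A} {x : K} (hxx : η x = η' x) {z : K} (hz : z ∈ F⟮x⟯) : η z = η' z := by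
  obtain ⟨p, q, rfl⟩ := (IntermediateField.mem_adjoin_simple_iff F z).mp hz
  have haeval (p : F[X]) : η (aeval x p) = η' (aeval x p) := by
    rw [← aeval_algHom_apply, ← aeval_algHom_apply, hxx]
  by_cases hq : aeval x q = 0
  · simp [hq]
  · refine mul_right_cancel₀ ((map_ne_zero_iff η η.injective).mpr hq) ?_
    rw [← map_mul, haeval q, ← map_mul, div_mul_cancel₀ _ hq, haeval]

theorem algHom_eq_of_constantCoeff_eq {x : K} (hx : IsSeparatingVariable F x)
    {η η' : K →ₐ[F] PowerSeries K}
    (hcoeff : ∀ f, PowerSeries.constantCoeff (η f) = PowerSeries.constantCoeff (η' f))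
    (hxx : η x = η' x) : η = η' := by
  have := hx.separable
  have : Algebra.FormallyUnramified F⟮x⟯ K := Algebra.FormallyUnramified.of_isSeparable _ _
  let _ : Algebra F⟮x⟯ (PowerSeries K) :=
    ((η : K →+* PowerSeries K).comp (algebraMap F⟮x⟯ K)).toAlgebra
  let g : K →ₐ[F⟮x⟯] PowerSeries K := { (η : K →+* PowerSeries K) with commutes' := fun _ => rfl }
  let g' : K →ₐ[F⟮x⟯] PowerSeries K := { (η' : K →+* PowerSeries K) with
    commutes' := fun c => (algHom_eqOn_adjoin_simple hxx c.2).symm }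
  have hgg : g = g' := Algebra.FormallyUnramified.ext_of_iInf
    (I := Ideal.span {(PowerSeries.X : PowerSeries K)})
    (Ideal.iInf_pow_eq_bot_of_isDomain _ fun htop => PowerSeries.X_prime.not_isUnit
      (Ideal.span_singleton_eq_top.mp htop)) fun f => by
    rw [Ideal.Quotient.eq, Ideal.mem_span_singleton, PowerSeries.X_dvd_iff, map_sub, sub_eq_zero]
    exact hcoeff f
  exact AlgHom.ext fun f => congr($hgg f)

theorem IsTaylorHom.subst_eq {x : K} (hx : IsSeparatingVariable F x)
    {η η' : K →ₐ[F] PowerSeries K} (hη : IsTaylorHom F x η)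
    (hη' : ∀ f, PowerSeries.constantCoeff (η' f) = f) (f : K) :
    (η f).subst (η' x - PowerSeries.C x) = η' f := by
  have hτ : PowerSeries.constantCoeff (η' x - PowerSeries.C x) = 0 := by simp [hη']
  have hs := PowerSeries.HasSubst.of_constantCoeff_zero' hτ
  have hC (c : K) : (PowerSeries.C c).subst (η' x - PowerSeries.C x) = PowerSeries.C c :=
    PowerSeries.subst_C c
  let ζ : K →ₐ[F] PowerSeries K := ((PowerSeries.substAlgHom hs).restrictScalars F).comp η
  have hζ (f : K) : ζ f = (η f).subst (η' x - PowerSeries.C x) :=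
    congr($(PowerSeries.coe_substAlgHom hs) (η f))
  suffices hζη : ζ = η' by rw [← hζ, hζη]
  refine algHom_eq_of_constantCoeff_eq hx (fun f => ?_) ?_
  · have hf := PowerSeries.constantCoeff_subst_eq_zero hτ (η f - PowerSeries.C f)
      (by simp [hη.constantCoeff])
    rw [PowerSeries.subst_sub hs, hC, map_sub, sub_eq_zero] at hf
    rw [hζ, hη']
    exact hf.trans (PowerSeries.constantCoeff_C f)
  · rw [hζ, hη.apply_self, PowerSeries.subst_add hs, hC, PowerSeries.subst_X hs, add_sub_cancel]

theorem coeff_pow_of_lt {τ : PowerSeries K} (hτ : PowerSeries.constantCoeff τ = 0) {m i : ℕ}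
    (hmi : m < i) : PowerSeries.coeff m (τ ^ i) = 0 :=
  PowerSeries.X_pow_dvd_iff.mp (pow_dvd_pow_of_dvd (PowerSeries.X_dvd_iff.mpr hτ) i) m hmi

theorem coeff_pow_self {τ : PowerSeries K} (hτ : PowerSeries.constantCoeff τ = 0) (m : ℕ) :
    PowerSeries.coeff m (τ ^ m) = PowerSeries.coeff 1 τ ^ m := by
  obtain ⟨ρ, rfl⟩ := PowerSeries.X_dvd_iff.mpr hτ
  have hρ := PowerSeries.coeff_X_pow_mul (ρ ^ m) m 0
  rw [zero_add] at hρ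
  rw [mul_pow, hρ, PowerSeries.coeff_zero_eq_constantCoeff_apply, map_pow,
    ← PowerSeries.coeff_zero_eq_constantCoeff_apply, ← PowerSeries.coeff_succ_X_mul]

theorem exists_chain_rule {x t : K} (hx : IsSeparatingVariable F x) {η η' : K →ₐ[F] PowerSeries K}
    (hη : IsTaylorHom F x η) (hη' : IsTaylorHom F t η') : ∃ c : ℕ → ℕ → K,
      (∀ m, c m m = hη'.derivation x ^ m) ∧ ∀ m f, PowerSeries.coeff m (η' f) =
        ∑ i ∈ Finset.range (m + 1), c m i * PowerSeries.coeff i (η f) := by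
  set τ : PowerSeries K := η' x - PowerSeries.C x with hτdef
  have hτ : PowerSeries.constantCoeff τ = 0 := by simp [hτdef, hη'.constantCoeff]
  refine ⟨fun m i => PowerSeries.coeff m (τ ^ i), fun m => (coeff_pow_self hτ m).trans ?_,
    fun m f => ?_⟩
  · rw [hτdef, map_sub, PowerSeries.coeff_C, if_neg one_ne_zero, sub_zero,
      hη'.derivation_apply]
  · rw [← hη.subst_eq hx hη'.constantCoeff, PowerSeries.coeff_subst'
      (PowerSeries.HasSubst.of_constantCoeff_zero' hτ),
      finsum_eq_sum_of_support_subset (s := Finset.range (m + 1))]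
    · exact Finset.sum_congr rfl fun i _ => by rw [smul_eq_mul, mul_comm]
    · intro i hi
      by_contra hmi
      exact hi (smul_eq_zero_of_right _ (coeff_pow_of_lt hτ (by simpa using hmi)))

end Separating

namespace IsPlaceSystem

variable {F K ι : Type*} [Field F] [Field K] [Algebra F K] {v : ι → Valuation K ℤᵐ⁰}
  (h : IsPlaceSystem F v)

include h

theorem exists_expansion (P : ι) {t : K} (ht : v P t = exp (-1)) {f : K} (hf : OrdGE (v P) 0 f)
    (N : ℕ) : ∃ (p : F[X]) (g : K), OrdGE (v P) 0 g ∧ f = aeval t p + t ^ N * g := by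
  have ht0 : t ≠ 0 := ne_zero_of_eq_exp ht
  induction N with
  | zero => exact ⟨0, f, hf, by simp⟩
  | succ N ih =>
    obtain ⟨p, g, hg, rfl⟩ := ih
    obtain ⟨c, hc⟩ := h.exists_residue P g hg
    refine ⟨p + C c * X ^ N, (g - algebraMap F K c) / t, ?_, ?_⟩
    · simpa [vOrd_eq_of_eq_exp_neg ht] using hc.div ht0
    · simp only [map_add, map_mul, aeval_C, aeval_X_pow]
      field_simp
      ring

theorem ordGE_derivation_of_mem_adjoin (P : ι) (D : Derivation F K K) {T : Set K} {m : ℤ}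
    (hT : ∀ u ∈ T, OrdGE (v P) 0 u ∧ OrdGE (v P) m (D u)) {a : K}
    (ha : a ∈ Algebra.adjoin F T) : OrdGE (v P) 0 a ∧ OrdGE (v P) m (D a) := by
  induction ha using Algebra.adjoin_induction with
  | mem u hu => exact hT u hu
  | algebraMap c =>
    exact ⟨h.ordGE_algebraMap P c, by rw [D.map_algebraMap]; exact OrdGE.zero _⟩
  | add a b _ _ ha hb => exact ⟨ha.1.add hb.1, by rw [map_add]; exact ha.2.add hb.2⟩
  | mul a b _ _ ha hb =>
    refine ⟨ha.1.mul_left hb.1, ?_⟩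
    rw [D.leibniz]
    exact (ha.1.mul_left hb.2).add (hb.1.mul_left ha.2)

theorem ordGE_derivation_of_generators (P : ι) (D : Derivation F K K) {T : Finset K}
    (hT : ∀ f, OrdGE (v P) 0 f →
      ∃ a ∈ Algebra.adjoin F {u | u ∈ T ∧ OrdGE (v P) 0 u},
      ∃ b ∈ Algebra.adjoin F {u | u ∈ T ∧ OrdGE (v P) 0 u}, v P b = 1 ∧ f = a / b)
    {m : ℤ} (hm : ∀ u ∈ T, OrdGE (v P) m (D u)) {f : K} (hf : OrdGE (v P) 0 f) :
    OrdGE (v P) m (D f) := by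
  obtain ⟨a, ha, b, hb, hb1, rfl⟩ := hT f hf
  obtain ⟨ha0, hDa⟩ := h.ordGE_derivation_of_mem_adjoin P D (fun u hu => ⟨hu.2, hm u hu.1⟩) ha
  obtain ⟨hb0, hDb⟩ := h.ordGE_derivation_of_mem_adjoin P D (fun u hu => ⟨hu.2, hm u hu.1⟩) hb
  have hbne : b ≠ 0 := (Valuation.ne_zero_iff (v P)).mp (by simp [hb1])
  have hvb : vOrd (v P) b = 0 := vOrd_eq_of_eq_exp_neg (by simpa using hb1)
  have hquot : D (a / b) = (b * D a - a * D b) / (b * b) := by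
    rw [D.leibniz_div]
    simp only [smul_eq_mul]
    field_simp
  rw [hquot]
  simpa [vOrd_mul hbne hbne, hvb] using
    ((hb0.mul_left hDa).sub (ha0.mul_left hDb)).div (mul_ne_zero hbne hbne)

/-- The order of `D` is bounded below on the local ring at `P`, and `f` agrees with a polynomial
in `t` to any given order. -/
theorem ordGE_derivation (P : ι) (D : Derivation F K K) {t : K} (ht : v P t = exp (-1)) {m : ℤ}
    (hm : OrdGE (v P) m (D t)) {f : K} (hf : OrdGE (v P) 0 f) : OrdGE (v P) m (D f) := by
  have ht1 : OrdGE (v P) 1 t := ht.le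
  have ht0 : OrdGE (v P) 0 t := ht1.mono zero_le_one
  obtain ⟨T, hT⟩ := h.exists_generators
  obtain ⟨B, hB⟩ : ∃ B : ℕ, ∀ u ∈ T, (-vOrd (v P) (D u)).toNat ≤ B :=
    ⟨_, fun u hu => Finset.le_sup (f := fun u => (-vOrd (v P) (D u)).toNat) hu⟩
  have hbound (g : K) (hg : OrdGE (v P) 0 g) : OrdGE (v P) (-B) (D g) :=
    h.ordGE_derivation_of_generators P D (hT P)
      (fun u hu => (OrdGE.self _).mono (by have := hB u hu; lia)) hg
  set N := (m + B).toNat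
  obtain ⟨p, g, hg, rfl⟩ := h.exists_expansion P ht hf (N + 1)
  have hcast : OrdGE (v P) 0 ((N + 1 : ℕ) : K) := by
    simpa using h.ordGE_algebraMap P ((N + 1 : ℕ) : F)
  rw [map_add, D.leibniz, D.leibniz_pow, D.map_aeval]
  simp only [smul_eq_mul, nsmul_eq_mul, add_tsub_cancel_right]
  refine ((h.ordGE_aeval P ht0 _).mul_left hm).add (OrdGE.add ?_ ?_)
  · exact ((ht1.pow (N + 1)).mul (hbound g hg)).mono (by push_cast; lia)
  · exact hg.mul_left (hcast.mul_left ((ht0.pow_of_zero N).mul_left hm))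

theorem derivation_uniformizer_ne_zero (P : ι) {D : Derivation F K K} {x : K} (hD : D x ≠ 0) {t : K}
    (ht : v P t = exp (-1)) : D t ≠ 0 := by
  intro hDt
  have hregular (f : K) (hf : OrdGE (v P) 0 f) : D f = 0 := OrdGE.eq_zero_of_forall (v := v P)
    fun m => h.ordGE_derivation P D ht (by rw [hDt]; exact OrdGE.zero _) hf
  have hx0 : x ≠ 0 := by rintro rfl; simp at hD
  by_cases hx : OrdGE (v P) 0 x
  · exact hD (hregular x hx)
  · have hxinv : OrdGE (v P) 0 x⁻¹ := by
      rw [ordGE_iff_le_vOrd hx0] at hx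
      rw [ordGE_iff_le_vOrd (inv_ne_zero hx0), vOrd_inv]
      lia
    have hDinv := hregular _ hxinv
    rw [D.leibniz_inv] at hDinv
    simp [hx0, hD] at hDinv

theorem vOrd_derivation_eq (P : ι) {D : Derivation F K K} {x : K} (hD : D x ≠ 0) {t t' : K}
    (ht : v P t = exp (-1)) {c : F} (ht' : v P (t' - algebraMap F K c) = exp (-1)) :
    vOrd (v P) (D t') = vOrd (v P) (D t) := by
  have hle {s s' : K} (hs : v P s = exp (-1)) (hs' : v P s' = exp (-1)) :
      vOrd (v P) (D s) ≤ vOrd (v P) (D s') := by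
    rw [← ordGE_iff_le_vOrd (h.derivation_uniformizer_ne_zero P hD hs')]
    exact h.ordGE_derivation P D hs (OrdGE.self _) (OrdGE.mono (m := 1) hs'.le zero_le_one)
  have hc : D (t' - algebraMap F K c) = D t' := by simp
  rw [← hc]
  exact le_antisymm (hle ht' ht) (hle ht ht')

end IsPlaceSystem

/-! ### Regularity of traces -/

section Algebra

variable {F K : Type*} [Field F] [Field K] [Algebra F K]

theorem derivation_aeval_sub (D : Derivation F K K) (L : IntermediateField F K) (p : L[X]) (y : K) :
    D (aeval y p) - aeval y (derivative p) * D y = p.sum fun i c => D (c : K) * y ^ i := by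
  induction p using Polynomial.induction_on' with
  | add p q hp hq =>
    rw [sum_add_index p q _ (by simp) (by simp [add_mul]), ← hp, ← hq]
    simp only [map_add]
    ring
  | monomial n a =>
    rw [sum_monomial_index _ _ (by simp), derivative_monomial, aeval_monomial, aeval_monomial,
      D.leibniz, D.leibniz_pow]
    simp only [smul_eq_mul, nsmul_eq_mul, IntermediateField.algebraMap_apply, map_mul, map_natCast]
    ring

theorem trace_mem_range_of_aeval_derivative_mul_mem_adjoin {A E L : Type*} [CommRing A] [IsDomain A]
    [IsIntegrallyClosed A] [Field E] [Algebra A E] [IsFractionRing A E] [Field L] [Algebra E L]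
    [Algebra A L] [IsScalarTower A E L] [FiniteDimensional E L] [Algebra.IsSeparable E L] {y z : L}
    (hy : IsIntegral A y) (htop : Algebra.adjoin E {y} = ⊤)
    (hz : aeval y (derivative (minpoly E y)) * z ∈ Algebra.adjoin A {y}) :
    Algebra.trace E L z ∈ Set.range (algebraMap A E) := by
  have hne : aeval y (derivative (minpoly E y)) ≠ 0 :=
    (Algebra.IsSeparable.isSeparable E y).aeval_derivative_ne_zero (minpoly.aeval _ y)
  have hdual : z ∈ (Algebra.traceForm E L).dualSubmodule
      (Subalgebra.toSubmodule (Algebra.adjoin A {y})) := by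
    rw [traceForm_dualSubmodule_adjoin A E htop hy, Submodule.mem_smul_pointwise_iff_exists]
    exact ⟨_, hz, by rw [smul_eq_mul, inv_mul_cancel_left₀ hne]⟩
  have hone := (LinearMap.BilinForm.mem_dualSubmodule _).mp hdual 1 (Subalgebra.one_mem _)
  rwa [Algebra.traceForm_apply, mul_one, Submodule.mem_one] at hone

/-- The elements of `L` that are regular at the place `w` of `K`, over which minimal polynomials and
traces of regular functions are considered. -/
def localSubring (w : Valuation K ℤᵐ⁰) (L : IntermediateField F K) : ValuationSubring L :=
  (w.comap (algebraMap L K)).valuationSubring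

theorem mem_localSubring {w : Valuation K ℤᵐ⁰} {L : IntermediateField F K} {a : L} :
    a ∈ localSubring w L ↔ OrdGE w 0 (a : K) := by
  rw [ordGE_zero_iff_le_one]
  rfl

instance (w : Valuation K ℤᵐ⁰) (L : IntermediateField F K) :
    IsScalarTower (localSubring w L) L K := IsScalarTower.of_algebraMap_eq fun _ => rfl

end Algebra

namespace IsPlaceSystem

variable {F K ι : Type*} [Field F] [Field K] [Algebra F K] {v : ι → Valuation K ℤᵐ⁰}
  (h : IsPlaceSystem F v) {s : K}

/-- The finite set of zeros of `s`. -/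
noncomputable def zeros [IsAlgClosed F] (hs : Transcendental F s) : Finset ι :=
  (h.finite_zeros hs).toFinset

theorem mem_zeros [IsAlgClosed F] {hs : Transcendental F s} {P : ι} :
    P ∈ h.zeros hs ↔ OrdGE (v P) 1 s := by
  simp [zeros]

include h

theorem exists_eq_div_of_regular (hs : Transcendental F s) {P : ι} (hP : OrdGE (v P) 1 s)
    {c : K} (hc : c ∈ F⟮s⟯) (hcP : OrdGE (v P) 0 c) :
    ∃ p q : F[X], q.coeff 0 ≠ 0 ∧ c = aeval s p / aeval s q := by
  obtain ⟨u, r, hu, hr, j, hj⟩ := exists_primitive_multiple hs ![(⟨c, hc⟩ : F⟮s⟯), 1]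
    (Function.ne_iff.mpr ⟨1, by simp⟩)
  have hnum : (u : K) * c = aeval s (r 0) := by simpa using hr 0
  have hden : (u : K) = aeval s (r 1) := by simpa using hr 1
  have hu0 : (u : K) ≠ 0 := fun h0 => hu (Subtype.ext h0)
  refine ⟨r 0, r 1, fun hden0 => ?_, by rw [← hnum, ← hden, mul_div_cancel_left₀ _ hu0]⟩
  have hnum0 : (r 0).coeff 0 ≠ 0 := by
    fin_cases j
    exacts [hj, absurd hden0 hj]
  have hu1 : OrdGE (v P) 1 (u : K) := by
    have hsub := h.ordGE_aeval_sub_coeff_zero P (hP.mono zero_le_one) hP (r 1)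
    rwa [hden0, map_zero, sub_zero, ← hden] at hsub
  have hlt := hu1.mul_right hcP
  rw [hnum, ordGE_one_iff_lt_one, h.valuation_aeval_of_coeff_zero_ne_zero P hP hnum0] at hlt
  exact lt_irrefl _ hlt

theorem ordGE_derivation_div (D : Derivation F K K) (hD : D s = 1) {Q : ι}
    (hQ : OrdGE (v Q) 1 s) {p q : F[X]} (hq : q.coeff 0 ≠ 0) :
    OrdGE (v Q) 0 (D (aeval s p / aeval s q)) := by
  have hval := h.valuation_aeval_of_coeff_zero_ne_zero Q hQ hq
  have hq0 : aeval s q ≠ 0 := (Valuation.ne_zero_iff (v Q)).mp (by simp [hval])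
  have hord : vOrd (v Q) (aeval s q) = 0 := vOrd_eq_of_eq_exp_neg (by simpa using hval)
  have hquot : D (aeval s p / aeval s q) =
      aeval s (q * derivative p - p * derivative q) / (aeval s q * aeval s q) := by
    rw [D.leibniz_div, D.map_aeval, D.map_aeval, hD]
    simp only [smul_eq_mul, map_sub, map_mul]
    field_simp
  rw [hquot]
  simpa [vOrd_mul hq0 hq0, hord] using
    (h.ordGE_aeval Q (hQ.mono zero_le_one) (q * derivative p - p * derivative q)).div
      (mul_ne_zero hq0 hq0)

theorem ordGE_zero_of_isSimultaneousParameter {S : Finset ι} {y : K} {c : ι → F}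
    (hy : IsSimultaneousParameter v S y c) {Q : ι} (hQ : Q ∈ S) : OrdGE (v Q) 0 y := by
  have hsub : OrdGE (v Q) 0 (y - algebraMap F K (c Q)) :=
    OrdGE.mono (m := 1) (hy.valuation_sub Q hQ).le zero_le_one
  simpa using hsub.add (h.ordGE_algebraMap Q (c Q))

variable [IsAlgClosed F]

theorem zerosDegree_zeros (hs : Transcendental F s) :
    zerosDegree v (h.zeros hs) s = Module.finrank F⟮s⟯ K := by
  classical
  have hs0 := ne_zero_of_transcendental hs
  have hdeg := h.degree_poles (transcendental_inv hs)
  rw [adjoin_simple_inv] at hdeg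
  zify
  rw [← hdeg, Finsupp.degree_apply,
    cast_zerosDegree fun P hP => (h.mem_zeros.mp hP).mono zero_le_one]
  symm
  refine Finset.sum_subset_zero_on_sdiff (fun P hP => ?_) (fun P hP => ?_) fun P hP => ?_
  · have hpole : max (vOrd (v P) s) 0 ≠ 0 := by simpa [vOrd_inv] using hP
    rw [h.mem_zeros, ordGE_iff_le_vOrd hs0]
    lia
  · have hpole : h.poles s⁻¹ P = 0 := by
      simpa [-poles_apply] using (Finset.mem_sdiff.mp hP).2
    rw [poles_apply, vOrd_inv, neg_neg] at hpole
    have hzero := (ordGE_iff_le_vOrd hs0).mp (h.mem_zeros.mp (Finset.mem_sdiff.mp hP).1)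
    lia
  · have hpole : max (vOrd (v P) s) 0 ≠ 0 := by simpa [vOrd_inv] using hP
    rw [poles_apply, vOrd_inv, neg_neg]
    lia

section Trace

variable {hs : Transcendental F s} {y : K} {c : ι → F}
  (hy : IsSimultaneousParameter v (h.zeros hs) y c)

include hy

theorem exists_eq_sum_mul_pow (w : K) :
    ∃ a : Fin (zerosDegree v (h.zeros hs) s) → F⟮s⟯, w = ∑ i, (a i : K) * y ^ (i : ℕ) := by
  have := h.finiteDimensional s hs
  have hli := h.linearIndependent_pow hs (fun Q hQ => (h.mem_zeros.mp hQ).mono zero_le_one) hy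
  have hw : w ∈ Submodule.span F⟮s⟯ (Set.range fun i : Fin (zerosDegree v (h.zeros hs) s) =>
      y ^ (i : ℕ)) := by
    rw [hli.span_eq_top_of_card_eq_finrank' (by rw [Fintype.card_fin, h.zerosDegree_zeros])]
    exact Submodule.mem_top
  obtain ⟨a, ha⟩ := (Submodule.mem_span_range_iff_exists_fun _).mp hw
  exact ⟨a, ha.symm⟩

theorem adjoin_eq_top : Algebra.adjoin F⟮s⟯ {y} = ⊤ := by
  refine eq_top_iff.mpr fun w _ => ?_
  obtain ⟨a, rfl⟩ := h.exists_eq_sum_mul_pow hy w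
  exact sum_mem fun i _ => mul_mem (Subalgebra.algebraMap_mem _ (a i))
    (pow_mem (Algebra.self_mem_adjoin_singleton _ y) _)

variable {P : ι} (hP : P ∈ h.zeros hs)

include hP

theorem exists_localSubring_eq_sum_mul_pow {w : K} (hw : ∀ Q ∈ h.zeros hs, OrdGE (v Q) 0 w) :
    ∃ a : Fin (zerosDegree v (h.zeros hs) s) → localSubring (v P) F⟮s⟯,
      w = ∑ i, ((a i : F⟮s⟯) : K) * y ^ (i : ℕ) := by
  obtain ⟨a, rfl⟩ := h.exists_eq_sum_mul_pow hy w
  exact ⟨fun i => ⟨a i, mem_localSubring.mpr (h.ordGE_coeff_of_ordGE_sum hs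
    (fun Q hQ => h.mem_zeros.mp hQ) hy a hw i hP)⟩, rfl⟩

theorem isIntegral_localSubring : IsIntegral (localSubring (v P) F⟮s⟯) y := by
  set n := zerosDegree v (h.zeros hs) s
  obtain ⟨a, ha⟩ := h.exists_localSubring_eq_sum_mul_pow hy hP (w := y ^ n) fun Q hQ =>
    (h.ordGE_zero_of_isSimultaneousParameter hy hQ).pow_of_zero n
  refine ⟨X ^ n - ∑ i : Fin n, C (a i) * X ^ (i : ℕ), monic_X_pow_sub (degree_sum_fin_lt a), ?_⟩
  have hmap (b : localSubring (v P) F⟮s⟯) :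
      algebraMap (localSubring (v P) F⟮s⟯) K b = ((b : F⟮s⟯) : K) := rfl
  simpa [eval₂_finsetSum, hmap, sub_eq_zero] using ha

theorem mem_adjoin_localSubring {w : K} (hw : ∀ Q ∈ h.zeros hs, OrdGE (v Q) 0 w) :
    w ∈ Algebra.adjoin (localSubring (v P) F⟮s⟯) {y} := by
  obtain ⟨a, rfl⟩ := h.exists_localSubring_eq_sum_mul_pow hy hP hw
  exact sum_mem fun i _ => mul_mem (Subalgebra.algebraMap_mem _ (a i))
    (pow_mem (Algebra.self_mem_adjoin_singleton _ y) _)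

/-- Applying `D` to the equation `φ(y) = 0` expresses `D y * φ'(y)` through the derivatives of the
coefficients of `φ`, which are regular at all zeros of `s`. -/
theorem ordGE_derivation_mul_aeval_derivative_minpoly {D : Derivation F K K} (hD : D s = 1) {Q : ι}
    (hQ : Q ∈ h.zeros hs) :
    OrdGE (v Q) 0 (D y * aeval y (derivative (minpoly F⟮s⟯ y))) := by
  have hint := h.isIntegral_localSubring hy hP
  have := h.finiteDimensional s hs
  set φ := minpoly F⟮s⟯ y with hφ
  have hφ_map : φ = (minpoly (localSubring (v P) F⟮s⟯) y).map (algebraMap _ F⟮s⟯) :=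
    minpoly.isIntegrallyClosed_eq_field_fractions F⟮s⟯ K hint
  have hφP (i : ℕ) : OrdGE (v P) 0 (φ.coeff i : K) := by
    rw [hφ_map, coeff_map]
    exact mem_localSubring.mp ((minpoly (localSubring (v P) F⟮s⟯) y).coeff i).2
  have hDφ := derivation_aeval_sub D _ φ y
  rw [hφ, minpoly.aeval, map_zero, zero_sub, ← hφ] at hDφ
  rw [mul_comm, ← neg_neg (aeval y (derivative φ) * D y), hDφ]
  refine (OrdGE.sum fun i _ => OrdGE.mul_right ?_
    ((h.ordGE_zero_of_isSimultaneousParameter hy hQ).pow_of_zero i)).neg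
  obtain ⟨p, q, hq, hpq⟩ :=
    h.exists_eq_div_of_regular hs (h.mem_zeros.mp hP) (φ.coeff i).2 (hφP i)
  rw [hpq]
  exact h.ordGE_derivation_div D hD (h.mem_zeros.mp hQ) hq

end Trace

/-- By Euler's formula the trace maps `(1 / φ'(y)) O[y]` to `O`, where `φ` is the minimal polynomial
of a simultaneous parameter `y` at the zeros of `s`. -/
theorem ordGE_trace (hs : IsSeparatingVariable F s) {E : IntermediateField F K}
    (hE : F⟮s⟯ = E) {D : Derivation F K K} (hD : D s = 1) {z : K}
    (hz : ∀ Q, OrdGE (v Q) 1 s → ∃ t, v Q t = exp (-1) ∧ OrdGE (v Q) (vOrd (v Q) (D t)) z)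
    {P : ι} (hP : OrdGE (v P) 1 s) : OrdGE (v P) 0 (Algebra.trace E K z : K) := by
  subst hE
  have hst := hs.transcendental
  have := hs.separable
  have := h.finiteDimensional s hst
  obtain ⟨y, c, hy⟩ := h.exists_isSimultaneousParameter (h.zeros hst)
  have hPS : P ∈ h.zeros hst := h.mem_zeros.mpr hP
  have hDs : D s ≠ 0 := by simp [hD]
  have hreg (Q : ι) (hQ : Q ∈ h.zeros hst) :
      OrdGE (v Q) 0 (aeval y (derivative (minpoly F⟮s⟯ y)) * z) := by
    obtain ⟨t, ht, hzt⟩ := hz Q (h.mem_zeros.mp hQ)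
    have hDy : D y ≠ 0 := by
      simpa using h.derivation_uniformizer_ne_zero Q hDs (hy.valuation_sub Q hQ)
    have hφ := h.ordGE_derivation_mul_aeval_derivative_minpoly hy hPS hD hQ
    rw [OrdGE.mul_iff hDy, h.vOrd_derivation_eq Q hDs ht (hy.valuation_sub Q hQ)] at hφ
    exact (hφ.mul hzt).mono (by simp)
  obtain ⟨a, ha⟩ := trace_mem_range_of_aeval_derivative_mul_mem_adjoin
    (h.isIntegral_localSubring hy hPS) (h.adjoin_eq_top hy) (h.mem_adjoin_localSubring hy hPS hreg)
  rw [← ha]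
  exact mem_localSubring.mp a.2

end IsPlaceSystem

/-! ### The degree of the divisor of a differential -/

section Algebra

variable {F K : Type*} [Field F] [Field K] [Algebra F K] {x : K}

theorem adjoin_simple_sub_algebraMap (x : K) (c : F) : F⟮x - algebraMap F K c⟯ = F⟮x⟯ := by
  refine le_antisymm ?_ ?_ <;> rw [IntermediateField.adjoin_simple_le_iff]
  · exact sub_mem (IntermediateField.mem_adjoin_simple_self F x) (F⟮x⟯.algebraMap_mem c)
  · simpa using add_mem (IntermediateField.mem_adjoin_simple_self F (x - algebraMap F K c))
      (F⟮x - algebraMap F K c⟯.algebraMap_mem c)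

theorem isSeparatingVariable_sub_algebraMap (hx : IsSeparatingVariable F x) (c : F) :
    IsSeparatingVariable F (x - algebraMap F K c) where
  transcendental ha := hx.transcendental (by simpa using ha.add (isAlgebraic_algebraMap c))
  separable := by
    rw [adjoin_simple_sub_algebraMap]
    exact hx.separable

theorem isSeparatingVariable_inv (hx : IsSeparatingVariable F x) : IsSeparatingVariable F x⁻¹ where
  transcendental := transcendental_inv hx.transcendental
  separable := by
    rw [adjoin_simple_inv]
    exact hx.separable

theorem neg_sq_smul_derivation_inv (hx : x ≠ 0) {D : Derivation F K K} (hD : D x = 1) :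
    ((-x ^ 2) • D) x⁻¹ = 1 := by
  simp only [Derivation.smul_apply, Derivation.leibniz_inv, hD, smul_eq_mul]
  field_simp

end Algebra

namespace IsPlaceSystem

variable {F K ι : Type*} [Field F] [Field K] [Algebra F K] {v : ι → Valuation K ℤᵐ⁰}
  (h : IsPlaceSystem F v) {x : K} {D : Derivation F K K}

include h in
theorem exists_not_ordGE_zero (hx : Transcendental F x) : ∃ P, ¬ OrdGE (v P) 0 x := by
  by_contra! hc
  obtain ⟨c, rfl⟩ := h.mem_range_of_regular x hc
  exact hx (isAlgebraic_algebraMap c)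

variable [IsAlgClosed F]

theorem finite_support_derivation_uniformizer (hD : D x = 1) :
    {P | -vOrd (v P) (D (h.exists_uniformizer P).choose) ≠ 0}.Finite := by
  obtain ⟨T, hT⟩ := h.exists_generators
  have hfin : ((⋃ u ∈ T, {P | vOrd (v P) (D u) ≠ 0}) ∪ {P | vOrd (v P) x ≠ 0}).Finite :=
    (T.finite_toSet.biUnion fun u _ => h.finite_support (D u)).union (h.finite_support x)
  refine hfin.subset fun P => ?_
  contrapose!
  intro hP
  obtain ⟨hT0, hx0⟩ : (∀ u ∈ T, vOrd (v P) (D u) = 0) ∧ vOrd (v P) x = 0 := by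
    simpa using not_or.mp hP
  have ht := (h.exists_uniformizer P).choose_spec
  set t := (h.exists_uniformizer P).choose
  have hDt : D t ≠ 0 := h.derivation_uniformizer_ne_zero P (x := x) (by simp [hD]) ht
  have hnonneg := h.ordGE_derivation_of_generators P D (hT P) (m := 0)
    (fun u hu => hT0 u hu ▸ OrdGE.self _) (f := t) (OrdGE.mono (m := 1) ht.le zero_le_one)
  have hnonpos := h.ordGE_derivation P D ht (OrdGE.self (D t)) (f := x) (hx0 ▸ OrdGE.self x)
  rw [hD, ordGE_iff_le_vOrd one_ne_zero, vOrd_one] at hnonpos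
  rw [ordGE_iff_le_vOrd hDt] at hnonneg
  simp only [Set.mem_ofPred_eq, not_not]
  lia

/-- The divisor of the differential `dx`, where `D = d/dx`; its multiplicity at a point with
uniformizer `t` is the order of `dx/dt = (D t)⁻¹`. -/
noncomputable def canonical (hD : D x = 1) : ι →₀ ℤ :=
  Finsupp.ofSupportFinite (fun P => -vOrd (v P) (D (h.exists_uniformizer P).choose))
    (h.finite_support_derivation_uniformizer hD)

theorem canonical_apply (hD : D x = 1) {P : ι} {t : K} (ht : v P t = exp (-1)) :
    h.canonical hD P = -vOrd (v P) (D t) := by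
  have hu := (h.exists_uniformizer P).choose_spec
  have hD0 : D x ≠ 0 := by simp [hD]
  exact congrArg Neg.neg
    (h.vOrd_derivation_eq P hD0 ht (c := 0) (t' := (h.exists_uniformizer P).choose)
      (by simpa using hu))

section Trace

variable (hx : IsSeparatingVariable F x) (hD : D x = 1) {k : ℤ} {z : K}
  (hz : z ∈ h.rrSpace (h.canonical hD + (k + 2) • h.poles x)) {P : ι}

include hx hz

theorem ordGE_trace_of_ordGE_zero (hP : OrdGE (v P) 0 x) :
    OrdGE (v P) 0 (Algebra.trace F⟮x⟯ K z : K) := by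
  obtain ⟨c, hc⟩ := h.exists_residue P x hP
  refine h.ordGE_trace (isSeparatingVariable_sub_algebraMap hx c)
    (adjoin_simple_sub_algebraMap x c) (D := D) (by simp [hD]) (fun Q hQ => ?_) hc
  obtain ⟨t, ht⟩ := h.exists_uniformizer Q
  have hpole : h.poles x Q = 0 := by
    have hreg := (hQ.mono zero_le_one).add (h.ordGE_algebraMap Q c)
    rw [sub_add_cancel, ordGE_iff_le_vOrd (ne_zero_of_transcendental hx.transcendental)] at hreg
    simpa using hreg
  refine ⟨t, ht, ?_⟩
  simpa [-poles_apply, hpole, h.canonical_apply hD ht] using hz Q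

theorem ordGE_trace_of_not_ordGE_zero (hP : ¬ OrdGE (v P) 0 x) :
    OrdGE (v P) (k * vOrd (v P) x) (Algebra.trace F⟮x⟯ K z : K) := by
  have hx0 := ne_zero_of_transcendental hx.transcendental
  have hxk := zpow_ne_zero (-k) hx0
  have hinv : OrdGE (v P) 1 x⁻¹ := by
    rw [ordGE_iff_le_vOrd hx0] at hP
    rw [ordGE_iff_le_vOrd (inv_ne_zero hx0), vOrd_inv]
    lia
  have htrace := h.ordGE_trace (isSeparatingVariable_inv hx) (adjoin_simple_inv x)
    (neg_sq_smul_derivation_inv hx0 hD) (z := x ^ (-k) * z) (fun Q hQ => ?_) hinv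
  · have hlin : (Algebra.trace F⟮x⟯ K (x ^ (-k) * z) : K) =
        x ^ (-k) * (Algebra.trace F⟮x⟯ K z : K) := by
      have hsmul : x ^ (-k) * z = (IntermediateField.AdjoinSimple.gen F x) ^ (-k) • z := by
        rw [Algebra.smul_def]
        simp
      rw [hsmul, map_smul, smul_eq_mul, IntermediateField.coe_mul]
      congr 1
    rw [hlin, OrdGE.mul_iff hxk, vOrd_zpow] at htrace
    exact htrace.mono (by lia)
  · obtain ⟨t, ht⟩ := h.exists_uniformizer Q
    have hDt : D t ≠ 0 := h.derivation_uniformizer_ne_zero Q (x := x) (by simp [hD]) ht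
    have hord : vOrd (v Q) (((-x ^ 2) • D) t) = 2 * vOrd (v Q) x + vOrd (v Q) (D t) := by
      rw [Derivation.smul_apply, smul_eq_mul, vOrd_mul (neg_ne_zero.mpr (pow_ne_zero 2 hx0)) hDt,
        vOrd_neg, vOrd_pow, Nat.cast_ofNat]
    have hpole : h.poles x Q = -vOrd (v Q) x := by
      rw [ordGE_iff_le_vOrd (inv_ne_zero hx0), vOrd_inv] at hQ
      rw [poles_apply]
      lia
    refine ⟨t, ht, ?_⟩
    rw [OrdGE.mul_iff hxk, vOrd_zpow, hord]
    refine (hz Q).mono ?_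
    rw [Finsupp.add_apply, Finsupp.smul_apply, hpole, smul_eq_mul, h.canonical_apply hD ht]
    linarith

theorem trace_mem_rrSpace : (Algebra.trace F⟮x⟯ K z : K) ∈ h.rrSpace (k • h.poles x) := by
  intro P
  have hx0 := ne_zero_of_transcendental hx.transcendental
  rw [Finsupp.smul_apply, poles_apply, smul_eq_mul]
  by_cases hP : OrdGE (v P) 0 x
  · rw [max_eq_right (neg_nonpos.mpr ((ordGE_iff_le_vOrd hx0).mp hP)), mul_zero, neg_zero]
    exact h.ordGE_trace_of_ordGE_zero hx hD hz hP
  · have hlt := lt_of_not_ge (mt (ordGE_iff_le_vOrd hx0).mpr hP)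
    rw [max_eq_left (by lia), mul_neg, neg_neg]
    exact h.ordGE_trace_of_not_ordGE_zero hx hD hz hP

end Trace

theorem rrSpace_eq_bot_of_neg (hx : Transcendental F x) {k : ℤ} (hk : k < 0) :
    h.rrSpace (k • h.poles x) = ⊥ := by
  refine eq_bot_iff.mpr fun f hf => ?_
  have hle (P : ι) : 0 ≤ -(k • h.poles x) P := by
    rw [Finsupp.smul_apply, smul_eq_mul]
    exact neg_nonneg.mpr (mul_nonpos_of_nonpos_of_nonneg hk.le (h.poles_nonneg x P))
  obtain ⟨c, rfl⟩ := h.mem_range_of_regular f fun P => (hf P).mono (hle P)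
  obtain ⟨P, hP⟩ := h.exists_not_ordGE_zero hx
  rw [ordGE_iff_le_vOrd (ne_zero_of_transcendental hx), not_le] at hP
  have hlt : 1 ≤ -(k • h.poles x) P := by
    rw [Finsupp.smul_apply, smul_eq_mul, poles_apply, max_eq_left (by lia)]
    nlinarith
  simp [h.eq_zero_of_ordGE_one P ((hf P).mono hlt)]

/-- Near a pole of `x`, each `r i (x⁻¹)` agrees with its constant term up to a function that
vanishes there. -/
theorem sum_coeff_zero_smul_mem_rrSpace (hx0 : x ≠ 0) {k : ℤ} {κ : Type*} [Fintype κ]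
    {u : κ → K} (hu : ∀ i, u i ∈ h.rrSpace (k • h.poles x)) {r : κ → F[X]}
    (hr : ∑ i, aeval x⁻¹ (r i) * u i = 0) :
    ∑ i, (r i).coeff 0 • u i ∈ h.rrSpace ((k - 1) • h.poles x) := by
  intro P
  by_cases hP : OrdGE (v P) 0 x⁻¹
  · have hsub : ∑ i, (r i).coeff 0 • u i =
        -∑ i, (aeval x⁻¹ (r i) - algebraMap F K ((r i).coeff 0)) * u i := by
      simp only [sub_mul, Finset.sum_sub_distrib, hr, zero_sub, neg_neg, Algebra.smul_def]
    rw [hsub]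
    refine (OrdGE.sum fun i _ =>
      ((h.ordGE_aeval_sub_coeff_zero P hP (OrdGE.self _) (r i)).mul (hu i P)).mono ?_).neg
    rw [ordGE_iff_le_vOrd (inv_ne_zero hx0), vOrd_inv] at hP
    simp only [Finsupp.smul_apply, smul_eq_mul, poles_apply, max_eq_left hP, vOrd_inv]
    linarith
  · refine OrdGE.sum fun i _ => ?_
    rw [Algebra.smul_def]
    refine (h.ordGE_algebraMap P _).mul_left ((hu i P).mono ?_)
    rw [ordGE_iff_le_vOrd (inv_ne_zero hx0), vOrd_inv, not_le] at hP
    simp [max_eq_right hP.le]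

theorem linearIndependent_of_sum_smul_mem_rrSpace (hx : Transcendental F x) {k : ℤ} {κ : Type*}
    [Fintype κ] {u : κ → K} (hu : ∀ i, u i ∈ h.rrSpace (k • h.poles x))
    (hind : ∀ c : κ → F, ∑ i, c i • u i ∈ h.rrSpace ((k - 1) • h.poles x) → c = 0) :
    LinearIndependent F⟮x⟯ u := by
  rw [Fintype.linearIndependent_iff]
  intro g hg
  by_contra! hne
  obtain ⟨j, hj⟩ := hne
  have hmem (i : κ) : (g i : K) ∈ F⟮x⁻¹⟯ := by
    rw [adjoin_simple_inv]
    exact (g i).2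
  obtain ⟨w, r, -, hr, i, hi⟩ := exists_primitive_multiple (transcendental_inv hx)
    (fun i => (⟨g i, hmem i⟩ : F⟮x⁻¹⟯)) fun h0 => hj (Subtype.ext congr(($(congrFun h0 j) : K)))
  refine hi (congrFun (hind (fun i => (r i).coeff 0)
    (h.sum_coeff_zero_smul_mem_rrSpace (ne_zero_of_transcendental hx) hu ?_)) i)
  calc ∑ i, aeval x⁻¹ (r i) * u i = w * ∑ i, g i • u i := by
        simp only [← hr, Algebra.smul_def, Finset.mul_sum, mul_assoc]
        rfl
    _ = 0 := by rw [hg, mul_zero]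

theorem finrank_rrSpace_inf_le (hx : Transcendental F x) (k : ℤ) (U : Submodule F⟮x⟯ K) :
    Module.finrank F (h.rrSpace (k • h.poles x) ⊓ U.restrictScalars F : Submodule F K) ≤
      Module.finrank F (h.rrSpace ((k - 1) • h.poles x) ⊓ U.restrictScalars F : Submodule F K) +
        Module.finrank F⟮x⟯ U := by
  have := h.finiteDimensional x hx
  set B : Submodule F K := h.rrSpace (k • h.poles x) ⊓ U.restrictScalars F
  set A : Submodule F K := h.rrSpace ((k - 1) • h.poles x) ⊓ U.restrictScalars F
  have : Module.Finite F B := Submodule.finiteDimensional_of_le inf_le_left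
  have hAB : A ≤ B := inf_le_inf_right _ (h.rrSpace_mono
    (smul_le_smul_of_nonneg_right (by lia) (h.poles_nonneg x)))
  rw [← Submodule.finrank_quotient_add_finrank (A.submoduleOf B), add_comm,
    (Submodule.submoduleOfEquivOfLe hAB).finrank_eq]
  gcongr
  let b := Module.finBasis F (B ⧸ A.submoduleOf B)
  choose u hu using fun i => (A.submoduleOf B).mkQ_surjective (b i)
  have hind (c : Fin _ → F) (hc : ∑ i, c i • (u i : K) ∈ h.rrSpace ((k - 1) • h.poles x)) :
      c = 0 := by
    have hcA : ((∑ i, c i • u i : B) : K) ∈ A := by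
      simp only [Submodule.coe_sum, Submodule.coe_smul]
      exact ⟨hc, sum_mem fun i _ => Submodule.smul_mem _ _ (u i).2.2⟩
    have hrel : ∑ i, c i • b i = 0 := by
      simp only [← hu, ← map_smul, ← map_sum]
      exact (Submodule.Quotient.mk_eq_zero _).mpr hcA
    exact funext (Fintype.linearIndependent_iff.mp b.linearIndependent c hrel)
  have hli : LinearIndependent F⟮x⟯ fun i => (⟨(u i : K), (u i).2.2⟩ : U) :=
    .of_comp U.subtype (h.linearIndependent_of_sum_smul_mem_rrSpace hx (fun i => (u i).2.1) hind)
  simpa using hli.fintype_card_le_finrank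

theorem finrank_rrSpace_inf_span_one_le (hx : Transcendental F x) (k : ℕ) :
    Module.finrank F (h.rrSpace (((k : ℤ) - 1) • h.poles x) ⊓
      (Submodule.span F⟮x⟯ {(1 : K)}).restrictScalars F : Submodule F K) ≤ k := by
  induction k with
  | zero => rw [h.rrSpace_eq_bot_of_neg hx (by norm_num), bot_inf_eq, finrank_bot]
  | succ k ih =>
    have hspan : Module.finrank F⟮x⟯ (Submodule.span F⟮x⟯ {(1 : K)}) ≤ 1 := by
      simpa using finrank_span_le_card (R := F⟮x⟯) ({1} : Set K)
    rw [Nat.cast_succ, add_sub_cancel_right]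
    exact (h.finrank_rrSpace_inf_le hx k _).trans (add_le_add ih hspan)

/-- The basis `b` of `K` over `F(x)` is reduced, with pole orders `δ`, if every function whose
poles are bounded by `m` times those of `x` only involves the `b i` with the same property. -/
structure IsReducedBasis {κ : Type*} (b : Module.Basis κ F⟮x⟯ K) (δ : κ → ℕ) : Prop where
  mem_rrSpace : ∀ i, b i ∈ h.rrSpace (δ i • h.poles x)
  rrSpace_le_span : ∀ m : ℕ, h.rrSpace (m • h.poles x) ≤
    (Submodule.span F⟮x⟯ (b '' {i | δ i ≤ m})).restrictScalars F

/-- A basis for which the sum of the pole orders is minimal is reduced. -/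
theorem exists_isReducedBasis (hx : Transcendental F x) :
    ∃ (b : Module.Basis (Fin (Module.finrank F⟮x⟯ K)) F⟮x⟯ K)
      (δ : Fin (Module.finrank F⟮x⟯ K) → ℕ), h.IsReducedBasis b δ := by
  classical
  have := h.finiteDimensional x hx
  set n := Module.finrank F⟮x⟯ K with hn
  have : Nonempty (Fin n) := ⟨⟨0, Module.finrank_pos⟩⟩
  have hex : ∃ N, ∃ (b : Fin n → K) (δ : Fin n → ℕ), LinearIndependent F⟮x⟯ b ∧
      (∀ i, b i ∈ h.rrSpace (δ i • h.poles x)) ∧ ∑ i, δ i = N := by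
    obtain ⟨b, m, hb⟩ := h.exists_basis_mem_rrSpace hx
    exact ⟨_, b, fun _ => m, b.linearIndependent, hb, rfl⟩
  obtain ⟨b, δ, hli, hmem, hsum⟩ := Nat.find_spec hex
  let B := basisOfLinearIndependentOfCardEqFinrank hli (by simp [hn])
  have hB : ⇑B = b := by simp [B]
  refine ⟨B, δ, by rwa [hB], fun m u hu => ?_⟩
  rw [Submodule.restrictScalars_mem, Module.Basis.mem_span_image]
  intro i hi
  by_contra hlt
  rw [Set.mem_ofPred_eq, not_le] at hlt
  have hli' : LinearIndependent F⟮x⟯ (Function.update b i u) :=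
    hli.update i u ⟨1, one_mem _, B.repr u,
      mem_nonZeroDivisors_of_ne_zero (Finsupp.mem_support_iff.mp hi),
      by rw [one_smul, ← hB, B.linearCombination_repr]⟩
  have hmem' (j : Fin n) :
      Function.update b i u j ∈ h.rrSpace (Function.update δ i m j • h.poles x) := by
    rcases eq_or_ne j i with rfl | hj
    · simpa using hu
    · simpa [hj] using hmem j
  have hlt' : ∑ j, Function.update δ i m j < ∑ j, δ j :=
    Fintype.sum_strictMono (update_lt_self_iff.mpr hlt)
  exact Nat.find_min hex (hsum ▸ hlt') ⟨_, _, hli', hmem', rfl⟩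

section Reduced

variable {h} {κ : Type*} [Fintype κ] {b : Module.Basis κ F⟮x⟯ K} {δ : κ → ℕ}

theorem finrank_rrSpace_nsmul_poles_le (hb : h.IsReducedBasis b δ) (hx : Transcendental F x)
    (m : ℕ) : Module.finrank F (h.rrSpace (m • h.poles x)) ≤ ∑ i, (m + 1 - δ i) := by
  classical
  have hstep (m : ℕ) : Module.finrank F (h.rrSpace (m • h.poles x)) ≤
      Module.finrank F (h.rrSpace (((m : ℤ) - 1) • h.poles x)) +
        (Finset.univ.filter fun i => δ i ≤ m).card := by
    have hle := h.finrank_rrSpace_inf_le hx m (Submodule.span F⟮x⟯ (b '' {i | δ i ≤ m}))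
    rw [natCast_zsmul, inf_eq_left.mpr (hb.rrSpace_le_span m)] at hle
    refine hle.trans (add_le_add (Submodule.finrank_mono inf_le_left) ?_)
    have hspan := (finrank_span_finset_le_card (R := F⟮x⟯)
      ((Finset.univ.filter fun i => δ i ≤ m).image b)).trans Finset.card_image_le
    rwa [Set.finrank, Finset.coe_image, Finset.coe_filter_univ] at hspan
  have hsum (m : ℕ) : ∑ i, (m + 1 - δ i) =
      ∑ i, (m - δ i) + (Finset.univ.filter fun i => δ i ≤ m).card := by
    rw [Finset.card_filter, ← Finset.sum_add_distrib]
    refine Finset.sum_congr rfl fun i _ => ?_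
    split_ifs <;> lia
  induction m with
  | zero =>
    refine (hstep 0).trans ?_
    rw [h.rrSpace_eq_bot_of_neg hx (by norm_num), finrank_bot, hsum]
    gcongr
    exact Nat.zero_le _
  | succ m ih =>
    refine (hstep (m + 1)).trans ?_
    rw [hsum, Nat.cast_succ, add_sub_cancel_right, natCast_zsmul]
    gcongr

theorem sum_le_of_isReducedBasis (hb : h.IsReducedBasis b δ) (hx : Transcendental F x) {g : ℤ}
    (hg : ∀ A : ι →₀ ℤ, A.degree + 1 - Module.finrank F (h.rrSpace A) ≤ g) :
    ((∑ i, δ i : ℕ) : ℤ) ≤ Module.finrank F⟮x⟯ K - 1 + g := by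
  set m := ∑ i, δ i with hm
  have hsum : ((∑ i, (m + 1 - δ i) : ℕ) : ℤ) = Module.finrank F⟮x⟯ K * (m + 1) - m := by
    have hsub (i : κ) : ((m + 1 - δ i : ℕ) : ℤ) = (m + 1) - δ i := by
      have hle : δ i ≤ m := Finset.single_le_sum (f := δ) (by simp) (Finset.mem_univ i)
      lia
    rw [Nat.cast_sum, Finset.sum_congr rfl fun i _ => hsub i, Finset.sum_sub_distrib, hm,
      Module.finrank_eq_card_basis b]
    simp
  have hgm := hg (m • h.poles x)
  rw [map_nsmul, h.degree_poles hx, nsmul_eq_mul] at hgm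
  have hle := Nat.cast_le (α := ℤ).mpr (finrank_rrSpace_nsmul_poles_le hb hx m)
  rw [hsum] at hle
  linarith

/-- The traces of the products with the `b i` embed the space into a product of spaces of
functions in `F(x)` with bounded poles. -/
theorem finrank_rrSpace_canonical_add_poles_le (hb : h.IsReducedBasis b δ)
    (hx : IsSeparatingVariable F x) (hD : D x = 1) :
    Module.finrank F (h.rrSpace (h.canonical hD + h.poles x)) ≤ ∑ i, δ i := by
  have := h.finiteDimensional x hx.transcendental
  have := hx.separable
  let V (i : κ) : Submodule F K := h.rrSpace (((δ i : ℤ) - 1) • h.poles x) ⊓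
    (Submodule.span F⟮x⟯ {(1 : K)}).restrictScalars F
  set R := h.rrSpace (h.canonical hD + h.poles x)
  have hV (f : R) (i : κ) : (Algebra.trace F⟮x⟯ K ((f : K) * b i) : K) ∈ V i := by
    refine ⟨h.trace_mem_rrSpace hx hD ?_,
      Submodule.mem_span_singleton.mpr ⟨_, by rw [Algebra.smul_def, mul_one]; rfl⟩⟩
    convert h.mul_mem_rrSpace f.2 (hb.mem_rrSpace i) using 2
    rw [add_assoc, ← natCast_zsmul]
    module
  let T : K →ₗ[F] F⟮x⟯ := (Algebra.trace F⟮x⟯ K).restrictScalars F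
  let Φ : R →ₗ[F] (∀ i, V i) := LinearMap.pi fun i => LinearMap.codRestrict (V i)
    (F⟮x⟯.val.toLinearMap ∘ₗ T ∘ₗ (LinearMap.mulRight F (b i)) ∘ₗ R.subtype) (hV · i)
  have hΦ : Function.Injective Φ := by
    rw [← LinearMap.ker_eq_bot, LinearMap.ker_eq_bot']
    intro f hf
    have hform : Algebra.traceForm F⟮x⟯ K (f : K) = 0 := b.ext fun i =>
      Subtype.ext congr(($(congrFun hf i) : K))
    exact Subtype.ext ((LinearMap.separatingLeft_iff_ker_eq_bot.mp
      (traceForm_nondegenerate F⟮x⟯ K).1).le hform)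
  have (i : κ) : Module.Finite F (V i) := Submodule.finiteDimensional_of_le inf_le_left
  calc Module.finrank F R ≤ ∑ i, Module.finrank F (V i) := by
        rw [← Module.finrank_pi_fintype]
        exact LinearMap.finrank_le_finrank_of_injective hΦ
    _ ≤ ∑ i, δ i := Finset.sum_le_sum fun i _ =>
        h.finrank_rrSpace_inf_span_one_le hx.transcendental (δ i)

end Reduced

theorem degree_canonical_le (hx : IsSeparatingVariable F x) (hD : D x = 1) {g : ℤ}
    (hg : ∀ A : ι →₀ ℤ, A.degree + 1 - Module.finrank F (h.rrSpace A) ≤ g) :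
    (h.canonical hD).degree ≤ 2 * g - 2 := by
  obtain ⟨b, δ, hb⟩ := h.exists_isReducedBasis hx.transcendental
  have hsum := sum_le_of_isReducedBasis hb hx.transcendental hg
  have hrank := Nat.cast_le (α := ℤ).mpr (finrank_rrSpace_canonical_add_poles_le hb hx hD)
  have hgc := hg (h.canonical hD + h.poles x)
  rw [map_add, h.degree_poles hx.transcendental] at hgc
  linarith

end IsPlaceSystem

/-! ### Lexicographically minimal nonvanishing minors -/

section Minors

theorem toLex_comp_sort_le {r : ℕ} {f : Fin r → ℕ} (hf : Function.Injective f) :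
    toLex (f ∘ Tuple.sort f) ≤ toLex f := by
  by_contra hlt
  obtain ⟨s, hfix, hs⟩ := not_le.mp hlt
  obtain ⟨u, hu⟩ := (Tuple.sort f).surjective s
  have hsu : s ≤ u := by
    by_contra! hus
    exact hus.ne ((hf (hfix u hus)).trans hu)
  have hle := Tuple.monotone_sort f hsu
  rw [Function.comp_apply, Function.comp_apply, hu] at hle
  exact hle.not_gt hs

/-- The rows `R, d (m 0), …, d (m (r - 1))` of the matrices defining Frobenius orders. -/
def minorRows {K : Type*} {r : ℕ} (R : Fin (r + 1) → K) (d : ℕ → Fin (r + 1) → K)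
    (m : Fin r → ℕ) : Fin (r + 1) → Fin (r + 1) → K :=
  Fin.cons R (d ∘ m)

theorem minorRows_update {K : Type*} {r : ℕ} (R : Fin (r + 1) → K)
    (d : ℕ → Fin (r + 1) → K) (m : Fin r → ℕ) (i : Fin r) (k : ℕ) :
    minorRows R d (Function.update m i k) = Function.update (minorRows R d m) i.succ (d k) := by
  rw [minorRows, minorRows, ← Fin.cons_update, Function.comp_update]

variable {K : Type*} [Field K] {r : ℕ}

theorem det_eq_prod_mul_det {N : ℕ} (M M' : Fin N → Fin N → K) (g : Fin N → K)
    (h : ∀ a, M' a - g a • M a ∈ Submodule.span K (M '' {b | b < a})) :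
    (Matrix.of M').det = (∏ a, g a) * (Matrix.of M).det := by
  have hcoeff (a : Fin N) : ∃ c : Fin N → K, (∀ b, a ≤ b → c b = 0) ∧
      M' a = g a • M a + ∑ b, c b • M b := by
    obtain ⟨l, hl, hsum⟩ := (Finsupp.mem_span_image_iff_linearCombination K).mp (h a)
    refine ⟨l, fun b hab => Finsupp.notMem_support_iff.mp fun hb => hab.not_gt (hl hb), ?_⟩
    rw [← sub_eq_iff_eq_add', ← hsum, Finsupp.linearCombination_apply, Finsupp.sum_fintype]
    simp
  choose c hc hM using hcoeff
  let L : Matrix (Fin N) (Fin N) K := Matrix.of fun a b => (if a = b then g a else 0) + c a b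
  have hL : Matrix.of M' = L * Matrix.of M := by
    ext a j
    rw [Matrix.of_apply, hM a, Matrix.mul_apply]
    simp [L, add_mul, Finset.sum_add_distrib]
  have hLtri : L.IsLowerTriangular := fun a b (hab : a < b) => by simp [L, hab.ne, hc a b hab.le]
  rw [hL, Matrix.det_mul, Matrix.det_of_isLowerTriangular L hLtri]
  simp [L, hc _ _ le_rfl]

/-- The set of increasing tuples for which the minor does not vanish. -/
def minorSet (R : Fin (r + 1) → K) (d : ℕ → Fin (r + 1) → K) : Set (Lex (Fin r → ℕ)) :=
  {m | StrictMono (ofLex m) ∧ (Matrix.of (minorRows R d (ofLex m))).det ≠ 0}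

variable {R : Fin (r + 1) → K} {d d' d'' : ℕ → Fin (r + 1) → K} {γ γ' : ℕ → K}

theorem det_minorRows_ne_zero_iff {m : Fin r → ℕ} :
    (Matrix.of (minorRows R d m)).det ≠ 0 ↔ LinearIndependent K (minorRows R d m) := by
  rw [← isUnit_iff_ne_zero, ← Matrix.isUnit_iff_isUnit_det,
    ← Matrix.linearIndependent_rows_iff_isUnit]
  rfl

theorem injective_of_linearIndependent_minorRows {m : Fin r → ℕ}
    (hm : LinearIndependent K (minorRows R d m)) : Function.Injective m :=
  .of_comp (f := d) (Fin.cons_injective_iff.mp hm.injective).2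

theorem linearIndependent_minorRows_comp {m : Fin r → ℕ}
    (hm : LinearIndependent K (minorRows R d m)) (σ : Equiv.Perm (Fin r)) :
    LinearIndependent K (minorRows R d (m ∘ σ)) := by
  rw [minorRows, linearIndependent_finCons] at hm ⊢
  refine ⟨hm.1.comp σ σ.injective, ?_⟩
  rw [← Function.comp_assoc, σ.surjective.range_comp]
  exact hm.2

/-- Replacing an entry of the minimal tuple by a smaller one and sorting the result gives a
lexicographically smaller tuple, so the corresponding minor vanishes. -/
theorem not_linearIndependent_minorRows_update {ν : Fin r → ℕ}
    (hν : IsLeast (minorSet R d) (toLex ν)) {i : Fin r} {m : ℕ} (hm : m < ν i) :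
    ¬ LinearIndependent K (minorRows R d (Function.update ν i m)) := by
  intro hli
  set f := Function.update ν i m
  have hf := injective_of_linearIndependent_minorRows hli
  have hmem : toLex (f ∘ Tuple.sort f) ∈ minorSet R d :=
    ⟨(Tuple.monotone_sort f).strictMono_of_injective (hf.comp (Tuple.sort f).injective),
      det_minorRows_ne_zero_iff.mpr (linearIndependent_minorRows_comp hli _)⟩
  exact ((hν.2 hmem).trans (toLex_comp_sort_le hf)).not_gt (Pi.toLex_update_lt_self_iff.mpr hm)

theorem mem_span_of_isLeast {ν : Fin r → ℕ} (hν : IsLeast (minorSet R d) (toLex ν)) (j : Fin r)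
    {m : ℕ} (hm : m < ν j) :
    d m ∈ Submodule.span K (minorRows R d ν '' {b | b < j.succ}) := by
  have hli : LinearIndependent K (minorRows R d ν) := det_minorRows_ne_zero_iff.mp hν.1.2
  let B := basisOfLinearIndependentOfCardEqFinrank hli (by simp)
  have hB : ⇑B = minorRows R d ν := by simp [B]
  rw [← hB, Module.Basis.mem_span_image]
  intro a ha
  by_contra hja
  obtain ⟨i, rfl⟩ := Fin.exists_succ_eq.mpr ((Fin.succ_pos j).trans_le (not_lt.mp hja)).ne'
  refine not_linearIndependent_minorRows_update hν (i := i) (hm.trans_le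
    (hν.1.1.monotone (Fin.succ_le_succ_iff.mp (not_lt.mp hja)))) ?_
  rw [minorRows_update]
  exact hli.update i.succ (d m) ⟨1, one_mem _, B.repr (d m),
    mem_nonZeroDivisors_of_ne_zero (Finsupp.mem_support_iff.mp ha),
    by rw [one_smul, ← hB, B.linearCombination_repr]⟩

/-- `d'` arises from `d` by a triangular substitution modulo `R`, with diagonal entries `γ`. -/
def IsTriangular (R : Fin (r + 1) → K) (d d' : ℕ → Fin (r + 1) → K) (γ : ℕ → K) : Prop :=
  ∀ m, d' m - γ m • d m ∈ Submodule.span K (insert R (d '' Set.Iio m))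

theorem IsTriangular.of_sum (c : ℕ → ℕ → K) (e : ℕ → K)
    (h : ∀ m, d' m = ∑ i ∈ Finset.range (m + 1), c m i • d i + e m • R) :
    IsTriangular R d d' fun m => c m m := by
  intro m
  have hsub : d' m - c m m • d m = ∑ i ∈ Finset.range m, c m i • d i + e m • R := by
    rw [h m, Finset.sum_range_succ]
    abel
  rw [hsub]
  exact add_mem (sum_mem fun i hi => Submodule.smul_mem _ _
      (Submodule.subset_span (Or.inr ⟨i, Finset.mem_range.mp hi, rfl⟩)))
    (Submodule.smul_mem _ _ (Submodule.subset_span (Or.inl rfl)))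

theorem IsTriangular.trans (h : IsTriangular R d d' γ) (h' : IsTriangular R d' d'' γ') :
    IsTriangular R d d'' fun m => γ' m * γ m := by
  intro m
  have hle : Submodule.span K (insert R (d' '' Set.Iio m)) ≤
      Submodule.span K (insert R (d '' Set.Iio m)) := by
    rw [Submodule.span_le]
    rintro _ (rfl | ⟨i, hi, rfl⟩)
    · exact Submodule.subset_span (Or.inl rfl)
    · have hmono := Submodule.span_mono (R := K) (Set.insert_subset_insert (a := R)
        (Set.image_mono (f := d) (Set.Iio_subset_Iio (le_of_lt hi))))
      simpa using add_mem (hmono (h i)) (Submodule.smul_mem _ (γ i)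
        (Submodule.subset_span (Or.inr ⟨i, hi, rfl⟩)))
  convert add_mem (hle (h' m)) (Submodule.smul_mem _ (γ' m) (h m)) using 1
  module

theorem IsTriangular.det_eq (h : IsTriangular R d d' γ) {ν : Fin r → ℕ}
    (hν : IsLeast (minorSet R d) (toLex ν)) (ρ : K) :
    (Matrix.of (minorRows (ρ • R) d' ν)).det =
      ρ * (∏ i, γ (ν i)) * (Matrix.of (minorRows R d ν)).det := by
  rw [det_eq_prod_mul_det (minorRows R d ν) (minorRows (ρ • R) d' ν)
    (Fin.cons ρ fun i => γ (ν i)), Fin.prod_univ_succ]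
  · simp
  · refine Fin.cases ?_ fun j => ?_
    · simp [minorRows]
    · refine Submodule.span_le.mpr ?_ (h (ν j))
      rintro _ (rfl | ⟨m, hm, rfl⟩)
      · exact Submodule.subset_span ⟨0, Fin.succ_pos j, rfl⟩
      · exact mem_span_of_isLeast hν j hm

end Minors

/-! ### Local integrality of Hasse derivatives -/

section PowerSeries

variable {K : Type*} [Field K] {v : Valuation K ℤᵐ⁰} {n C : ℕ} {A A' : ℤ} {α β : PowerSeries K}

/-- The coefficients of index `l ≤ n` of a power series have order at least `A - C l`, a bound that
is compatible with products. -/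
def TaylorGE (v : Valuation K ℤᵐ⁰) (n C : ℕ) (A : ℤ) (α : PowerSeries K) : Prop :=
  ∀ l ≤ n, OrdGE v (A - C * l) (PowerSeries.coeff l α)

theorem TaylorGE.add (hα : TaylorGE v n C A α) (hβ : TaylorGE v n C A β) :
    TaylorGE v n C A (α + β) := fun l hl => by
  rw [map_add]
  exact (hα l hl).add (hβ l hl)

theorem TaylorGE.mul (hα : TaylorGE v n C A α) (hβ : TaylorGE v n C A' β) :
    TaylorGE v n C (A + A') (α * β) := fun l hl => by
  rw [PowerSeries.coeff_mul]
  refine OrdGE.sum fun p hp => ?_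
  obtain rfl := Finset.HasAntidiagonal.mem_antidiagonal.mp hp
  refine ((hα p.1 (by lia)).mul (hβ p.2 (by lia))).mono ?_
  push_cast
  linarith

theorem TaylorGE.C_of_ordGE {a : K} (ha : OrdGE v A a) : TaylorGE v n C A (PowerSeries.C a) :=
    fun l _ => by
  rw [PowerSeries.coeff_C]
  split_ifs with hl
  · simpa [hl] using ha
  · exact OrdGE.zero _

theorem TaylorGE.X (hAC : A ≤ C) : TaylorGE v n C A PowerSeries.X := fun l _ => by
  rw [PowerSeries.coeff_X]
  split_ifs with hl
  · exact OrdGE.one.mono (by simpa [hl] using hAC)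
  · exact OrdGE.zero _

theorem TaylorGE.pow (hα : TaylorGE v n C A α) (N : ℕ) : TaylorGE v n C (N * A) (α ^ N) := by
  induction N with
  | zero => simpa using TaylorGE.C_of_ordGE (n := n) (C := C) (OrdGE.one (v := v))
  | succ N ih =>
    rw [pow_succ, Nat.cast_succ, add_one_mul]
    exact ih.mul hα

theorem TaylorGE.mono {C' : ℕ} (hα : TaylorGE v n C A α) (hC : C ≤ C') : TaylorGE v n C' A α :=
  fun l hl => (hα l hl).mono (by gcongr)

theorem TaylorGE.of_mul (hα : TaylorGE v n C 0 α) (hαβ : TaylorGE v n C A (α * β))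
    (hunit : v (PowerSeries.constantCoeff α) = 1) : TaylorGE v n C A β := by
  have hne : PowerSeries.constantCoeff α ≠ 0 := (Valuation.ne_zero_iff v).mp (by simp [hunit])
  have hord : vOrd v (PowerSeries.constantCoeff α) = 0 :=
    vOrd_eq_of_eq_exp_neg (by simpa using hunit)
  intro l
  induction l using Nat.strong_induction_on with
  | _ l ih =>
    intro hl
    have hcoeff := PowerSeries.coeff_mul l α β
    rw [← Finset.add_sum_erase _ _
      (Finset.HasAntidiagonal.mem_antidiagonal.mpr (zero_add l) : ((0, l) : ℕ × ℕ) ∈ _)] at hcoeff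
    have hmul : OrdGE v (A - C * l) (PowerSeries.constantCoeff α * PowerSeries.coeff l β) := by
      rw [← PowerSeries.coeff_zero_eq_constantCoeff_apply, ← sub_eq_of_eq_add hcoeff]
      refine (hαβ l hl).sub (OrdGE.sum fun p hp => ?_)
      obtain ⟨hp0, hp⟩ := Finset.mem_erase.mp hp
      obtain rfl := Finset.HasAntidiagonal.mem_antidiagonal.mp hp
      have hpos : p.1 ≠ 0 := fun h0 => hp0 (Prod.ext h0 (by simp [h0]))
      refine ((hα p.1 (by lia)).mul (ih p.2 (by lia) (by lia))).mono ?_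
      push_cast
      linarith
    rwa [OrdGE.mul_iff hne, hord, sub_zero] at hmul

/-- The Taylor polynomial of order `m`, evaluated at `a`. -/
noncomputable def taylorEval (m : ℕ) (a : K) : PowerSeries K →ₗ[K] K :=
  ∑ i ∈ Finset.range (m + 1), a ^ i • PowerSeries.coeff i

theorem taylorEval_apply (m : ℕ) (a : K) (α : PowerSeries K) :
    taylorEval m a α = ∑ i ∈ Finset.range (m + 1), a ^ i * PowerSeries.coeff i α := by
  simp [taylorEval]

theorem taylorEval_C (m : ℕ) (a c : K) : taylorEval m a (PowerSeries.C c) = c := by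
  simp [taylorEval_apply, PowerSeries.coeff_C]

theorem taylorEval_X {m : ℕ} (hm : m ≠ 0) (a : K) : taylorEval m a PowerSeries.X = a := by
  simp [taylorEval_apply, PowerSeries.coeff_X, Nat.pos_of_ne_zero hm]

variable {m : ℕ} {a : K}

theorem ordGE_pow_mul_coeff (ha : OrdGE v 1 a) (hα : ∀ i, OrdGE v 0 (PowerSeries.coeff i α))
    (i : ℕ) : OrdGE v i (a ^ i * PowerSeries.coeff i α) := by
  simpa using (ha.pow i).mul (hα i)

theorem ordGE_taylorEval (ha : OrdGE v 1 a) (hα : ∀ i, OrdGE v 0 (PowerSeries.coeff i α)) :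
    OrdGE v 0 (taylorEval m a α) := by
  rw [taylorEval_apply]
  exact OrdGE.sum fun i _ => (ordGE_pow_mul_coeff ha hα i).mono (by positivity)

theorem ordGE_taylorEval_mul_sub (ha : OrdGE v 1 a) (hα : ∀ i, OrdGE v 0 (PowerSeries.coeff i α))
    (hβ : ∀ i, OrdGE v 0 (PowerSeries.coeff i β)) :
    OrdGE v (m + 1) (taylorEval m a (α * β) - taylorEval m a α * taylorEval m a β) := by
  let G (p : ℕ × ℕ) : K :=
    a ^ p.1 * PowerSeries.coeff p.1 α * (a ^ p.2 * PowerSeries.coeff p.2 β)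
  let S := Finset.range (m + 1) ×ˢ Finset.range (m + 1)
  have hprod : taylorEval m a α * taylorEval m a β = ∑ p ∈ S, G p := by
    rw [taylorEval_apply, taylorEval_apply, Finset.sum_mul_sum, ← Finset.sum_product']
  have hlow : taylorEval m a (α * β) = ∑ p ∈ S with p.1 + p.2 < m + 1, G p := by
    rw [taylorEval_apply, ← Finset.sum_fiberwise_of_maps_to (t := Finset.range (m + 1))
      (g := fun p : ℕ × ℕ => p.1 + p.2)
      fun p hp => Finset.mem_range.mpr (Finset.mem_filter.mp hp).2]
    refine Finset.sum_congr rfl fun l hl => ?_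
    have hfiber : {p ∈ {p ∈ S | p.1 + p.2 < m + 1} | p.1 + p.2 = l} =
        Finset.HasAntidiagonal.antidiagonal l := by
      ext p
      have hlm := Finset.mem_range.mp hl
      simp only [S, Finset.mem_filter, Finset.mem_product, Finset.mem_range,
        Finset.HasAntidiagonal.mem_antidiagonal]
      lia
    rw [PowerSeries.coeff_mul, Finset.mul_sum, hfiber]
    refine Finset.sum_congr rfl fun p hp => ?_
    rw [← Finset.HasAntidiagonal.mem_antidiagonal.mp hp, pow_add]
    ring
  rw [hprod, hlow, ← Finset.sum_filter_add_sum_filter_not S (fun p => p.1 + p.2 < m + 1),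
    sub_add_cancel_left]
  refine (OrdGE.sum fun p hp => ?_).neg
  have hle := not_lt.mp (Finset.mem_filter.mp hp).2
  exact ((ordGE_pow_mul_coeff ha hα p.1).mul (ordGE_pow_mul_coeff ha hβ p.2)).mono
    (by exact_mod_cast hle)

end PowerSeries

namespace IsPlaceSystem

variable {F K ι : Type*} [Field F] [Field K] [Algebra F K] {v : ι → Valuation K ℤᵐ⁰}
  (h : IsPlaceSystem F v)

include h

theorem taylorGE_algebraMap (P : ι) (n C : ℕ) (c : F) :
    TaylorGE (v P) n C 0 (algebraMap F (PowerSeries K) c) := by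
  rw [IsScalarTower.algebraMap_apply F K (PowerSeries K)]
  exact TaylorGE.C_of_ordGE (h.ordGE_algebraMap P c)

/-- By the product rule it suffices to bound the Hasse derivatives of finitely many generators. -/
theorem exists_taylorGE (P : ι) {η : K →ₐ[F] PowerSeries K}
    (hη : ∀ f, PowerSeries.constantCoeff (η f) = f) (n : ℕ) :
    ∃ C : ℕ, ∀ f, OrdGE (v P) 0 f → TaylorGE (v P) n C 0 (η f) := by
  obtain ⟨T, hT⟩ := h.exists_generators
  let bound (q : K × ℕ) : ℕ := (-vOrd (v P) (PowerSeries.coeff q.2 (η q.1))).toNat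
  let C := (T ×ˢ Finset.range (n + 1)).sup bound
  have hC : ∀ u ∈ T, ∀ l ≤ n, -vOrd (v P) (PowerSeries.coeff l (η u)) ≤ C := fun u hu l hl =>
    Int.toNat_le.mp (Finset.le_sup (f := bound) (b := (u, l))
      (Finset.mem_product.mpr ⟨hu, Finset.mem_range.mpr (Nat.lt_succ_of_le hl)⟩))
  have hadjoin (a : K) (ha : a ∈ Algebra.adjoin F {u | u ∈ T ∧ OrdGE (v P) 0 u}) :
      TaylorGE (v P) n C 0 (η a) := by
    induction ha using Algebra.adjoin_induction with
    | mem u hu =>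
      intro l hl
      rcases Nat.eq_zero_or_pos l with rfl | hl0
      · simpa [hη] using hu.2
      · refine (OrdGE.self _).mono ?_
        have hCl := hC u hu.1 l hl
        have hl1 : (1 : ℤ) ≤ l := by exact_mod_cast hl0
        nlinarith [hl1]
    | algebraMap c =>
      rw [AlgHom.commutes]
      exact h.taylorGE_algebraMap P n C c
    | add a b _ _ ha hb =>
      rw [map_add]
      exact ha.add hb
    | mul a b _ _ ha hb =>
      rw [map_mul]
      simpa using ha.mul hb
  refine ⟨C, fun f hf => ?_⟩
  obtain ⟨a, ha, b, hb, hb1, rfl⟩ := hT P f hf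
  have hb0 : b ≠ 0 := (Valuation.ne_zero_iff (v P)).mp (by simp [hb1])
  refine (hadjoin b hb).of_mul ?_ (by rwa [hη])
  rw [← map_mul, mul_div_cancel₀ _ hb0]
  exact hadjoin a ha

section Uniformizer

variable {P : ι} {t : K} (ht : v P t = exp (-1)) {η : K →ₐ[F] PowerSeries K}
  (hη : IsTaylorHom F t η)

include ht hη

/-- Up to a high power of `t`, which absorbs the poles of the derivatives of the remainder, `f` is
a polynomial in `t`. -/
theorem ordGE_coeff {f : K} (hf : OrdGE (v P) 0 f) (l : ℕ) :
    OrdGE (v P) 0 (PowerSeries.coeff l (η f)) := by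
  have ht1 : OrdGE (v P) 1 t := ht.le
  obtain ⟨C, hC⟩ := h.exists_taylorGE P hη.constantCoeff l
  obtain ⟨p, g, hg, rfl⟩ := h.exists_expansion P ht hf (C * l + l)
  rw [map_add, map_add]
  refine OrdGE.add ?_ ?_
  · have hη0 : TaylorGE (v P) l 0 0 (η t) := by
      rw [hη.apply_self]
      exact (TaylorGE.C_of_ordGE (ht1.mono zero_le_one)).add (TaylorGE.X le_rfl)
    have hpoly (p : F[X]) : TaylorGE (v P) l 0 0 (η (aeval t p)) := by
      induction p using Polynomial.induction_on' with
      | add p q hp hq =>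
        rw [map_add, map_add]
        exact hp.add hq
      | monomial n a =>
        rw [aeval_monomial, map_mul, AlgHom.commutes, map_pow]
        simpa using (h.taylorGE_algebraMap P l 0 a).mul (hη0.pow n)
    simpa using hpoly p l le_rfl
  · have hη1 : TaylorGE (v P) l (C + 1) 1 (η t) := by
      rw [hη.apply_self]
      exact (TaylorGE.C_of_ordGE ht1).add (TaylorGE.X (by simp))
    rw [map_mul, map_pow]
    refine ((hη1.pow (C * l + l)).mul ((hC g hg).mono (Nat.le_succ C)) l le_rfl).mono ?_
    push_cast
    linarith

section Specialization

variable {φ : K →ₐ[F] K} (hφ : ∀ f, OrdGE (v P) 0 f → OrdGE (v P) 0 (φ f))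
  (hφt : OrdGE (v P) 1 (φ t)) (m : ℕ)

include hφ hφt

theorem ordGE_taylorEval_sub_mul {f g : K} (hf : OrdGE (v P) 0 f) (hg : OrdGE (v P) 0 g)
    (hfφ : OrdGE (v P) (m + 1) (taylorEval m (φ t - t) (η f) - φ f))
    (hgφ : OrdGE (v P) (m + 1) (taylorEval m (φ t - t) (η g) - φ g)) :
    OrdGE (v P) (m + 1) (taylorEval m (φ t - t) (η (f * g)) - φ (f * g)) := by
  have ha : OrdGE (v P) 1 (φ t - t) := hφt.sub ht.le
  have hsplit : taylorEval m (φ t - t) (η (f * g)) - φ (f * g) =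
      (taylorEval m (φ t - t) (η f * η g) -
        taylorEval m (φ t - t) (η f) * taylorEval m (φ t - t) (η g)) +
      ((taylorEval m (φ t - t) (η f) - φ f) * taylorEval m (φ t - t) (η g) +
        φ f * (taylorEval m (φ t - t) (η g) - φ g)) := by
    rw [map_mul η, map_mul φ]
    ring
  rw [hsplit]
  exact (ordGE_taylorEval_mul_sub ha (h.ordGE_coeff ht hη hf) (h.ordGE_coeff ht hη hg)).add
    ((hfφ.mul_right (ordGE_taylorEval ha (h.ordGE_coeff ht hη hg))).add ((hφ f hf).mul_left hgφ))

theorem ordGE_taylorEval_sub_aeval (p : F[X]) :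
    OrdGE (v P) (m + 1) (taylorEval m (φ t - t) (η (aeval t p)) - φ (aeval t p)) := by
  have ht0 : OrdGE (v P) 0 t := OrdGE.mono (m := 1) ht.le zero_le_one
  have hconst (c : F) : OrdGE (v P) (m + 1)
      (taylorEval m (φ t - t) (η (algebraMap F K c)) - φ (algebraMap F K c)) := by
    rw [AlgHom.commutes, AlgHom.commutes, IsScalarTower.algebraMap_apply F K (PowerSeries K),
      show algebraMap K (PowerSeries K) = PowerSeries.C from rfl, taylorEval_C, sub_self]
    exact OrdGE.zero _
  have hself : OrdGE (v P) (m + 1) (taylorEval m (φ t - t) (η t) - φ t) := by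
    rcases eq_or_ne m 0 with rfl | hm
    · simpa [taylorEval_apply, hη.constantCoeff] using
        OrdGE.sub (m := 1) ht.le hφt
    · rw [hη.apply_self, map_add, taylorEval_C, taylorEval_X hm, add_sub_cancel, sub_self]
      exact OrdGE.zero _
  have hpow (n : ℕ) :
      OrdGE (v P) (m + 1) (taylorEval m (φ t - t) (η (t ^ n)) - φ (t ^ n)) := by
    induction n with
    | zero => simpa using hconst 1
    | succ n ih =>
      rw [pow_succ]
      exact h.ordGE_taylorEval_sub_mul ht hη hφ hφt m (ht0.pow_of_zero n) ht0 ih hself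
  induction p using Polynomial.induction_on' with
  | add p q hp hq =>
    rw [map_add, map_add, map_add, map_add, add_sub_add_comm]
    exact hp.add hq
  | monomial n c =>
    rw [aeval_monomial]
    exact h.ordGE_taylorEval_sub_mul ht hη hφ hφt m (h.ordGE_algebraMap P c) (ht0.pow_of_zero n)
      (hconst c) (hpow n)

/-- At a fixed point of `φ`, the Taylor expansion evaluated at `φ t - t` gives `φ`. -/
theorem ordGE_taylorEval_sub {f : K} (hf : OrdGE (v P) 0 f) :
    OrdGE (v P) (m + 1) (taylorEval m (φ t - t) (η f) - φ f) := by
  have ha : OrdGE (v P) 1 (φ t - t) := hφt.sub ht.le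
  have ht0 : OrdGE (v P) 0 t := OrdGE.mono (m := 1) ht.le zero_le_one
  have htm := ht0.pow_of_zero (m + 1)
  obtain ⟨p, g, hg, rfl⟩ := h.exists_expansion P ht hf (m + 1)
  have hφpow : OrdGE (v P) (m + 1) (φ (t ^ (m + 1))) := by
    simpa using hφt.pow (m + 1)
  have hηpow : OrdGE (v P) (m + 1) (taylorEval m (φ t - t) (η (t ^ (m + 1)))) := by
    have happrox := h.ordGE_taylorEval_sub_aeval ht hη hφ hφt m (X ^ (m + 1))
    rw [aeval_X_pow] at happrox
    simpa only [sub_add_cancel] using happrox.add hφpow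
  have hrem : OrdGE (v P) (m + 1) (taylorEval m (φ t - t) (η (t ^ (m + 1) * g))) := by
    have hmul := (ordGE_taylorEval_mul_sub (m := m) ha (h.ordGE_coeff ht hη htm)
      (h.ordGE_coeff ht hη hg)).add (hηpow.mul_right
        (ordGE_taylorEval (m := m) ha (h.ordGE_coeff ht hη hg)))
    rwa [sub_add_cancel, ← map_mul] at hmul
  rw [map_add, map_add, map_add, add_sub_add_comm, map_mul φ]
  exact (h.ordGE_taylorEval_sub_aeval ht hη hφ hφt m p).add
    (hrem.sub (hφpow.mul_right (hφ g hg)))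

end Specialization

end Uniformizer

end IsPlaceSystem

/-! ### Local estimates for the Frobenius minor -/

section Triangular

variable {F K : Type*} [Field F] [Field K] [Algebra F K] {x t : K} {r : ℕ}

theorem IsTaylorHom.isTriangular (hx : IsSeparatingVariable F x) {η η' : K →ₐ[F] PowerSeries K}
    (hη : IsTaylorHom F x η) (hη' : IsTaylorHom F t η') (R f : Fin (r + 1) → K) (u : K) :
    IsTriangular R (fun m j => PowerSeries.coeff m (η (f j)))
      (fun m j => PowerSeries.coeff m (η' (f j * u))) fun m => hη'.derivation x ^ m * u := by
  obtain ⟨c, hcdiag, hc⟩ := exists_chain_rule hx hη hη'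
  have hmul : IsTriangular R (fun m j => PowerSeries.coeff m (η (f j)))
      (fun m j => PowerSeries.coeff m (η (f j * u))) fun m => PowerSeries.coeff (m - m) (η u) := by
    refine IsTriangular.of_sum (fun m i => PowerSeries.coeff (m - i) (η u)) 0 fun m => ?_
    ext j
    rw [map_mul, PowerSeries.coeff_mul, Finset.Nat.sum_antidiagonal_eq_sum_range_succ_mk]
    simp [mul_comm]
  have hchain : IsTriangular R (fun m j => PowerSeries.coeff m (η (f j * u)))
      (fun m j => PowerSeries.coeff m (η' (f j * u))) fun m => c m m := by
    refine IsTriangular.of_sum c 0 fun m => ?_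
    ext j
    rw [hc]
    simp
  simpa [hcdiag, hη.constantCoeff] using hmul.trans hchain

/-- The `m`-th row is the remainder, divided by `-a ^ (m + 1)`, of the Taylor expansion of a vector
proportional to `R`. -/
theorem isTriangular_remainder {a : K} (ha : a ≠ 0) (R : Fin (r + 1) → K)
    (α : Fin (r + 1) → PowerSeries K) (c : K) :
    IsTriangular R (fun m j => PowerSeries.coeff m (α j))
      (fun m j => -a⁻¹ ^ (m + 1) * (taylorEval m a (α j) - c * R j)) fun _ => -a⁻¹ := by
  have hdiag (m : ℕ) : -a⁻¹ ^ (m + 1) * a ^ m = -a⁻¹ := by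
    rw [pow_succ, inv_pow]
    field_simp
  suffices hsum : IsTriangular R (fun m j => PowerSeries.coeff m (α j))
      (fun m j => -a⁻¹ ^ (m + 1) * (taylorEval m a (α j) - c * R j))
      fun m => -a⁻¹ ^ (m + 1) * a ^ m by simpa only [hdiag] using hsum
  refine IsTriangular.of_sum (fun m i => -a⁻¹ ^ (m + 1) * a ^ i) (fun m => a⁻¹ ^ (m + 1) * c)
    fun m => ?_
  ext j
  simp only [taylorEval_apply, Pi.add_apply, Finset.sum_apply, Pi.smul_apply, smul_eq_mul, mul_sub,
    Finset.mul_sum, mul_assoc]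
  ring

theorem nonneg_vOrd_det_of_isTriangular {v : Valuation K ℤᵐ⁰} {R : Fin (r + 1) → K}
    {d d' : ℕ → Fin (r + 1) → K} {w b ρ : K} (hd : IsTriangular R d d' fun m => w ^ m * b)
    {ν : Fin r → ℕ} (hν : IsLeast (minorSet R d) (toLex ν)) (hw : w ≠ 0) (hb : b ≠ 0) (hρ : ρ ≠ 0)
    (hR : ∀ j, OrdGE v 0 (ρ * R j)) (hd' : ∀ m j, OrdGE v 0 (d' m j)) :
    0 ≤ vOrd v ρ + (∑ i, (ν i : ℤ)) * vOrd v w + r * vOrd v b +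
      vOrd v (Matrix.of (minorRows R d ν)).det := by
  have hint : OrdGE v 0 (Matrix.of (minorRows (ρ • R) d' ν)).det :=
    OrdGE.det _ fun i j => Fin.cases (hR j) (fun i => hd' (ν i) j) i
  have hΔ : (Matrix.of (minorRows R d ν)).det ≠ 0 := hν.1.2
  have hbr := pow_ne_zero r hb
  have hws := pow_ne_zero (∑ i, ν i) hw
  rw [hd.det_eq hν, Finset.prod_mul_distrib, Finset.prod_pow_eq_pow_sum, Finset.prod_const,
    Finset.card_univ, Fintype.card_fin,
    ordGE_iff_le_vOrd (mul_ne_zero (mul_ne_zero hρ (mul_ne_zero hws hbr)) hΔ),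
    vOrd_mul (mul_ne_zero hρ (mul_ne_zero hws hbr)) hΔ, vOrd_mul hρ (mul_ne_zero hws hbr),
    vOrd_mul hws hbr, vOrd_pow, vOrd_pow, Nat.cast_sum] at hint
  linarith

theorem ordGE_inv_pow_mul_pow {v : Valuation K ℤᵐ⁰} {f u : K} (hf : OrdGE v 0 (f * u⁻¹)) (q : ℕ) :
    OrdGE v 0 (u⁻¹ ^ q * f ^ q) := by
  rw [← mul_pow, mul_comm]
  exact hf.pow_of_zero q

theorem valuation_sub_eq_exp_neg_one {v : Valuation K ℤᵐ⁰} {t s : K} (ht : v t = exp (-1))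
    (hs : OrdGE v 2 s) : v (s - t) = exp (-1) := by
  obtain ⟨ht1, ht2⟩ := eq_exp_neg_iff_ordGE.mp ht
  refine eq_exp_neg_iff_ordGE.mpr ⟨(hs.mono one_le_two).sub ht1, fun hst => ht2 ?_⟩
  simpa using hs.sub hst

end Triangular

namespace IsPlaceSystem

variable {F K ι : Type*} [Field F] [IsAlgClosed F] [Field K] [Algebra F K]
  {v : ι → Valuation K ℤᵐ⁰} (h : IsPlaceSystem F v) {x : K} (hx : IsSeparatingVariable F x)

include h hx

theorem isSeparatingVariable_uniformizer {D : Derivation F K K} (hD : D x = 1) (P : ι) {t : K}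
    (ht : v P t = exp (-1)) : IsSeparatingVariable F t := by
  have hDt : D t ≠ 0 := h.derivation_uniformizer_ne_zero P (x := x) (by simp [hD]) ht
  have htt : Transcendental F t := by
    rcases transcendental_or_mem_range (F := F) t with htt | ⟨c, rfl⟩
    · exact htt
    · simp at hDt
  have := h.finiteDimensional t htt
  exact isSeparatingVariable_of_derivation hx hD htt hDt

variable {η : K →ₐ[F] PowerSeries K} (hη : IsTaylorHom F x η) {P : ι} {t : K}
  (ht : v P t = exp (-1)) {r q : ℕ} {f : Fin (r + 1) → K} {ν : Fin r → ℕ}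

include ht in
theorem vOrd_derivation_eq_canonical {η' : K →ₐ[F] PowerSeries K} (hη' : IsTaylorHom F t η') :
    hη'.derivation x ≠ 0 ∧
      vOrd (v P) (hη'.derivation x) = h.canonical hη.derivation_self P := by
  have hinv : hη.derivation t * hη'.derivation x = 1 := by
    rw [← smul_eq_mul, ← derivation_eq_smul hη'.derivation hx hη.derivation_self,
      hη'.derivation_self]
  have hDx := right_ne_zero_of_mul_eq_one hinv
  refine ⟨hDx, ?_⟩
  have hord := congrArg (vOrd (v P)) hinv
  rw [vOrd_mul (left_ne_zero_of_mul_eq_one hinv) hDx, vOrd_one] at hord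
  rw [h.canonical_apply _ ht]
  linarith

section Point

variable (hν : IsLeast (minorSet (fun j => f j ^ q) fun m j => PowerSeries.coeff m (η (f j)))
  (toLex ν)) {e : ℤ} (he : ∀ j, OrdGE (v P) (-e) (f j)) {j₀ : Fin (r + 1)} (hj₀ : f j₀ ≠ 0)
  (hord : vOrd (v P) (f j₀) = -e)

include hν he hj₀ hord

/-- Divide by `f j₀`, so that all entries become regular at `P`, and replace `x` by a
uniformizer. -/
theorem nonneg_vOrd_minor :
    0 ≤ vOrd (v P) (Matrix.of (minorRows (fun j => f j ^ q)
      (fun m j => PowerSeries.coeff m (η (f j))) ν)).det + (q + r) * e +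
      (∑ i, (ν i : ℤ)) * h.canonical hη.derivation_self P := by
  obtain ⟨t, ht⟩ := h.exists_uniformizer P
  obtain ⟨η', hη'⟩ :=
    exists_isTaylorHom F t (h.isSeparatingVariable_uniformizer hx hη.derivation_self P ht)
  obtain ⟨hw, hword⟩ := h.vOrd_derivation_eq_canonical hx hη ht hη'
  have hu := inv_ne_zero hj₀
  have hregular (j : Fin (r + 1)) : OrdGE (v P) 0 (f j * (f j₀)⁻¹) := by
    simpa [hord, div_eq_mul_inv] using (he j).div hj₀
  have htri := hη.isTriangular hx hη' (fun j => f j ^ q) f (f j₀)⁻¹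
  have hineq := nonneg_vOrd_det_of_isTriangular htri hν hw hu (pow_ne_zero q hu)
    (fun j => ordGE_inv_pow_mul_pow (hregular j) q)
    fun m j => h.ordGE_coeff ht hη' (hregular j) m
  rw [vOrd_pow, vOrd_inv, hord, hword] at hineq
  linarith

/-- At a fixed point of `φ` the rows can moreover be replaced by Taylor remainders of
`φ (f j / f j₀)`, since `φ` raises each `f j` to the `q`-th power; this gains a factor `φ t - t`, of
order one, in each of the `r` rows. -/
theorem le_vOrd_minor (hq : 1 < q) {φ : K →ₐ[F] K} (hφf : ∀ j, φ (f j) = f j ^ q)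
    (hφ : ∀ f, OrdGE (v P) 0 f → OrdGE (v P) 0 (φ f)) (ht : v P t = exp (-1)) (hφt : φ t = t ^ q) :
    r ≤ vOrd (v P) (Matrix.of (minorRows (fun j => f j ^ q)
      (fun m j => PowerSeries.coeff m (η (f j))) ν)).det + (q + r) * e +
      (∑ i, (ν i : ℤ)) * h.canonical hη.derivation_self P := by
  obtain ⟨η', hη'⟩ :=
    exists_isTaylorHom F t (h.isSeparatingVariable_uniformizer hx hη.derivation_self P ht)
  obtain ⟨hw, hword⟩ := h.vOrd_derivation_eq_canonical hx hη ht hη'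
  have hu := inv_ne_zero hj₀
  have hregular (j : Fin (r + 1)) : OrdGE (v P) 0 (f j * (f j₀)⁻¹) := by
    simpa [hord, div_eq_mul_inv] using (he j).div hj₀
  have hφt2 : OrdGE (v P) 2 (φ t) := by
    rw [hφt]
    exact (OrdGE.pow (m := 1) ht.le q).mono (by lia)
  have ha := valuation_sub_eq_exp_neg_one ht hφt2
  have ha0 := ne_zero_of_eq_exp ha
  have haord : vOrd (v P) (φ t - t) = 1 := vOrd_eq_of_eq_exp_neg ha
  have hremainder (m : ℕ) (j : Fin (r + 1)) : OrdGE (v P) 0 (-(φ t - t)⁻¹ ^ (m + 1) *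
      (taylorEval m (φ t - t) (η' (f j * (f j₀)⁻¹)) - (f j₀)⁻¹ ^ q * f j ^ q)) := by
    have htaylor := h.ordGE_taylorEval_sub ht hη' hφ (hφt2.mono one_le_two) m (hregular j)
    rw [map_mul φ, map_inv₀, hφf, hφf, mul_comm (f j ^ q), ← inv_pow] at htaylor
    have hcoeff := (OrdGE.self (v := v P) ((φ t - t)⁻¹ ^ (m + 1))).neg
    rw [vOrd_pow, vOrd_inv, haord] at hcoeff
    exact (hcoeff.mul htaylor).mono (by push_cast; linarith)
  have htri := (hη.isTriangular hx hη' (fun j => f j ^ q) f (f j₀)⁻¹).trans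
    (isTriangular_remainder ha0 _ (fun j => η' (f j * (f j₀)⁻¹)) ((f j₀)⁻¹ ^ q))
  simp only [mul_left_comm (-(φ t - t)⁻¹)] at htri
  have hb : -(φ t - t)⁻¹ * (f j₀)⁻¹ ≠ 0 := mul_ne_zero (neg_ne_zero.mpr (inv_ne_zero ha0)) hu
  have hineq := nonneg_vOrd_det_of_isTriangular htri hν hw hb (pow_ne_zero q hu)
    (fun j => ordGE_inv_pow_mul_pow (hregular j) q) hremainder
  rw [vOrd_pow, vOrd_mul (neg_ne_zero.mpr (inv_ne_zero ha0)) hu, vOrd_neg, vOrd_inv, vOrd_inv,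
    haord, hord, hword] at hineq
  linarith

end Point

include hη

theorem mul_card_fixedPoints_le (hq : 1 < q)
    (hν : IsLeast (minorSet (fun j => f j ^ q) fun m j => PowerSeries.coeff m (η (f j))) (toLex ν))
    (E : ι →₀ ℤ) (hE : ∀ P j, OrdGE (v P) (-E P) (f j))
    (hfree : ∀ P, ∃ j, f j ≠ 0 ∧ vOrd (v P) (f j) = -E P)
    {φ : K →ₐ[F] K} (hφf : ∀ j, φ (f j) = f j ^ q) (N : Finset ι)
    (hN : ∀ P ∈ N, (∀ f, OrdGE (v P) 0 f → OrdGE (v P) 0 (φ f)) ∧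
      ∃ t, v P t = exp (-1) ∧ φ t = t ^ q)
    {g : ℤ} (hg : ∀ A : ι →₀ ℤ, A.degree + 1 - Module.finrank F (h.rrSpace A) ≤ g) :
    r * (N.card : ℤ) ≤ (∑ i, (ν i : ℤ)) * (2 * g - 2) + (q + r) * E.degree := by
  classical
  set Δ := (Matrix.of (minorRows (fun j => f j ^ q)
    (fun m j => PowerSeries.coeff m (η (f j))) ν)).det
  have hΔ : Δ ≠ 0 := hν.1.2
  have hle : (r : ℤ) • ∑ P ∈ N, Finsupp.single P (1 : ℤ) ≤
      h.divisor Δ + ((q : ℤ) + r) • E + (∑ i, (ν i : ℤ)) • h.canonical hη.derivation_self := by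
    intro P
    have hindicator : (∑ Q ∈ N, Finsupp.single Q (1 : ℤ)) P = if P ∈ N then 1 else 0 := by
      rw [Finsupp.finsetSum_apply]
      simp [Finsupp.single_apply]
    obtain ⟨j₀, hj₀, hord⟩ := hfree P
    simp only [Finsupp.smul_apply, hindicator, Finsupp.add_apply, divisor_apply, smul_eq_mul]
    split_ifs with hP
    · obtain ⟨hφ, t, ht, hφt⟩ := hN P hP
      simpa using h.le_vOrd_minor hx hη hν (hE P) hj₀ hord hq hφf hφ ht hφt
    · simpa using h.nonneg_vOrd_minor hx hη hν (hE P) hj₀ hord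
  have hdeg := degree_le_degree hle
  simp only [map_add, map_zsmul, map_sum, Finsupp.degree_single, Finset.sum_const, smul_eq_mul,
    h.degree_divisor hΔ, zero_add, nsmul_eq_mul, mul_one] at hdeg
  have hcanonical := mul_le_mul_of_nonneg_left (h.degree_canonical_le hx hη.derivation_self hg)
    (Finset.sum_nonneg fun i _ => Nat.cast_nonneg (ν i) : (0 : ℤ) ≤ ∑ i, (ν i : ℤ))
  linarith

end IsPlaceSystem

end StohrVoloch

namespace StohrVoloch

open WithZero

/-! ### Functions on a projective variety -/

section Fractions

open MvPolynomial

variable {F : Type*} [Field F] {n : ℕ} {I : Ideal (MvPolynomial (Fin (n + 1)) F)}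

theorem algebraMap_mk_eq_aeval (G : MvPolynomial (Fin (n + 1)) F) :
    algebraMap _ (FractionRing (MvPolynomial (Fin (n + 1)) F ⧸ I)) (Ideal.Quotient.mk I G) =
      aeval (fun i => algebraMap _ (FractionRing (MvPolynomial (Fin (n + 1)) F ⧸ I))
        (Ideal.Quotient.mk I (X i))) G := by
  have hhom : (Algebra.algHom F (MvPolynomial (Fin (n + 1)) F ⧸ I)
      (FractionRing (MvPolynomial (Fin (n + 1)) F ⧸ I))).comp (Ideal.Quotient.mkₐ F I) =
      aeval fun i => algebraMap _ (FractionRing (MvPolynomial (Fin (n + 1)) F ⧸ I))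
        (Ideal.Quotient.mk I (X i)) := by
    ext i
    simp only [AlgHom.comp_apply, aeval_X]
    rfl
  exact congr($hhom G)

theorem exists_rep_ne_zero (P : zeroLocus I) : ∃ j, P.1.rep j ≠ 0 := by
  by_contra! hzero
  exact P.1.rep_nonzero (funext hzero)

theorem notMem_of_eval_ne_zero {P : zeroLocus I} {H : MvPolynomial (Fin (n + 1)) F}
    (hH : eval P.1.rep H ≠ 0) : H ∉ I := fun hmem => hH (P.2 _ hmem)

theorem X_notMem {P : zeroLocus I} {j : Fin (n + 1)} (hj : P.1.rep j ≠ 0) : X j ∉ I :=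
  notMem_of_eval_ne_zero (P := P) (by simpa using hj)

variable [I.IsPrime]

theorem frac_eq_frac {G H G' H' : MvPolynomial (Fin (n + 1)) F} (hH : H ∉ I) (hH' : H' ∉ I) :
    frac I G H = frac I G' H' ↔ G * H' - G' * H ∈ I := by
  rw [frac, frac, div_eq_div_iff (toFrac_ne_zero hH) (toFrac_ne_zero hH'), ← Ideal.Quotient.eq,
    ← (IsFractionRing.injective (MvPolynomial (Fin (n + 1)) F ⧸ I)
      (FractionRing (MvPolynomial (Fin (n + 1)) F ⧸ I))).eq_iff]
  simp only [map_mul]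

variable (I) in
/-- The quotient `G / H` of homogeneous polynomials of the same degree as an element of the function
field (zero if `H ∈ I`). -/
noncomputable def ratio {d : ℕ} {G H : MvPolynomial (Fin (n + 1)) F} (hG : G.IsHomogeneous d)
    (hH : H.IsHomogeneous d) : functionField I :=
  ⟨frac I G H, by
    by_cases hmem : H ∈ I
    · rw [show frac I G H = 0 by simp [frac, Ideal.Quotient.eq_zero_iff_mem.mpr hmem]]
      exact zero_mem _
    · exact ⟨d, G, H, hG, hH, hmem, rfl⟩⟩

theorem ratio_inv {d : ℕ} {G H : MvPolynomial (Fin (n + 1)) F} (hG : G.IsHomogeneous d)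
    (hH : H.IsHomogeneous d) : (ratio I hG hH)⁻¹ = ratio I hH hG :=
  Subtype.ext (inv_div _ _)

theorem ratio_ne_zero {d : ℕ} {G H : MvPolynomial (Fin (n + 1)) F} (hG : G.IsHomogeneous d)
    (hH : H.IsHomogeneous d) (hGI : G ∉ I) (hHI : H ∉ I) : ratio I hG hH ≠ 0 := fun hzero =>
  div_ne_zero (toFrac_ne_zero hGI) (toFrac_ne_zero hHI) congr(($hzero).1)

theorem ratio_eq_zero {d : ℕ} {G H : MvPolynomial (Fin (n + 1)) F} (hG : G.IsHomogeneous d)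
    (hH : H.IsHomogeneous d) (hGI : G ∈ I) : ratio I hG hH = 0 :=
  Subtype.ext <| by simp [ratio, frac, Ideal.Quotient.eq_zero_iff_mem.mpr hGI]

theorem ratio_sub_algebraMap {d : ℕ} {G H : MvPolynomial (Fin (n + 1)) F} (hG : G.IsHomogeneous d)
    (hH : H.IsHomogeneous d) (hHI : H ∉ I) (c : F) :
    ratio I hG hH - algebraMap F (functionField I) c = ratio I (hG.sub (hH.C_mul c)) hH := by
  refine Subtype.ext ?_
  change frac I G H - algebraMap F _ c = frac I (G - C c * H) H
  rw [← frac_C, frac, frac, frac, map_one, map_one, div_one, map_sub, map_mul, map_sub, map_mul,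
    sub_div, mul_div_cancel_right₀ _ (toFrac_ne_zero hHI)]

variable (I) in
/-- The affine coordinate function `xᵢ / xⱼ`. -/
noncomputable def coord (i j : Fin (n + 1)) : functionField I :=
  ratio I (isHomogeneous_X F i) (isHomogeneous_X F j)

theorem coord_self {j : Fin (n + 1)} (hj : X j ∉ I) : coord I j j = 1 :=
  Subtype.ext (div_self (toFrac_ne_zero hj))

theorem coord_mul_coord (i : Fin (n + 1)) {j : Fin (n + 1)} (hj : X j ∉ I) (l : Fin (n + 1)) :
    coord I i j * coord I j l = coord I i l :=
  Subtype.ext (div_mul_div_cancel₀ (toFrac_ne_zero hj))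

theorem aeval_coord {G : MvPolynomial (Fin (n + 1)) F} {d : ℕ} (hG : G.IsHomogeneous d)
    (j : Fin (n + 1)) :
    aeval (fun i => coord I i j) G = ratio I hG (isHomogeneous_X_pow j d) := by
  have hval : (aeval (fun i => coord I i j) G : functionField I).1 =
      aeval (fun i => (coord I i j).1) G :=
    congr($(comp_aeval (fun i => coord I i j) (functionField I).val) G)
  have hcoord : (fun i => (coord I i j).1) =
      (algebraMap _ (FractionRing (MvPolynomial (Fin (n + 1)) F ⧸ I))
        (Ideal.Quotient.mk I (X j)))⁻¹ • fun i => algebraMap _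
        (FractionRing (MvPolynomial (Fin (n + 1)) F ⧸ I)) (Ideal.Quotient.mk I (X i)) :=
    funext fun _ => div_eq_inv_mul _ _
  refine Subtype.ext ?_
  change (aeval (fun i => coord I i j) G : functionField I).1 = frac I G (X j ^ d)
  rw [hval, hcoord, aeval_def, ← eval_map, eval_smul_of_isHomogeneous (hG.map _), eval_map,
    ← aeval_def, ← algebraMap_mk_eq_aeval, frac, map_pow, map_pow, inv_pow, div_eq_inv_mul]

theorem ratio_eq_aeval_div {G H : MvPolynomial (Fin (n + 1)) F} {d : ℕ} (hG : G.IsHomogeneous d)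
    (hH : H.IsHomogeneous d) {j : Fin (n + 1)} (hj : X j ∉ I) :
    ratio I hG hH = aeval (fun i => coord I i j) G / aeval (fun i => coord I i j) H := by
  have hXd : (X j ^ d : MvPolynomial (Fin (n + 1)) F) ∉ I :=
    fun hmem => hj (Ideal.IsPrime.mem_of_pow_mem ‹_› _ hmem)
  rw [aeval_coord hG, aeval_coord hH]
  exact Subtype.ext (div_div_div_cancel_right₀ (toFrac_ne_zero hXd) _ _).symm

theorem exists_X_notMem {f : functionField I}
    (hf : f ∉ Set.range (algebraMap F (functionField I))) : ∃ j, X j ∉ I := by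
  by_contra! hX
  obtain ⟨d, G, H, -, -, -, hz⟩ := f.2
  have hconst (G : MvPolynomial (Fin (n + 1)) F) : algebraMap _
      (FractionRing (MvPolynomial (Fin (n + 1)) F ⧸ I)) (Ideal.Quotient.mk I G) =
      algebraMap F _ (aeval (fun _ => (0 : F)) G) := by
    rw [algebraMap_mk_eq_aeval, ← aeval_algebraMap_apply]
    congr 2
    funext i
    simp [Ideal.Quotient.eq_zero_iff_mem.mpr (hX i)]
  refine hf ⟨aeval (fun _ => (0 : F)) G / aeval (fun _ => (0 : F)) H, Subtype.ext ?_⟩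
  change algebraMap F _ _ = f.1
  rw [hz, frac, hconst, hconst, map_div₀]

end Fractions

namespace Curve

open MvPolynomial

variable {k F : Type*} [Field k] [Field F] [Algebra k F] {n : ℕ} {X : Curve k F n} {P : X.Point}

theorem valuation_le_one_iff {f : X.Func} :
    X.valuation P f ≤ 1 ↔ f ∈ localRing (extend F X.ideal) P := by
  constructor
  · intro hf
    obtain ⟨a, rfl⟩ := IsDiscreteValuationRing.exists_lift_of_le_one hf
    exact a.2
  · intro hf
    exact (IsDiscreteValuationRing.maximalIdeal
      (localRing (extend F X.ideal) P)).valuation_le_one ⟨f, hf⟩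

theorem exists_ratio_of_valuation_le_one {f : X.Func} (hf : X.valuation P f ≤ 1) :
    ∃ (d : ℕ) (G H : MvPolynomial (Fin (n + 1)) F) (hG : G.IsHomogeneous d)
      (hH : H.IsHomogeneous d), eval P.1.rep H ≠ 0 ∧ f = ratio _ hG hH := by
  obtain ⟨d, G, H, hG, hH, hHP, hfrac⟩ := valuation_le_one_iff.mp hf
  exact ⟨d, G, H, hG, hH, hHP, Subtype.ext hfrac⟩

variable {d : ℕ} {G H : MvPolynomial (Fin (n + 1)) F} (hG : G.IsHomogeneous d)
  (hH : H.IsHomogeneous d) (hHP : eval P.1.rep H ≠ 0)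

include hHP

theorem valuation_ratio_le_one : X.valuation P (ratio _ hG hH) ≤ 1 :=
  valuation_le_one_iff.mpr ⟨d, G, H, hG, hH, hHP, rfl⟩

theorem valuation_ratio_eq_one (hGP : eval P.1.rep G ≠ 0) :
    X.valuation P (ratio _ hG hH) = 1 := by
  refine le_antisymm (valuation_ratio_le_one hG hH hHP) ?_
  have hne : X.valuation P (ratio _ hG hH) ≠ 0 := (Valuation.ne_zero_iff _).mpr
    (ratio_ne_zero hG hH (notMem_of_eval_ne_zero hGP) (notMem_of_eval_ne_zero hHP))
  have hinv := valuation_ratio_le_one (X := X) hH hG hGP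
  rw [← ratio_inv, map_inv₀] at hinv
  exact (inv_le_one₀ (zero_lt_iff.mpr hne)).mp hinv

theorem valuation_ratio_lt_one (hGP : eval P.1.rep G = 0) :
    X.valuation P (ratio _ hG hH) < 1 := by
  refine lt_of_le_of_ne (valuation_ratio_le_one hG hH hHP) fun hunit => ?_
  have hne : ratio (extend F X.ideal) hG hH ≠ 0 :=
    (Valuation.ne_zero_iff (X.valuation P)).mp (by simp [hunit])
  obtain ⟨d', G', H', hG', hH', hHP', hinv⟩ :=
    exists_ratio_of_valuation_le_one (X := X) (P := P) (f := (ratio _ hG hH)⁻¹)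
      (by rw [map_inv₀, hunit, inv_one])
  have hmul : ratio (extend F X.ideal) hG hH * ratio (extend F X.ideal) hG' hH' = 1 := by
    rw [← hinv, mul_inv_cancel₀ hne]
  have hprod : frac (extend F X.ideal) (G * G') (H * H') = frac (extend F X.ideal) 1 1 := by
    rw [← frac_mul]
    exact congr(($hmul).1).trans (by simp [frac])
  have hmem := (frac_eq_frac (notMem_of_eval_ne_zero (P := P) (by simp [hHP, hHP']))
    one_notMem).mp hprod
  simpa [hGP, hHP, hHP'] using P.2 _ hmem

end Curve

section LinearForms

open MvPolynomial

variable {F : Type*} [Field F] {n : ℕ}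

theorem exists_linear_form_eval_eq_zero {P Q : ℙ F (Fin (n + 1) → F)} (hne : Q ≠ P) :
    ∃ L : MvPolynomial (Fin (n + 1)) F, L.IsHomogeneous 1 ∧ eval Q.rep L = 0 ∧
      eval P.rep L ≠ 0 := by
  by_contra! hvanish
  have hminors (i j : Fin (n + 1)) : Q.rep j * P.rep i = Q.rep i * P.rep j := by
    have hL := (isHomogeneous_C_mul_X (Q.rep j) i).sub (isHomogeneous_C_mul_X (Q.rep i) j)
    simpa [sub_eq_zero] using hvanish _ hL (by simp [mul_comm])
  obtain ⟨i, hi⟩ : ∃ i, P.rep i ≠ 0 := by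
    by_contra! hzero
    exact P.rep_nonzero (funext hzero)
  apply hne
  rw [← Q.mk_rep, ← P.mk_rep, Projectivization.mk_eq_mk_iff']
  refine ⟨Q.rep i / P.rep i, funext fun j => ?_⟩
  rw [Pi.smul_apply, smul_eq_mul, div_mul_eq_mul_div, div_eq_iff hi, hminors]

theorem exists_linear_form_eval_ne_zero [Infinite F] (S : Finset (ℙ F (Fin (n + 1) → F))) :
    ∃ L : MvPolynomial (Fin (n + 1)) F, L.IsHomogeneous 1 ∧ ∀ P ∈ S, eval P.rep L ≠ 0 := by
  obtain ⟨ℓ, hℓ⟩ := Module.exists_dual_forall_apply_ne_zero (K := F)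
    (fun P : S => P.1.rep) fun P => P.1.rep_nonzero
  refine ⟨∑ i, C (ℓ fun j => if i = j then 1 else 0) * X i,
    IsHomogeneous.sum _ _ _ fun i _ => isHomogeneous_C_mul_X _ i, fun P hP => ?_⟩
  have hne := hℓ ⟨P, hP⟩
  rw [LinearMap.pi_apply_eq_sum_univ] at hne
  simpa [mul_comm] using hne

end LinearForms

section HomogeneousIdeals

open MvPolynomial

variable {k F : Type*} [Field k] [Field F] [Algebra k F] {n : ℕ}
  {J : Ideal (MvPolynomial (Fin (n + 1)) k)}

theorem extend_le_of_homogeneous (hJ : ∀ g ∈ J, ∀ d, homogeneousComponent d g ∈ J)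
    {I : Ideal (MvPolynomial (Fin (n + 1)) F)}
    (hI : ∀ d, ∀ g ∈ J, g.IsHomogeneous d → map (algebraMap k F) g ∈ I) : extend F J ≤ I := by
  refine Ideal.map_le_iff_le_comap.mpr fun g hg => ?_
  rw [Ideal.mem_comap, ← sum_homogeneousComponent g, map_sum]
  exact sum_mem fun d _ => hI d _ (hJ g hg d) (homogeneousComponent_isHomogeneous d g)

theorem extend_le_ker_aeval_coord [(extend F J).IsPrime]
    (hJ : ∀ g ∈ J, ∀ d, homogeneousComponent d g ∈ J) (j : Fin (n + 1)) :
    extend F J ≤ RingHom.ker (aeval fun i => coord (extend F J) i j) :=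
  extend_le_of_homogeneous hJ fun _ _ hg hd =>
    (aeval_coord (hd.map _) j).trans (ratio_eq_zero _ _ (Ideal.mem_map_of_mem _ hg))

theorem mk_mem_zeroLocus (hJ : ∀ g ∈ J, ∀ d, homogeneousComponent d g ∈ J) {a : Fin (n + 1) → F}
    (ha : a ≠ 0) (hker : extend F J ≤ RingHom.ker (eval a)) :
    Projectivization.mk F a ha ∈ zeroLocus (extend F J) := by
  obtain ⟨c, hc⟩ := Projectivization.exists_smul_eq_mk_rep F a ha
  suffices hle : extend F J ≤ RingHom.ker (eval (Projectivization.mk F a ha).rep) from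
    fun g hg => hle hg
  refine extend_le_of_homogeneous hJ fun d g hg hd => ?_
  rw [RingHom.mem_ker, ← hc, Units.smul_def, eval_smul_of_isHomogeneous (hd.map _),
    RingHom.mem_ker.mp (hker (Ideal.mem_map_of_mem _ hg)), mul_zero]

end HomogeneousIdeals

section Centers

open MvPolynomial

variable {F : Type*} [Field F]

/-- A point of affine space in the centre of `V`, by the Nullstellensatz. -/
theorem exists_valuation_aeval_eq_one [IsAlgClosed F] {K σ : Type*} [Field K] [Algebra F K]
    [Finite σ] (V : ValuationSubring K) (hV : ∀ c, algebraMap F K c ∈ V) {y : σ → K}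
    (hy : ∀ i, y i ∈ V) :
    ∃ a : σ → F, ∀ G : MvPolynomial σ F, eval a G ≠ 0 → V.valuation (aeval y G) = 1 := by
  have hmem (G : MvPolynomial σ F) : aeval y G ∈ V := eval₂_mem (fun _ _ => hV _) hy
  let θ : MvPolynomial σ F →+* V := (aeval (R := F) y).toRingHom.codRestrict V.toSubring hmem
  obtain ⟨M, hM, hle⟩ := Ideal.exists_le_maximal ((IsLocalRing.maximalIdeal V).comap θ)
    (Ideal.comap_ne_top _ Ideal.IsPrime.ne_top')
  obtain ⟨a, rfl⟩ := isMaximal_iff_eq_vanishingIdeal_singleton.mp hM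
  refine ⟨a, fun G hG => (V.valuation_eq_one_iff (θ G)).mp ?_⟩
  by_contra hunit
  have hvanish := hle (show G ∈ (IsLocalRing.maximalIdeal V).comap θ from hunit)
  rw [mem_vanishingIdeal_singleton_iff, aeval_eq_eval] at hvanish
  exact hG hvanish

variable {n : ℕ} {I : Ideal (MvPolynomial (Fin (n + 1)) F)} [I.IsPrime]

theorem exists_coord_mem (V : ValuationSubring (functionField I)) {j₀ : Fin (n + 1)}
    (hj₀ : X j₀ ∉ I) : ∃ j, X j ∉ I ∧ ∀ i, coord I i j ∈ V := by
  obtain ⟨j, -, hmax⟩ := Finset.exists_max_image Finset.univ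
    (fun j => V.valuation (coord I j j₀)) ⟨j₀, Finset.mem_univ _⟩
  have hpos : 0 < V.valuation (coord I j j₀) := by
    refine zero_lt_one.trans_le ?_
    simpa [coord_self hj₀] using hmax j₀ (Finset.mem_univ _)
  have hj : X j ∉ I := fun hmem => hpos.ne' (by rw [coord, ratio_eq_zero _ _ hmem, map_zero])
  refine ⟨j, hj, fun i => ?_⟩
  have hle := hmax i (Finset.mem_univ _)
  rw [← coord_mul_coord i hj j₀, map_mul] at hle
  exact (V.valuation_le_one_iff _).mp ((mul_le_iff_le_one_left hpos).mp hle)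

end Centers

namespace Curve

open MvPolynomial

variable {k F : Type*} [Field k] [Field F] [Algebra k F] {n : ℕ} (X : Curve k F n)

theorem exists_valuation_sub_lt_one (P : X.Point) {f : X.Func} (hf : X.valuation P f ≤ 1) :
    ∃ c : F, X.valuation P (f - algebraMap F X.Func c) < 1 := by
  obtain ⟨d, G, H, hG, hH, hHP, rfl⟩ := exists_ratio_of_valuation_le_one hf
  refine ⟨eval P.1.rep G / eval P.1.rep H, ?_⟩
  rw [ratio_sub_algebraMap hG hH (notMem_of_eval_ne_zero hHP)]
  exact valuation_ratio_lt_one _ hH hHP (by simp [hHP])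

theorem exists_uniformizer (P : X.Point) : ∃ t, X.valuation P t = exp (-1) :=
  (IsDiscreteValuationRing.maximalIdeal
    (localRing (extend F X.ideal) P)).valuation_exists_uniformizer X.Func

theorem exists_separating_pair [Infinite F] (S : Finset X.Point) {P Q : X.Point} (hP : P ∈ S)
    (hne : Q ≠ P) : ∃ e, X.valuation P e = 1 ∧ (∀ R ∈ S, X.valuation R e ≤ 1) ∧
      (Q ∈ S → X.valuation Q e < 1) := by
  classical
  obtain ⟨M, hM, hMS⟩ := exists_linear_form_eval_ne_zero (S.image Subtype.val)
  replace hMS (R : X.Point) (hR : R ∈ S) : eval R.1.rep M ≠ 0 :=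
    hMS _ (Finset.mem_image_of_mem _ hR)
  obtain ⟨L, hL, hLQ, hLP⟩ := exists_linear_form_eval_eq_zero (Subtype.coe_injective.ne hne)
  exact ⟨ratio _ hL hM, valuation_ratio_eq_one _ _ (hMS P hP) hLP,
    fun R hR => valuation_ratio_le_one _ _ (hMS R hR),
    fun hQ => valuation_ratio_lt_one _ _ (hMS Q hQ) hLQ⟩

theorem exists_separating [Infinite F] (S : Finset X.Point) {P : X.Point} (hP : P ∈ S) :
    ∃ e, X.valuation P e = 1 ∧ ∀ Q ∈ S, Q ≠ P → X.valuation Q e < 1 := by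
  classical
  choose! e heP heS heQ using fun (Q : X.Point) (hne : Q ≠ P) =>
    X.exists_separating_pair S hP hne
  refine ⟨∏ Q ∈ S.erase P, e Q, ?_, fun Q hQ hne => ?_⟩
  · rw [map_prod]
    exact Finset.prod_eq_one fun Q hQ => heP Q (Finset.ne_of_mem_erase hQ)
  · rw [← Finset.mul_prod_erase _ e (Finset.mem_erase.mpr ⟨hne, hQ⟩), map_mul, map_prod]
    refine mul_lt_one_of_lt_of_le (heQ Q hne hQ) (Finset.prod_le_one' fun R hR => ?_)
    exact heS R (Finset.ne_of_mem_erase (Finset.mem_of_mem_erase hR)) Q hQ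

theorem adjoin_coord_eq_top {j : Fin (n + 1)} (hj : MvPolynomial.X j ∉ extend F X.ideal) :
    IntermediateField.adjoin F (Set.range fun i => coord (extend F X.ideal) i j) = ⊤ := by
  rw [eq_top_iff]
  rintro f -
  obtain ⟨d, G, H, hG, hH, -, hfrac⟩ := f.2
  have hf : f = ratio _ hG hH := Subtype.ext hfrac
  have hmem (G : MvPolynomial (Fin (n + 1)) F) : aeval (fun i => coord (extend F X.ideal) i j) G ∈
      IntermediateField.adjoin F (Set.range fun i => coord (extend F X.ideal) i j) := by
    apply IntermediateField.algebra_adjoin_le_adjoin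
    rw [Algebra.adjoin_range_eq_range_aeval]
    exact ⟨G, rfl⟩
  rw [hf, ratio_eq_aeval_div hG hH hj]
  exact div_mem (hmem G) (hmem H)

theorem finiteDimensional {x : X.Func} (hx : Transcendental F x) :
    FiniteDimensional F⟮x⟯ X.Func := by
  obtain ⟨j, hj⟩ := exists_X_notMem (I := extend F X.ideal) (f := x) (by
    rintro ⟨c, rfl⟩
    exact hx (isAlgebraic_algebraMap c))
  have hfg : Algebra.EssFiniteType F X.Func := by
    rw [← IntermediateField.fg_top_iff, ← X.adjoin_coord_eq_top hj]
    exact IntermediateField.fg_adjoin_of_finite (Set.finite_range _)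
  have hbasis : IsTranscendenceBasis F (fun _ : Unit => x) := by
    refine AlgebraicIndependent.isTranscendenceBasis_of_lift_trdeg_le_of_finite ?_ ?_
    · exact (algebraicIndependent_unique_type_iff (ι := Unit)).mpr hx
    · simp [X.trdeg_eq_one]
  have halg : Algebra.IsAlgebraic F⟮x⟯ X.Func := by
    have := hbasis.isAlgebraic_field
    rwa [Set.range_const] at this
  obtain ⟨s, hs⟩ := IntermediateField.fg_top_iff.mpr (Algebra.EssFiniteType.of_comp F F⟮x⟯ X.Func)
  have hfin : FiniteDimensional F⟮x⟯ (IntermediateField.adjoin F⟮x⟯ (s : Set X.Func)) :=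
    IntermediateField.finiteDimensional_adjoin fun y _ => (halg.isAlgebraic y).isIntegral
  rw [hs] at hfin
  exact IntermediateField.topEquiv.toLinearEquiv.finiteDimensional

theorem exists_generators : ∃ T : Finset X.Func, ∀ P f, X.valuation P f ≤ 1 →
    ∃ a ∈ Algebra.adjoin F {u | u ∈ T ∧ X.valuation P u ≤ 1},
    ∃ b ∈ Algebra.adjoin F {u | u ∈ T ∧ X.valuation P u ≤ 1}, X.valuation P b = 1 ∧ f = a / b := by
  have hfin := Set.finite_range fun p : Fin (n + 1) × Fin (n + 1) =>
    coord (extend F X.ideal) p.1 p.2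
  refine ⟨hfin.toFinset, fun P f hf => ?_⟩
  obtain ⟨d, G, H, hG, hH, hHP, rfl⟩ := exists_ratio_of_valuation_le_one hf
  obtain ⟨j, hj⟩ := exists_rep_ne_zero P
  have hmem (G : MvPolynomial (Fin (n + 1)) F) : aeval (fun i => coord (extend F X.ideal) i j) G ∈
      Algebra.adjoin F {u | u ∈ hfin.toFinset ∧ X.valuation P u ≤ 1} := by
    refine Algebra.adjoin_mono (s := Set.range fun i => coord (extend F X.ideal) i j) ?_ ?_
    · rintro _ ⟨i, rfl⟩
      exact ⟨hfin.mem_toFinset.mpr ⟨(i, j), rfl⟩, valuation_ratio_le_one _ _ (by simpa using hj)⟩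
    · rw [Algebra.adjoin_range_eq_range_aeval]
      exact ⟨G, rfl⟩
  refine ⟨_, hmem G, _, hmem H, ?_, ratio_eq_aeval_div hG hH (X_notMem hj)⟩
  rw [aeval_coord hH]
  exact valuation_ratio_eq_one _ _ (by simp [hj]) hHP

theorem exists_localRing_le [IsAlgClosed F] (V : ValuationSubring X.Func)
    (hV : ∀ c, algebraMap F X.Func c ∈ V) {j₀ : Fin (n + 1)}
    (hj₀ : MvPolynomial.X j₀ ∉ extend F X.ideal) :
    ∃ Q : X.Point, ∀ f ∈ localRing (extend F X.ideal) Q, f ∈ V := by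
  obtain ⟨j, hj, hcoord⟩ := exists_coord_mem V hj₀
  obtain ⟨a, ha⟩ := exists_valuation_aeval_eq_one V hV hcoord
  have hvanish {G : MvPolynomial (Fin (n + 1)) F}
      (hG : aeval (fun i => coord (extend F X.ideal) i j) G = 0) : eval a G = 0 := by
    by_contra hne
    simpa [hG] using ha G hne
  have ha0 : a ≠ 0 := by
    rintro rfl
    have heval := hvanish (G := MvPolynomial.X j - 1) (by simp [coord_self hj])
    rw [map_sub, eval_X, map_one, Pi.zero_apply, zero_sub, neg_eq_zero] at heval
    exact one_ne_zero heval
  have hker : extend F X.ideal ≤ RingHom.ker (eval a) :=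
    fun G hG => hvanish (extend_le_ker_aeval_coord X.homogeneous j hG)
  refine ⟨⟨_, mk_mem_zeroLocus X.homogeneous ha0 hker⟩, fun f hf => ?_⟩
  obtain ⟨d, G, H, hG, hH, hHQ, hfrac⟩ := hf
  obtain ⟨c, hc⟩ := Projectivization.exists_smul_eq_mk_rep F a ha0
  have hHa : eval a H ≠ 0 := fun hzero => hHQ <| by
    change eval (Projectivization.mk F a ha0).rep H = 0
    rw [← hc, Units.smul_def, eval_smul_of_isHomogeneous hH, hzero, mul_zero]
  have hf : f = ratio _ hG hH := Subtype.ext hfrac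
  rw [hf, ratio_eq_aeval_div hG hH hj, ← V.valuation_le_one_iff, map_div₀, ha H hHa, div_one,
    V.valuation_le_one_iff]
  exact eval₂_mem (fun _ _ => hV _) hcoord

theorem mem_range_of_valuation_le_one [IsAlgClosed F] {f : X.Func}
    (hf : ∀ P, X.valuation P f ≤ 1) : f ∈ Set.range (algebraMap F X.Func) := by
  by_contra hconst
  obtain ⟨j, hj⟩ := exists_X_notMem (I := extend F X.ideal) hconst
  have hint : f ∉ (integralClosure F X.Func).toSubring := fun hmem =>
    ((transcendental_or_mem_range (F := F) f).resolve_right hconst) (IsIntegral.isAlgebraic hmem)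
  obtain ⟨V, hV, hfV⟩ := Subring.exists_le_valuationSubring_of_isIntegrallyClosedIn hint
  obtain ⟨Q, hQ⟩ := X.exists_localRing_le V (fun c => hV (isIntegral_algebraMap (x := c))) hj
  exact hfV (hQ f (valuation_le_one_iff.mp (hf Q)))

theorem isPlaceSystem [IsAlgClosed F] : IsPlaceSystem F fun P : X.Point => X.valuation P where
  ordGE_algebraMap P c := ordGE_zero_iff_le_one.mpr (X.valuation_algebraMap_le_one P c)
  exists_residue P f hf := by
    obtain ⟨c, hc⟩ := X.exists_valuation_sub_lt_one P (ordGE_zero_iff_le_one.mp hf)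
    exact ⟨c, ordGE_one_iff_lt_one.mpr hc⟩
  exists_uniformizer := X.exists_uniformizer
  exists_separating S P hP := by
    have : Infinite F := IsAlgClosed.instInfinite
    simpa only [ordGE_one_iff_lt_one] using X.exists_separating S hP
  mem_range_of_regular f hf :=
    X.mem_range_of_valuation_le_one fun P => ordGE_zero_iff_le_one.mp (hf P)
  finiteDimensional _ hx := X.finiteDimensional hx
  exists_generators := by simpa only [ordGE_zero_iff_le_one] using X.exists_generators

end Curve

/-! ### Rational points and the Frobenius morphism -/

theorem isHomogeneous_expand {R σ : Type*} [CommSemiring R] {G : MvPolynomial σ R} {d : ℕ}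
    (hG : G.IsHomogeneous d) (q : ℕ) : (MvPolynomial.expand q G).IsHomogeneous (q * d) :=
  hG.aeval _ fun i => MvPolynomial.isHomogeneous_X_pow i q

namespace Curve

open MvPolynomial

variable {k F : Type*} [Field k] [Field F] [Algebra k F] {n : ℕ} {X : Curve k F n} {P : X.Point}

theorem ordGE_aeval_sub_algebraMap_eval {σ : Type*} {y : σ → X.Func} {a : σ → F} {m : ℤ}
    (hy : ∀ i, OrdGE (X.valuation P) 0 (y i))
    (hya : ∀ i, OrdGE (X.valuation P) m (y i - algebraMap F X.Func (a i)))
    (G : MvPolynomial σ F) :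
    OrdGE (X.valuation P) m (aeval y G - algebraMap F X.Func (eval a G)) := by
  induction G using MvPolynomial.induction_on with
  | C c => simpa using OrdGE.zero m
  | add p q hp hq =>
    rw [map_add, map_add, map_add, add_sub_add_comm]
    exact hp.add hq
  | mul_X p i hp =>
    have hc : OrdGE (X.valuation P) 0 (algebraMap F X.Func (eval a p)) :=
      ordGE_zero_iff_le_one.mpr (X.valuation_algebraMap_le_one P _)
    have hsplit : aeval y (p * MvPolynomial.X i) -
        algebraMap F X.Func (eval a (p * MvPolynomial.X i)) =
        (aeval y p - algebraMap F X.Func (eval a p)) * y i +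
          algebraMap F X.Func (eval a p) * (y i - algebraMap F X.Func (a i)) := by
      simp only [map_mul, aeval_X, eval_X]
      ring
    exact hsplit ▸ (hp.mul_right (hy i)).add (OrdGE.mul_left hc (hya i))

theorem valuation_coord_sub_lt_one {j : Fin (n + 1)} (hj : P.1.rep j ≠ 0) (i : Fin (n + 1)) :
    X.valuation P (coord (extend F X.ideal) i j - algebraMap F X.Func (P.1.rep i / P.1.rep j)) <
      1 := by
  rw [coord, ratio_sub_algebraMap _ _ (X_notMem hj)]
  exact valuation_ratio_lt_one _ _ (by simpa using hj) (by simp [hj])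

theorem exists_valuation_coord_sub_eq {j : Fin (n + 1)} (hj : P.1.rep j ≠ 0) :
    ∃ i, X.valuation P
      (coord (extend F X.ideal) i j - algebraMap F X.Func (P.1.rep i / P.1.rep j)) = exp (-1) := by
  by_contra! hne
  have hcoord (i : Fin (n + 1)) : OrdGE (X.valuation P) 0 (coord (extend F X.ideal) i j) :=
    ordGE_zero_iff_le_one.mpr (valuation_ratio_le_one _ _ (by simpa using hj))
  have htwo (i : Fin (n + 1)) : OrdGE (X.valuation P) 2
      (coord (extend F X.ideal) i j - algebraMap F X.Func (P.1.rep i / P.1.rep j)) := by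
    by_contra hlt
    exact hne i (eq_exp_neg_iff_ordGE.mpr
      ⟨ordGE_one_iff_lt_one.mpr (valuation_coord_sub_lt_one hj i), hlt⟩)
  obtain ⟨t, ht⟩ := X.exists_uniformizer P
  obtain ⟨ht_one, ht_two⟩ := eq_exp_neg_iff_ordGE.mp ht
  obtain ⟨d, G, H, hG, hH, hHP, rfl⟩ :=
    exists_ratio_of_valuation_le_one (ordGE_zero_iff_le_one.mp (ht_one.mono zero_le_one))
  have hGP : eval P.1.rep G = 0 := by
    by_contra hGP
    exact (ordGE_one_iff_lt_one.mp ht_one).ne (valuation_ratio_eq_one hG hH hHP hGP)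
  have heval : eval (fun i => P.1.rep i / P.1.rep j) G = 0 := by
    have hsmul : (fun i => P.1.rep i / P.1.rep j) = (P.1.rep j)⁻¹ • P.1.rep :=
      funext fun _ => div_eq_inv_mul _ _
    rw [hsmul, eval_smul_of_isHomogeneous hG, hGP, mul_zero]
  have hnum : OrdGE (X.valuation P) 2 (aeval (fun i => coord (extend F X.ideal) i j) G) := by
    simpa [heval] using ordGE_aeval_sub_algebraMap_eval hcoord htwo G
  have hden : X.valuation P (aeval (fun i => coord (extend F X.ideal) i j) H) = 1 := by
    simpa only [aeval_coord hH] using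
      valuation_ratio_eq_one hH (isHomogeneous_X_pow j d) (by simp [hj]) hHP
  refine ht_two ?_
  rw [OrdGE, ratio_eq_aeval_div hG hH (X_notMem hj), map_div₀, hden, div_one]
  exact hnum

theorem rep_div_rep_mem_range (hP : P ∈ X.rationalPoints) (i j : Fin (n + 1)) :
    P.1.rep i / P.1.rep j ∈ Set.range (algebraMap k F) := by
  obtain ⟨v, hv, hPv⟩ := hP
  obtain ⟨c, hc⟩ := Projectivization.exists_smul_eq_mk_rep F _ hv
  refine ⟨v i / v j, ?_⟩
  rw [hPv, ← hc, map_div₀]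
  exact (mul_div_mul_left _ _ c.ne_zero).symm

theorem exists_uniformizer_mem_rationalFunctions (hP : P ∈ X.rationalPoints) :
    ∃ t ∈ X.rationalFunctions, X.valuation P t = exp (-1) := by
  obtain ⟨j, hj⟩ := exists_rep_ne_zero P
  obtain ⟨i, ht⟩ := exists_valuation_coord_sub_eq hj
  obtain ⟨a, ha⟩ := rep_div_rep_mem_range hP i j
  refine ⟨_, ⟨1, MvPolynomial.X i - C a * MvPolynomial.X j, MvPolynomial.X j,
    (isHomogeneous_X k i).sub (isHomogeneous_C_mul_X a j), isHomogeneous_X k j,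
    by simpa using X_notMem hj, ?_⟩, ht⟩
  rw [← ha, coord, ratio_sub_algebraMap _ _ (X_notMem hj)]
  simp [ratio]

section Fintype

variable [Fintype k]

theorem exists_pow_card_eq_smul (hP : P ∈ X.rationalPoints) :
    ∃ c : F, c ≠ 0 ∧ (fun i => P.1.rep i ^ Fintype.card k) = c • P.1.rep := by
  obtain ⟨j, hj⟩ := exists_rep_ne_zero P
  refine ⟨P.1.rep j ^ (Fintype.card k - 1), pow_ne_zero _ hj, funext fun i => ?_⟩
  obtain ⟨a, ha⟩ := rep_div_rep_mem_range hP i j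
  rw [eq_div_iff hj] at ha
  rw [Pi.smul_apply, smul_eq_mul, ← ha, mul_pow, ← map_pow, FiniteField.pow_card,
    mul_left_comm, ← pow_succ, Nat.sub_add_cancel Fintype.card_pos]

variable [Algebra.IsAlgebraic k F]

theorem frobeniusPullback_of_mem_rationalFunctions {f : X.Func} (hf : f ∈ X.rationalFunctions) :
    frobeniusPullback X.ideal f = f ^ Fintype.card k := by
  obtain ⟨d, G, H, -, -, -, hfrac⟩ := hf
  refine Subtype.ext ?_
  change frobeniusFrac X.ideal f.1 = f.1 ^ Fintype.card k
  rw [hfrac, frobeniusFrac_frac, expand_map_algebraMap, expand_map_algebraMap, frac, frac, map_pow,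
    map_pow, map_pow, map_pow, div_pow]

theorem valuation_frobeniusPullback_le_one (hP : P ∈ X.rationalPoints) {f : X.Func}
    (hf : X.valuation P f ≤ 1) : X.valuation P (frobeniusPullback X.ideal f) ≤ 1 := by
  obtain ⟨d, G, H, hG, hH, hHP, hfrac⟩ := valuation_le_one_iff.mp hf
  obtain ⟨c, hc, hrep⟩ := exists_pow_card_eq_smul hP
  refine valuation_le_one_iff.mpr ⟨_, _, _, isHomogeneous_expand hG (Fintype.card k),
    isHomogeneous_expand hH (Fintype.card k), ?_, ?_⟩
  · rw [eval_expand]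
    change eval (fun i => P.1.rep i ^ Fintype.card k) H ≠ 0
    rw [hrep, eval_smul_of_isHomogeneous hH]
    exact mul_ne_zero (pow_ne_zero _ hc) hHP
  · change frobeniusFrac X.ideal f.1 = _
    rw [hfrac, frobeniusFrac_frac]

end Fintype

end Curve

/-! ### The bound for the number of rational points -/

namespace Curve

variable {k F : Type*} [Field k] [Field F] [Algebra k F] {n : ℕ} (X : Curve k F n)

theorem riemannRochSpace_eq_rrSpace (h : IsPlaceSystem F fun P : X.Point => X.valuation P)
    (D : X.Div) : X.riemannRochSpace D = h.rrSpace D := by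
  ext f
  change (f ≠ 0 → ∀ P, 0 ≤ D P + X.ord P f) ↔ ∀ P, OrdGE (X.valuation P) (-D P) f
  simp only [OrdGE, neg_neg, ← X.ord_iff]
  tauto

section Linear

variable {E : X.Div}

theorem ordGE_of_mem_riemannRochSpace {f : X.Func} (hf : f ∈ X.riemannRochSpace E) (P : X.Point) :
    OrdGE (X.valuation P) (-E P) f := by
  rw [OrdGE, neg_neg]
  exact (X.ord_iff P f _).mp fun hf0 => hf hf0 P

theorem ordGE_of_mem_span {α : Type*} {f : α → X.Func} {P : X.Point} {m : ℤ}
    (hf : ∀ j, OrdGE (X.valuation P) m (f j)) {g : X.Func}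
    (hg : g ∈ Submodule.span F (Set.range f)) : OrdGE (X.valuation P) m g := by
  induction hg using Submodule.span_induction with
  | mem g hg => exact hg.elim fun j hj => hj ▸ hf j
  | zero => exact OrdGE.zero _
  | add a b _ _ ha hb => exact ha.add hb
  | smul c a _ ha =>
    rw [Algebra.smul_def]
    exact OrdGE.mul_left (ordGE_zero_iff_le_one.mpr (X.valuation_algebraMap_le_one P c)) ha

theorem exists_ord_eq_neg_of_basePointFree {α : Type*} {f : α → X.Func}
    (hf : Submodule.span F (Set.range f) ≤ X.riemannRochSpace E)
    (hbpf : X.BasePointFree (X.linearSeries E (Submodule.span F (Set.range f)))) (P : X.Point) :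
    ∃ j, f j ≠ 0 ∧ X.ord P (f j) = -E P := by
  obtain ⟨D, ⟨g, hg, hg0, hD⟩, hDP⟩ := hbpf P
  by_contra! hne
  have hgt (j : α) : OrdGE (X.valuation P) (-E P + 1) (f j) := by
    by_cases hj : f j = 0
    · exact hj ▸ OrdGE.zero _
    have hle : 0 ≤ E P + X.ord P (f j) := hf (Submodule.subset_span ⟨j, rfl⟩) hj P
    refine (ordGE_iff_le_vOrd hj).mpr (?_ : _ ≤ X.ord P (f j))
    have := hne j hj
    lia
  have hord : -E P + 1 ≤ X.ord P g := (ordGE_iff_le_vOrd hg0).mp (X.ordGE_of_mem_span hgt hg)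
  have := hD P
  lia

end Linear

section IsAlgClosed

variable [IsAlgClosed F]

theorem degree_add_one_sub_finrank_le_genus {x : X.Func} (hx : Transcendental F x) (D : X.Div) :
    X.degree D + 1 - Module.finrank F (X.riemannRochSpace D) ≤ X.genus := by
  obtain ⟨C, hC⟩ := X.isPlaceSystem.riemann_inequality hx
  refine le_ciSup (f := fun D : X.Div =>
    X.degree D + 1 - (Module.finrank F (X.riemannRochSpace D) : ℤ)) ⟨C + 1, ?_⟩ D
  rintro _ ⟨D, rfl⟩
  have hD := hC D
  rw [← X.riemannRochSpace_eq_rrSpace] at hD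
  change D.degree + 1 - _ ≤ _
  lia

theorem degree_eq_of_mem_linearSeries {E D : X.Div} {V : Submodule F X.Func}
    (hD : D ∈ X.linearSeries E V) : X.degree D = X.degree E := by
  obtain ⟨f, -, hf, hDE⟩ := hD
  obtain rfl : D = E + X.isPlaceSystem.divisor f := Finsupp.ext hDE
  change (E + X.isPlaceSystem.divisor f).degree = E.degree
  rw [map_add, X.isPlaceSystem.degree_divisor hf, add_zero]

theorem linearSeries_nonempty (E : X.Div) {V : Submodule F X.Func} {f : X.Func} (hf : f ∈ V)
    (hf0 : f ≠ 0) : (X.linearSeries E V).Nonempty :=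
  ⟨E + X.isPlaceSystem.divisor f, f, hf, hf0, fun _ => rfl⟩

theorem IsLinearSeries.degree_eq {r : ℕ} {d : ℤ} {E : X.Div} {V : Submodule F X.Func}
    (hE : X.IsLinearSeries (X.linearSeries E V) r d) {f : X.Func} (hf : f ∈ V) (hf0 : f ≠ 0) :
    X.degree E = d := by
  obtain ⟨E', V', -, rfl, -, heq⟩ := hE
  obtain ⟨D, hD⟩ := X.linearSeries_nonempty E hf hf0
  rw [← X.degree_eq_of_mem_linearSeries hD, X.degree_eq_of_mem_linearSeries (heq ▸ hD)]

end IsAlgClosed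

variable [Fintype k] [Algebra.IsAlgebraic k F]

theorem frobeniusOrderSet_eq_minorSet {r : ℕ} {x : X.Func} (hx : IsSeparatingVariable F x)
    {f : Fin (r + 1) → X.Func} (hf : ∀ j, f j ∈ X.rationalFunctions) :
    X.frobeniusOrderSet x hx f = minorSet (fun j => f j ^ Fintype.card k) fun m j =>
      PowerSeries.coeff m ((exists_isTaylorHom F x hx).choose (f j)) := by
  simp only [frobeniusOrderSet, frobeniusMatrix,
    fun j => frobeniusPullback_of_mem_rationalFunctions (hf j)]
  rfl

theorem mul_card_rationalPoints_le [IsAlgClosed F] {r : ℕ} {d : ℤ} {𝒟 : Set X.Div}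
    (h𝒟 : X.IsLinearSeries 𝒟 r d) (hbpf : X.BasePointFree 𝒟) {ν : Fin r → ℕ}
    (hν : X.IsFrobeniusOrders 𝒟 ν) :
    r * (X.rationalPoints.ncard : ℤ) ≤
      (∑ i, (ν i : ℤ)) * (2 * X.genus - 2) + (Fintype.card k + r) * d := by
  obtain ⟨E, f, x, hx, hfk, hli, hfE, rfl, hmin⟩ := hν
  have hmem (j : Fin (r + 1)) : f j ∈ Submodule.span F (Set.range f) :=
    Submodule.subset_span ⟨j, rfl⟩
  rw [X.frobeniusOrderSet_eq_minorSet hx hfk] at hmin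
  rw [← h𝒟.degree_eq X (hmem 0) (hli.ne_zero 0),
    Set.ncard_eq_toFinset_card _ X.rationalPoints_finite]
  refine X.isPlaceSystem.mul_card_fixedPoints_le hx (exists_isTaylorHom F x hx).choose_spec
    Fintype.one_lt_card hmin E (fun P j => X.ordGE_of_mem_riemannRochSpace (hfE (hmem j)) P)
    (X.exists_ord_eq_neg_of_basePointFree hfE hbpf)
    (fun j => frobeniusPullback_of_mem_rationalFunctions (hfk j)) _ (fun P hP => ?_) fun A => ?_
  · rw [Set.Finite.mem_toFinset] at hP
    obtain ⟨t, ht, htP⟩ := exists_uniformizer_mem_rationalFunctions hP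
    exact ⟨fun g hg => ordGE_zero_iff_le_one.mpr
      (valuation_frobeniusPullback_le_one hP (ordGE_zero_iff_le_one.mp hg)),
      t, htP, frobeniusPullback_of_mem_rationalFunctions ht⟩
  · rw [← X.riemannRochSpace_eq_rrSpace]
    exact X.degree_add_one_sub_finrank_le_genus hx.transcendental A

end Curve

end StohrVoloch

theorem theorem3p1 {k F : Type*} [Field k] [Fintype k] [Field F] [Algebra k F] [IsAlgClosure k F]
    {n : ℕ} (X : StohrVoloch.Curve k F n) (r : ℕ) (hr : 1 ≤ r) (d : ℤ) (𝒟 : Set X.Div)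
    (h𝒟 : X.IsLinearSeries 𝒟 r d) (hbpf : X.BasePointFree 𝒟) (hdef : X.IsDefinedOver 𝒟)
    (ν : Fin r → ℕ) (hν : X.IsFrobeniusOrders 𝒟 ν) :
    (X.rationalPoints.ncard : ℚ) ≤
      ((∑ i, (ν i : ℚ)) * (2 * X.genus - 2) + (Fintype.card k + r) * d) / r := by
  have : IsAlgClosed F := IsAlgClosure.isAlgClosed k
  have hr_pos : (0 : ℚ) < r := mod_cast hr
  rw [le_div_iff₀' hr_pos]
  exact_mod_cast X.mul_card_rationalPoints_le h𝒟 hbpf hν
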